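/- Let $\mathcal H$ be a two-dimensional complex Hilbert space with a fixed orthonormal basis, $\mathcal B(\mathcal H)$ its linear operators with $\langle A,B\rangle=\mathrm{tr}(A^*B)$, $U(\mathcal H)$ its unitary group, $s_0=\tfrac12 I$ and $s_j=\tfrac12\sigma_j$ ($j=1,2,3$), where the $\sigma_j$ have the Pauli matrices in the fixed basis. The defining representation of $SU(2)$ acts in $\mathcal H$ through this basis. Let $\{\Lambda_t\}_{t\ge0}$ be a semigroup of linear maps on $\mathcal B(\mathcal H)$: $\Lambda_0=\mathrm{id}$, $\Lambda_{t+s}=\Lambda_t\Lambda_s$ and $\lim_{t\downarrow0}\Lambda_tA=A$ for every $A$. Fix $k\in\{1,2,3\}$ and a complex conjugation (selfadjoint antiunitary operator) $J$ in $\mathcal H$. (A) The following are equivalent. 1. Every $\Lambda_t$ is positive, trace-preserving and unital. 2. There are a locally compact space $X$, a Borel map $\pi:X\to U(\mathcal H)$ and finite signed Borel measures $\{\sigma_t\}_{t\ge0}$ on $X$ with $|\sigma_t|(X)=1$ ($|\sigma_t|$ the total variation) such that, for all $t\ge 0$ and $A$, $$\Lambda_tA=\mathrm{tr}(A)\,s_0+2\langle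 s_k,A\rangle\int_X\pi(x)s_k\pi(x)^*\,d\sigma_t(x)+\sum_{l\in\{1,2,3\},\,l\ne k}2\langle s_l,A\rangle\int_X\pi(x)s_l\pi(x)^*\,d|\sigma_t|(x).$$ 3. There are a locally compact space $X$, a Borel map $\pi:X\to U(\mathcal H)$ and finite positive Borel measures $\{\mu_t\}_{t\ge0},\{\nu_t\}_{t\ge0}$ on $X$ with $(\mu_t+\nu_t)(X)=1$ such that, for all $t\ge 0$ and $A$, $$\Lambda_tA=\int_X\pi(x)A\pi(x)^*\,d\mu_t(x)+\int_X\pi(x)(JA^*J)\pi(x)^*\,d\nu_t(x).$$ Moreover, in 2 and in 3 one can always take $X=SU(2)$ and $\pi$ the defining representation; that is, 1, 2, 3 are also equivalent to 2 and to 3 with this choice. (B) Every $\Lambda_t$ is completely positive, trace-preserving and unital if and only if 2 holds with probability measures $\sigma_t$, and if and only if 3 holds with probability measures $\mu_t$; again one can always take $X=SU(2)$ and $\pi$ the defining representation. In this case $\{\Lambda_t\}$ is a twirling semigroup: there are a locally compact, second countable, Hausdorff topological group $G$, a continuous unitary representation $\pi$ of $G$ in $\mathcal H$ and a convolution semigroup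 of probability measures $\{\mu_t\}_{t\ge0}$ on $G$ ($\mu_0=\delta_e$, $\mu_s*\mu_t=\mu_{s+t}$, $\mu_t\to\delta_e$ weakly as $t\downarrow0$) with $\Lambda_tA=\int_G\pi(g)A\pi(g)^*\,d\mu_t(g)$ for all $t\ge 0$ and $A$. (C) Let $E$ be any of the following functions of density operators $\rho$ with eigenvalues $p_i$ (repeated with multiplicity): the Tsallis entropy $\frac1{1-q}(\sum_ip_i^q-1)$ or the Rényi entropy $\frac1{1-q}\ln\sum_ip_i^q$, $q>0$ (for $q=1$ both mean the von Neumann entropy $-\sum_ip_i\ln p_i$), or $1-\|\rho\|_p$, $1<p\le\infty$, with the Schatten $p$-norm. If every $\Lambda_t$ is positive and trace-preserving, then $E(\Lambda_{t+s}\rho)\ge E(\Lambda_t\rho)$ for all density operators $\rho$ and all $t,s\ge0$ if and only if 2 holds, and if and only if 3 holds. -/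

import Mathlib

open MeasureTheory Filter Topology
open scoped NNReal ENNReal

universe u v

namespace QubitSemigroup

noncomputable section

section General

variable {H : Type*} [NormedAddCommGroup H] [InnerProductSpace ℂ H]

/-- The trace of an operator in `H`. -/
def opTrace (A : H →L[ℂ] H) : ℂ := LinearMap.trace ℂ H (A : H →ₗ[ℂ] H)

/-- A (strongly continuous) one-parameter semigroup of linear maps acting in the operators on `H`,
indexed by the non-negative reals. -/
structure IsSemigroup (Λ : ℝ≥0 → (H →L[ℂ] H) →ₗ[ℂ] (H →L[ℂ] H)) : Prop where
  map_zero : Λ 0 = LinearMap.id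
  map_add : ∀ s t : ℝ≥0, Λ (t + s) = (Λ t).comp (Λ s)
  tendsto_zero : ∀ A : H →L[ℂ] H, Tendsto (fun t => Λ t A) (𝓝[>] 0) (𝓝 A)

/-- A linear map sending positive operators to positive operators. -/
def IsPositiveMap (Φ : (H →L[ℂ] H) →ₗ[ℂ] (H →L[ℂ] H)) : Prop :=
  ∀ A : H →L[ℂ] H, A.IsPositive → (Φ A).IsPositive

def IsTracePreserving (Φ : (H →L[ℂ] H) →ₗ[ℂ] (H →L[ℂ] H)) : Prop :=
  ∀ A : H →L[ℂ] H, opTrace (Φ A) = opTrace A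

def IsUnitalMap (Φ : (H →L[ℂ] H) →ₗ[ℂ] (H →L[ℂ] H)) : Prop := Φ 1 = 1

/-- A density operator: positive with unit trace. -/
def IsDensity (ρ : H →L[ℂ] H) : Prop := ρ.IsPositive ∧ opTrace ρ = 1

/-- A complex conjugation: a selfadjoint antiunitary operator. -/
def IsComplexConjugation (J : H ≃ₛₗᵢ[starRingEnd ℂ] H) : Prop :=
  ∀ x y : H, inner ℂ (J x) y = inner ℂ (J y) x

end General

section Hilbert

variable {H : Type*} [NormedAddCommGroup H] [InnerProductSpace ℂ H] [CompleteSpace H]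

/-- Complete positivity of a linear map on the C⋆-algebra of bounded operators in `H`. -/
def IsCompletelyPositiveMap (Φ : (H →L[ℂ] H) →ₗ[ℂ] (H →L[ℂ] H)) : Prop :=
  ∃ Ψ : CompletelyPositiveMap (H →L[ℂ] H) (H →L[ℂ] H), Ψ.toLinearMap = Φ

/-- The Hilbert-Schmidt scalar product `tr (A* B)`. -/
def hsInner (A B : H →L[ℂ] H) : ℂ := opTrace (star A * B)

/-- The operator `J A* J`. -/
def transposition (J : H ≃ₛₗᵢ[starRingEnd ℂ] H) (A : H →L[ℂ] H) : H →L[ℂ] H :=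
  (J : H →SL[starRingEnd ℂ] H).comp
    ((ContinuousLinearMap.adjoint A).comp (J : H →SL[starRingEnd ℂ] H))

/-- The operator having a given matrix in the orthonormal basis `b`; this is an isomorphism of
⋆-algebras. -/
def matOp (b : OrthonormalBasis (Fin 2) ℂ H) :
    Matrix (Fin 2) (Fin 2) ℂ ≃⋆ₐ[ℂ] (H →L[ℂ] H) :=
  (Matrix.toEuclideanCLM (n := Fin 2) (𝕜 := ℂ)).trans b.repr.symm.conjStarAlgEquiv

/-- The three Pauli matrices. -/
def pauli : Fin 3 → Matrix (Fin 2) (Fin 2) ℂ :=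
  ![!![0, 1; 1, 0], !![0, -Complex.I; Complex.I, 0], !![1, 0; 0, -1]]

/-- The operators `s₁, s₂, s₃`: one half of the Pauli operators relative to the basis `b`. -/
def spin (b : OrthonormalBasis (Fin 2) ℂ H) (j : Fin 3) : H →L[ℂ] H :=
  (1 / 2 : ℂ) • matOp b (pauli j)

/-- The operator `s₀ = 1 / 2`. -/
def spinZero (H : Type*) [NormedAddCommGroup H] [InnerProductSpace ℂ H] : H →L[ℂ] H :=
  (1 / 2 : ℂ) • (1 : H →L[ℂ] H)

/-- The group `SU(2)`. -/
abbrev SU2 : Type := Matrix.specialUnitaryGroup (Fin 2) ℂ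

instance : MeasurableSpace SU2 := borel SU2

instance : BorelSpace SU2 := ⟨rfl⟩

/-- The defining representation of `SU(2)`, acting in `H` through the orthonormal basis `b`. -/
def definingRep (b : OrthonormalBasis (Fin 2) ℂ H) : SU2 →* unitary (H →L[ℂ] H) where
  toFun g := ⟨matOp b (g : Matrix (Fin 2) (Fin 2) ℂ),
    Unitary.map_mem (matOp b) (Matrix.specialUnitaryGroup_le_unitaryGroup g.2)⟩
  map_one' := Subtype.ext (map_one (matOp b))
  map_mul' g h := Subtype.ext (map_mul (matOp b) (g : Matrix (Fin 2) (Fin 2) ℂ) h)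

/-- The maps `Λ t` are given, through the signed measures `σ t` of total variation norm one, by
`tr(A) s₀ + 2 ⟨s_k, A⟩ ∫ π s_k π* dσ_t + ∑_{l ≠ k} 2 ⟨s_l, A⟩ ∫ π s_l π* d|σ_t|`. -/
def IsSignedForm (b : OrthonormalBasis (Fin 2) ℂ H) (k : Fin 3)
    {X : Type*} [MeasurableSpace X] (π : X → unitary (H →L[ℂ] H)) (σ : ℝ≥0 → SignedMeasure X)
    (Λ : ℝ≥0 → (H →L[ℂ] H) →ₗ[ℂ] (H →L[ℂ] H)) : Prop :=
  (∀ t, (σ t).totalVariation Set.univ = 1) ∧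
  ∀ (t : ℝ≥0) (A : H →L[ℂ] H),
    Λ t A = opTrace A • spinZero H
      + (2 * hsInner (spin b k) A) •
          (∫ᵛ x, ((π x : H →L[ℂ] H) * spin b k * star (π x : H →L[ℂ] H)) ∂<•(σ t))
      + ∑ l ∈ Finset.univ.erase k, (2 * hsInner (spin b l) A) •
          (∫ x, (π x : H →L[ℂ] H) * spin b l * star (π x : H →L[ℂ] H) ∂(σ t).totalVariation)

/-- The maps `Λ t` are given, through positive measures `μ t`, `ν t` with `(μ t + ν t)(X) = 1`, by
`∫ π A π* dμ_t + ∫ π (J A* J) π* dν_t`. -/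
def IsPairForm (J : H ≃ₛₗᵢ[starRingEnd ℂ] H)
    {X : Type*} [MeasurableSpace X] (π : X → unitary (H →L[ℂ] H)) (μ ν : ℝ≥0 → Measure X)
    (Λ : ℝ≥0 → (H →L[ℂ] H) →ₗ[ℂ] (H →L[ℂ] H)) : Prop :=
  (∀ t, (μ t + ν t) Set.univ = 1) ∧
  ∀ (t : ℝ≥0) (A : H →L[ℂ] H),
    Λ t A = (∫ x, (π x : H →L[ℂ] H) * A * star (π x : H →L[ℂ] H) ∂(μ t))
      + ∫ x, (π x : H →L[ℂ] H) * transposition J A * star (π x : H →L[ℂ] H) ∂(ν t)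

/-- The signed measures `σ t` are probability measures. -/
def IsProbabilityFamily {X : Type*} [MeasurableSpace X] (σ : ℝ≥0 → SignedMeasure X) : Prop :=
  ∀ t, 0 ≤ σ t ∧ σ t Set.univ = 1

/-- Existence of the signed-measure expression, on some locally compact space and for some Borel
map into the unitary group. -/
def HasSignedForm {H : Type v} [NormedAddCommGroup H] [InnerProductSpace ℂ H]
    [CompleteSpace H] (b : OrthonormalBasis (Fin 2) ℂ H) (k : Fin 3)
    (Λ : ℝ≥0 → (H →L[ℂ] H) →ₗ[ℂ] (H →L[ℂ] H)) : Prop :=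
  ∃ (X : Type u) (_ : TopologicalSpace X) (_ : LocallyCompactSpace X) (_ : MeasurableSpace X)
    (_ : BorelSpace X) (π : X → unitary (H →L[ℂ] H)) (σ : ℝ≥0 → SignedMeasure X),
    Measurable π ∧ IsSignedForm b k π σ Λ

/-- As `HasSignedForm`, with probability measures. -/
def HasProbSignedForm {H : Type v} [NormedAddCommGroup H] [InnerProductSpace ℂ H]
    [CompleteSpace H] (b : OrthonormalBasis (Fin 2) ℂ H) (k : Fin 3)
    (Λ : ℝ≥0 → (H →L[ℂ] H) →ₗ[ℂ] (H →L[ℂ] H)) : Prop :=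
  ∃ (X : Type u) (_ : TopologicalSpace X) (_ : LocallyCompactSpace X) (_ : MeasurableSpace X)
    (_ : BorelSpace X) (π : X → unitary (H →L[ℂ] H)) (σ : ℝ≥0 → SignedMeasure X),
    Measurable π ∧ IsProbabilityFamily σ ∧ IsSignedForm b k π σ Λ

/-- Existence of the expression by a pair of positive measures, on some locally compact space and
for some Borel map into the unitary group. -/
def HasPairForm {H : Type v} [NormedAddCommGroup H] [InnerProductSpace ℂ H]
    [CompleteSpace H] (J : H ≃ₛₗᵢ[starRingEnd ℂ] H)
    (Λ : ℝ≥0 → (H →L[ℂ] H) →ₗ[ℂ] (H →L[ℂ] H)) : Prop :=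
  ∃ (X : Type u) (_ : TopologicalSpace X) (_ : LocallyCompactSpace X) (_ : MeasurableSpace X)
    (_ : BorelSpace X) (π : X → unitary (H →L[ℂ] H)) (μ ν : ℝ≥0 → Measure X),
    Measurable π ∧ IsPairForm J π μ ν Λ

/-- As `HasPairForm`, with the first family consisting of probability measures. -/
def HasProbPairForm {H : Type v} [NormedAddCommGroup H] [InnerProductSpace ℂ H]
    [CompleteSpace H] (J : H ≃ₛₗᵢ[starRingEnd ℂ] H)
    (Λ : ℝ≥0 → (H →L[ℂ] H) →ₗ[ℂ] (H →L[ℂ] H)) : Prop :=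
  ∃ (X : Type u) (_ : TopologicalSpace X) (_ : LocallyCompactSpace X) (_ : MeasurableSpace X)
    (_ : BorelSpace X) (π : X → unitary (H →L[ℂ] H)) (μ ν : ℝ≥0 → Measure X),
    Measurable π ∧ (∀ t, IsProbabilityMeasure (μ t)) ∧ IsPairForm J π μ ν Λ

/-- A (continuous) convolution semigroup of probability measures on a topological group. -/
structure IsConvolutionSemigroup {G : Type*} [Group G] [TopologicalSpace G] [MeasurableSpace G]
    (μ : ℝ≥0 → Measure G) : Prop where
  isProbabilityMeasure : ∀ t, IsProbabilityMeasure (μ t)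
  map_zero : μ 0 = Measure.dirac 1
  map_add : ∀ s t : ℝ≥0, μ (s + t) = (μ s).mconv (μ t)
  tendsto_zero : ∀ f : BoundedContinuousFunction G ℝ,
    Tendsto (fun t => ∫ g, f g ∂(μ t)) (𝓝[>] 0) (𝓝 (f 1))

/-- Twirling semigroups: `Λ_t A = ∫ π(g) A π(g)* dμ_t(g)`, for a continuous unitary representation
`π` of a locally compact, second countable, Hausdorff group and a convolution semigroup of
probability measures on that group. -/
def IsTwirlingSemigroup {H : Type v} [NormedAddCommGroup H] [InnerProductSpace ℂ H]
    [CompleteSpace H] (Λ : ℝ≥0 → (H →L[ℂ] H) →ₗ[ℂ] (H →L[ℂ] H)) : Prop :=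
  ∃ (G : Type u) (_ : Group G) (_ : TopologicalSpace G) (_ : IsTopologicalGroup G)
    (_ : LocallyCompactSpace G) (_ : SecondCountableTopology G) (_ : T2Space G)
    (_ : MeasurableSpace G) (_ : BorelSpace G) (π : G →* unitary (H →L[ℂ] H))
    (μ : ℝ≥0 → Measure G),
    Continuous π ∧ IsConvolutionSemigroup μ ∧
    ∀ (t : ℝ≥0) (A : H →L[ℂ] H),
      Λ t A = ∫ g, (π g : H →L[ℂ] H) * A * star (π g : H →L[ℂ] H) ∂(μ t)

end Hilbert

section Entropy

variable {H : Type*} [NormedAddCommGroup H] [InnerProductSpace ℂ H] [FiniteDimensional ℂ H]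

/-- The eigenvalues, repeated according to their multiplicity, of an operator with real
spectrum. -/
def eigenvalues (ρ : H →L[ℂ] H) : Multiset ℝ :=
  (LinearMap.charpoly (ρ : H →ₗ[ℂ] H)).roots.map Complex.re

/-- The von Neumann entropy `- ∑ p log p`. -/
def vonNeumannEntropy (ρ : H →L[ℂ] H) : ℝ := ((eigenvalues ρ).map Real.negMulLog).sum

/-- The Tsallis entropy of parameter `q` (the von Neumann entropy for `q = 1`). -/
def tsallisEntropy (q : ℝ) (ρ : H →L[ℂ] H) : ℝ :=
  if q = 1 then vonNeumannEntropy ρ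
  else 1 / (1 - q) * (((eigenvalues ρ).map (fun p => p ^ q)).sum - 1)

/-- The Rényi entropy of parameter `q` (the von Neumann entropy for `q = 1`). -/
def renyiEntropy (q : ℝ) (ρ : H →L[ℂ] H) : ℝ :=
  if q = 1 then vonNeumannEntropy ρ
  else 1 / (1 - q) * Real.log (((eigenvalues ρ).map (fun p => p ^ q)).sum)

/-- One minus the Schatten `p`-norm of a density operator, where the Schatten `∞`-norm is the
operator norm. -/
def schattenEntropy (p : ℝ≥0∞) (ρ : H →L[ℂ] H) : ℝ :=
  if p = ⊤ then 1 - ‖ρ‖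
  else 1 - (((eigenvalues ρ).map (fun x => x ^ p.toReal)).sum) ^ (1 / p.toReal)

/-- The family of entropies: Tsallis and Rényi entropies with `0 < q`, and the functions
`1 - ‖ρ‖_p` with `1 < p ≤ ∞`. -/
inductive IsEntropy : ((H →L[ℂ] H) → ℝ) → Prop
  | tsallis (q : ℝ) (hq : 0 < q) : IsEntropy (tsallisEntropy q)
  | renyi (q : ℝ) (hq : 0 < q) : IsEntropy (renyiEntropy q)
  | schatten (p : ℝ≥0∞) (hp : 1 < p) : IsEntropy (schattenEntropy p)

/-- `Λ` does not decrease the entropy `E`. -/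
def DoesNotDecrease (E : (H →L[ℂ] H) → ℝ)
    (Λ : ℝ≥0 → (H →L[ℂ] H) →ₗ[ℂ] (H →L[ℂ] H)) : Prop :=
  ∀ ρ : H →L[ℂ] H, IsDensity ρ → ∀ t s : ℝ≥0, E (Λ t ρ) ≤ E (Λ (t + s) ρ)

end Entropy

end

end QubitSemigroup

/-! A qubit operator is `c + w·σ` with a Bloch vector `w`; for real `c` and `w` it is positive
exactly when `‖w‖ ≤ c` (`smul_one_add_bloch_nonneg_iff`). Hence a positive, trace-preserving, unital
map acts on Bloch vectors as a linear contraction. The singular value decomposition, together with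
the lifting of rotations to SU(2) (`exists_adj_pauliOp`), makes it diagonal with entries `d j` in
`[-1, 1]`, up to unitary conjugation on both sides (`exists_diagonal`).

The point `d` lies in a cube. Four vertices of this cube are the signs of the Klein four-group,
which is realized by unitary conjugations; the four antipodal vertices are these signs followed by
`w ↦ -w`, the universal NOT. So every such map is a convex mixture of unitary conjugations and of
conjugations composed with the universal NOT (`exists_mixture`). For a completely positive map `d`
lies in the tetrahedron spanned by the first four vertices, by positivity of the Choi form, and the
universal NOT disappears (`exists_mixture_of_isTwoPositive`).

Up to a unitary conjugation the universal NOT is `A ↦ J A* J`, which gives the pair form, and also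
the reversal of the `s_k` component, which gives the signed form, with the positive and negative
parts of `σ_t` as the two measures. The two parts must be mutually singular; this is arranged by
using that `g` and `-g` conjugate in the same way. All these arguments concern one `t` at a time.

The convolution semigroup needs coherence in `t`. At dyadic times `τ n` the map is within `C τ n` of
the identity (`IsSemigroup.exists_rate`), and the group elements of its mixture, signs being chosen
well, make the mean of the defining representation `O(τ n)`-close to `1`
(`exists_mixture_near_one`). The function `1 - tr(g)/2` is affine in the representation and vanishes
only at `1`, so its mean over the `k`-th convolution power is `O(k τ n)`. This tightness near `1`
lets the convolution powers converge along an ultrafilter to a continuous convolution semigroup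
(`exists_isConvolutionSemigroup`).

Each entropy is a strictly decreasing function of the Bloch length. Monotonicity at the maximally
mixed state therefore forces unitality, and conversely unital maps contract the Bloch ball
(`doesNotDecrease_iff`). -/

namespace QubitSemigroup

noncomputable section

/-! ### Traces, Pauli operators and Bloch vectors. -/

section TracesAndPauliOperators

variable {H : Type*} [NormedAddCommGroup H] [InnerProductSpace ℂ H]

section Trace

theorem opTrace_add (A B : H →L[ℂ] H) : opTrace (A + B) = opTrace A + opTrace B := by
  simp [opTrace]

theorem opTrace_sub (A B : H →L[ℂ] H) : opTrace (A - B) = opTrace A - opTrace B := by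
  simp [opTrace]

theorem opTrace_smul (c : ℂ) (A : H →L[ℂ] H) : opTrace (c • A) = c * opTrace A := by
  simp [opTrace]

theorem opTrace_real_smul (c : ℝ) (A : H →L[ℂ] H) : opTrace (c • A) = c * opTrace A := by
  rw [← Complex.coe_smul, opTrace_smul]

theorem opTrace_mul_comm (A B : H →L[ℂ] H) : opTrace (A * B) = opTrace (B * A) := by
  simpa [opTrace] using! LinearMap.trace_mul_comm ℂ (A : H →ₗ[ℂ] H) (B : H →ₗ[ℂ] H)

variable (H) in
/-- The trace as a linear functional. -/
def opTraceₗ : (H →L[ℂ] H) →ₗ[ℂ] ℂ where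
  toFun := opTrace
  map_add' := opTrace_add
  map_smul' := opTrace_smul

theorem opTraceₗ_apply (A : H →L[ℂ] H) : opTraceₗ H A = opTrace A := rfl

end Trace

variable [CompleteSpace H] (b : OrthonormalBasis (Fin 2) ℂ H)

section MatOp

theorem opTrace_matOp (M : Matrix (Fin 2) (Fin 2) ℂ) : opTrace (matOp b M) = M.trace := by
  have h : (matOp b M : H →ₗ[ℂ] H) =
      b.repr.symm.toLinearEquiv.conj (Matrix.toLpLin 2 2 M) := by
    ext x
    simp [matOp]
    rfl
  rw [opTrace, h, LinearMap.trace_conj', Matrix.toLpLin_eq_toLin, Matrix.trace_toLin_eq]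

theorem matOp_smul (c : ℂ) (M : Matrix (Fin 2) (Fin 2) ℂ) :
    matOp b (c • M) = c • matOp b M := map_smul (matOp b) c M

theorem exists_matOp (A : H →L[ℂ] H) : ∃ M, matOp b M = A := (matOp b).surjective A

theorem opTrace_star (b : OrthonormalBasis (Fin 2) ℂ H) (A : H →L[ℂ] H) :
    opTrace (star A) = star (opTrace A) := by
  obtain ⟨M, rfl⟩ := exists_matOp b A
  rw [← map_star, opTrace_matOp, opTrace_matOp, Matrix.star_eq_conjTranspose,
    Matrix.trace_conjTranspose]

theorem opTrace_one (b : OrthonormalBasis (Fin 2) ℂ H) : opTrace (1 : H →L[ℂ] H) = 2 := by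
  rw [← map_one (matOp b), opTrace_matOp]
  simp

/-- The Pauli operators relative to the basis `b`. -/
def pauliOp (j : Fin 3) : H →L[ℂ] H := matOp b (pauli j)

theorem spin_eq (j : Fin 3) : spin b j = (1 / 2 : ℂ) • pauliOp b j := rfl

theorem star_pauli (j : Fin 3) : star (pauli j) = pauli j := by
  ext i l
  fin_cases j <;> fin_cases i <;> fin_cases l <;> simp [pauli]

theorem pauli_mul_self (j : Fin 3) : pauli j * pauli j = 1 := by
  fin_cases j <;> simp [pauli, Matrix.one_fin_two]

theorem star_pauliOp (j : Fin 3) : star (pauliOp b j) = pauliOp b j := by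
  rw [pauliOp, ← map_star, star_pauli]

theorem pauliOp_mul_self (j : Fin 3) : pauliOp b j * pauliOp b j = 1 := by
  rw [pauliOp, ← map_mul, pauli_mul_self, map_one]

theorem opTrace_pauliOp (j : Fin 3) : opTrace (pauliOp b j) = 0 := by
  rw [pauliOp, opTrace_matOp]
  fin_cases j <;> simp [pauli, Matrix.trace_fin_two]

theorem opTrace_pauliOp_mul (i j : Fin 3) :
    opTrace (pauliOp b i * pauliOp b j) = if i = j then 2 else 0 := by
  rw [pauliOp, pauliOp, ← map_mul, opTrace_matOp]
  fin_cases i <;> fin_cases j <;> simp [pauli, Matrix.trace_fin_two] <;> norm_num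

theorem pauliOp_zero_mul_one : pauliOp b 0 * pauliOp b 1 = Complex.I • pauliOp b 2 := by
  rw [pauliOp, pauliOp, pauliOp, ← map_mul, ← matOp_smul]
  congr 1
  ext i l
  fin_cases i <;> fin_cases l <;> simp [pauli]

theorem pauli_expansion (M : Matrix (Fin 2) (Fin 2) ℂ) :
    M = (M.trace / 2) • 1 + ∑ j, ((pauli j * M).trace / 2) • pauli j := by
  ext i l
  fin_cases i <;> fin_cases l <;>
    simp [pauli, Fin.sum_univ_three, Matrix.trace_fin_two, Matrix.mul_apply, Fin.sum_univ_two] <;>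
    ring_nf <;> simp <;> ring

theorem pauliOp_expansion (A : H →L[ℂ] H) :
    A = (opTrace A / 2) • 1 + ∑ j, (opTrace (pauliOp b j * A) / 2) • pauliOp b j := by
  obtain ⟨M, rfl⟩ := exists_matOp b A
  conv_lhs => rw [pauli_expansion M]
  simp only [pauliOp, ← map_mul, opTrace_matOp, map_add, map_sum, matOp_smul, map_one]

theorem linearMap_ext_pauliOp {V : Type*} [AddCommMonoid V] [Module ℂ V]
    {Φ Ψ : (H →L[ℂ] H) →ₗ[ℂ] V} (h1 : Φ 1 = Ψ 1)
    (h : ∀ j, Φ (pauliOp b j) = Ψ (pauliOp b j)) : Φ = Ψ := by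
  ext A
  rw [pauliOp_expansion b A]
  simp [h1, h]

end MatOp

section Bloch

/-- Three-dimensional Euclidean space. -/
abbrev E3 : Type := EuclideanSpace ℝ (Fin 3)

/-- The traceless selfadjoint operator `∑ w_j σ_j`. -/
def bloch : E3 →ₗ[ℝ] (H →L[ℂ] H) where
  toFun w := ∑ j, w j • pauliOp b j
  map_add' v w := by simp [add_smul, Finset.sum_add_distrib]
  map_smul' c v := by simp [mul_smul, Finset.smul_sum]

theorem bloch_apply (w : E3) : bloch b w = ∑ j, w j • pauliOp b j := rfl

theorem bloch_eq_matOp (w : E3) :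
    bloch b w = matOp b !![(w 2 : ℂ), w 0 - w 1 * Complex.I; w 0 + w 1 * Complex.I, -w 2] := by
  simp only [bloch_apply, pauliOp, Fin.sum_univ_three, ← Complex.coe_smul, ← matOp_smul, ← map_add]
  congr 1
  ext i l
  fin_cases i <;> fin_cases l <;> simp [pauli] <;> ring

theorem star_bloch (w : E3) : star (bloch b w) = bloch b w := by
  simp [bloch_apply, star_pauliOp]

theorem opTrace_bloch (w : E3) : opTrace (bloch b w) = 0 := by
  rw [bloch_eq_matOp, opTrace_matOp]
  simp [Matrix.trace_fin_two]

theorem bloch_mul (v w : E3) :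
    bloch b v * bloch b w = inner ℝ v w • 1 + Complex.I • bloch b
      !₂[v 1 * w 2 - v 2 * w 1, v 2 * w 0 - v 0 * w 2, v 0 * w 1 - v 1 * w 0] := by
  rw [bloch_eq_matOp, bloch_eq_matOp, bloch_eq_matOp, ← map_mul (matOp b), ← map_one (matOp b),
    ← Complex.coe_smul, ← matOp_smul, ← matOp_smul, ← map_add (matOp b)]
  congr 1
  ext i l
  fin_cases i <;> fin_cases l <;>
    simp [Fin.sum_univ_three, PiLp.inner_apply] <;> ring_nf <;> simp <;> ring

theorem bloch_mul_self (w : E3) : bloch b w * bloch b w = (‖w‖ ^ 2) • 1 := by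
  have h : !₂[w 1 * w 2 - w 2 * w 1, w 2 * w 0 - w 0 * w 2, w 0 * w 1 - w 1 * w 0] = (0 : E3) := by
    ext i
    fin_cases i <;> simp <;> ring
  rw [bloch_mul, real_inner_self_eq_norm_sq, h, map_zero, smul_zero, add_zero]

theorem exists_bloch_eq {A : H →L[ℂ] H} (hA : star A = A) :
    ∃ w : E3, A = (opTrace A / 2) • 1 + bloch b w := by
  refine ⟨WithLp.toLp 2 fun j => (opTrace (pauliOp b j * A)).re / 2, ?_⟩
  conv_lhs => rw [pauliOp_expansion b A]
  congr 1
  rw [bloch_apply]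
  refine Finset.sum_congr rfl fun j _ => ?_
  rw [← Complex.coe_smul]
  congr 1
  have h : star (opTrace (pauliOp b j * A)) = opTrace (pauliOp b j * A) := by
    rw [← opTrace_star b, star_mul, hA, star_pauliOp, opTrace_mul_comm]
  have h2 : ((opTrace (pauliOp b j * A)).re : ℂ) = opTrace (pauliOp b j * A) :=
    Complex.conj_eq_iff_re.mp h
  simp [h2]

theorem nontrivial_of_basis {H : Type*} [NormedAddCommGroup H] [InnerProductSpace ℂ H]
    (b : OrthonormalBasis (Fin 2) ℂ H) : Nontrivial H :=
  ⟨b 0, 0, fun h => by simpa [h] using b.norm_eq_one 0⟩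

theorem norm_bloch (w : E3) : ‖bloch b w‖ = ‖w‖ := by
  have := nontrivial_of_basis b
  have h : ‖bloch b w‖ * ‖bloch b w‖ = ‖w‖ * ‖w‖ := by
    conv_lhs => rw [← CStarRing.norm_star_mul_self, star_bloch, bloch_mul_self, norm_smul]
    simp [pow_two]
  exact (mul_self_inj (norm_nonneg _) (norm_nonneg _)).mp h

theorem re_opTrace_nonneg (b : OrthonormalBasis (Fin 2) ℂ H) {A : H →L[ℂ] H} (hA : 0 ≤ A) :
    0 ≤ (opTrace A).re := by
  rw [opTrace, LinearMap.trace_eq_sum_inner _ b, Complex.re_sum]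
  exact Finset.sum_nonneg fun i _ =>
    ((ContinuousLinearMap.nonneg_iff_isPositive A).mp hA).re_inner_nonneg_right (b i)

/-- The eigenvalues are `c ± ‖w‖`, so the positive cone of qubit operators is a Lorentz cone. All
later estimates on positive maps come from this. -/
theorem smul_one_add_bloch_nonneg_iff (c : ℝ) (w : E3) :
    0 ≤ c • (1 : H →L[ℂ] H) + bloch b w ↔ ‖w‖ ≤ c := by
  constructor
  · intro h
    by_cases hw : w = 0
    · have h2 := re_opTrace_nonneg b h
      rw [hw, map_zero, add_zero, opTrace_real_smul, opTrace_one b] at h2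
      rw [hw, norm_zero]
      simpa using h2
    · have hpos : 0 < ‖w‖ := norm_pos_iff.mpr hw
      -- A positive multiple of the spectral projection of `bloch b w` for the eigenvalue `-‖w‖`:
      -- compressing by it isolates the eigenvalue `c - ‖w‖`.
      set B : H →L[ℂ] H := ‖w‖ • 1 - bloch b w with hB
      have hsB : star B = B := by simp [hB, star_bloch]
      have h1 : star B * (c • (1 : H →L[ℂ] H) + bloch b w) * B =
          (2 * (c - ‖w‖) * ‖w‖) • B := by
        rw [hsB, hB]
        simp only [sub_mul, mul_sub, mul_add, add_mul, smul_mul_assoc, mul_smul_comm, one_mul,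
          mul_one, smul_sub, smul_add, smul_smul, bloch_mul_self]
        module
      have h2 := re_opTrace_nonneg b (star_left_conjugate_nonneg h B)
      rw [h1, opTrace_real_smul, hB, opTrace_sub, opTrace_real_smul, opTrace_one b, opTrace_bloch]
        at h2
      simp only [sub_zero, Complex.mul_re, Complex.ofReal_re, Complex.ofReal_im, Complex.re_ofNat,
        Complex.im_ofNat, mul_zero, zero_mul] at h2
      by_contra! hc
      nlinarith [mul_pos hpos hpos]
  · intro h
    have h1 : IsSelfAdjoint (bloch b w) := star_bloch b w
    have h2 := h1.neg_algebraMap_norm_le_self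
    rw [norm_bloch, Algebra.algebraMap_eq_smul_one] at h2
    have h3 : ‖w‖ • (1 : H →L[ℂ] H) ≤ c • 1 := smul_le_smul_of_nonneg_right h zero_le_one
    calc (0 : H →L[ℂ] H) ≤ c • 1 - ‖w‖ • 1 := sub_nonneg.mpr h3
      _ = c • 1 + - (‖w‖ • 1) := by rw [sub_eq_add_neg]
      _ ≤ _ := by gcongr

theorem exists_smul_one_add_bloch {A : H →L[ℂ] H} (hA : star A = A) :
    ∃ (c : ℝ) (w : E3), A = c • (1 : H →L[ℂ] H) + bloch b w ∧ opTrace A = 2 * c := by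
  obtain ⟨w, hw⟩ := exists_bloch_eq b hA
  have h : ((opTrace A).re : ℂ) = opTrace A := by
    refine Complex.conj_eq_iff_re.mp ?_
    rw [starRingEnd_apply, ← opTrace_star b, hA]
  refine ⟨(opTrace A).re / 2, w, ?_, ?_⟩
  · conv_lhs => rw [hw]
    rw [← Complex.coe_smul]
    simp [h]
  · simp only [Complex.ofReal_div, h, Complex.ofReal_ofNat]
    ring

theorem bloch_injective : Function.Injective (bloch b) := by
  rw [injective_iff_map_eq_zero]
  intro w hw
  rw [← norm_eq_zero, ← norm_bloch b, hw, norm_zero]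

end Bloch

end TracesAndPauliOperators

/-! ### Conjugations by SU(2) and triples satisfying the Pauli relations. -/

section UnitaryConjugation

variable {H : Type*} [NormedAddCommGroup H] [InnerProductSpace ℂ H] [CompleteSpace H]
  (b : OrthonormalBasis (Fin 2) ℂ H)

theorem matOp_apply_basis (M : Matrix (Fin 2) (Fin 2) ℂ) (i : Fin 2) :
    matOp b M (b i) = ∑ j, M j i • b j := by
  simp only [matOp, StarAlgEquiv.trans_apply, LinearIsometryEquiv.conjStarAlgEquiv_apply]
  simp only [LinearIsometryEquiv.symm_symm, ContinuousLinearMap.coe_comp, Function.comp_apply,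
    LinearIsometryEquiv.coe_toContinuousLinearEquiv, ContinuousLinearEquiv.coe_coe,
    OrthonormalBasis.repr_self]
  rw [← b.sum_repr_symm]
  simp

/-- A unitary operator is, up to a phase, in the range of the defining representation. -/
theorem exists_definingRep_eq_smul (U : unitary (H →L[ℂ] H)) :
    ∃ (g : SU2) (c : ℂ), star c * c = 1 ∧
      (definingRep b g : H →L[ℂ] H) = c • (U : H →L[ℂ] H) := by
  obtain ⟨M, hM⟩ := exists_matOp b (U : H →L[ℂ] H)
  have hMu : M ∈ Matrix.unitaryGroup (Fin 2) ℂ := by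
    have : M = (matOp b).symm (U : H →L[ℂ] H) := by rw [← hM, StarAlgEquiv.symm_apply_apply]
    rw [this]
    exact Unitary.map_mem (matOp b).symm U.2
  -- In dimension two `det (c • M) = c ^ 2 * det M`, so a square root of the conjugate determinant
  -- normalizes `M` into SU(2).
  obtain ⟨c, hc⟩ := IsAlgClosed.exists_pow_nat_eq (star M.det) two_pos
  have hdet : star M.det * M.det = 1 := (Unitary.mem_iff.mp (Matrix.det_of_mem_unitary hMu)).1
  have hcc : star c * c = 1 := by
    have h1 : ‖c‖ ^ 2 = 1 := by
      have h2 : ‖M.det‖ = 1 := by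
        have h3 := congrArg norm hdet
        rw [norm_mul, norm_star, norm_one, ← sq] at h3
        exact (pow_left_inj₀ (norm_nonneg _) zero_le_one two_ne_zero).mp (by rw [h3, one_pow])
      rw [← norm_pow, hc, norm_star, h2]
    rw [Complex.star_def, ← Complex.normSq_eq_conj_mul_self, Complex.normSq_eq_norm_sq, h1,
      Complex.ofReal_one]
  refine ⟨⟨c • M, Matrix.mem_specialUnitaryGroup_iff.mpr ⟨?_, ?_⟩⟩, c, hcc, ?_⟩
  · rw [Matrix.mem_unitaryGroup_iff'] at hMu ⊢
    rw [star_smul, smul_mul_smul_comm, hMu, hcc, one_smul]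
  · rw [Matrix.det_smul, Fintype.card_fin, hc, hdet]
  · change matOp b (c • M) = _
    rw [matOp_smul, hM]

/-- Conjugation by a unitary operator. -/
abbrev adj (U : unitary (H →L[ℂ] H)) : (H →L[ℂ] H) ≃⋆ₐ[ℂ] (H →L[ℂ] H) :=
  Unitary.conjStarAlgAut ℂ (H →L[ℂ] H) U

/-- Phases cancel in a conjugation, so SU(2) already provides all of them. -/
theorem exists_adj_definingRep (U : unitary (H →L[ℂ] H)) :
    ∃ g : SU2, adj (definingRep b g) = adj U := by
  obtain ⟨g, c, hc, hg⟩ := exists_definingRep_eq_smul b U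
  refine ⟨g, ?_⟩
  ext1 A
  simp only [adj, Unitary.conjStarAlgAut_apply, hg, star_smul, smul_mul_assoc, mul_smul_comm,
    smul_smul, hc, one_smul]

/-- Any triple of operators satisfying the relations of the Pauli operators is conjugate to the
Pauli triple. -/
theorem exists_adj_pauliOp {S : Fin 3 → (H →L[ℂ] H)} (hs : ∀ j, star (S j) = S j)
    (h0 : S 0 * S 0 = 1) (h1 : S 1 * S 1 = 1) (h01 : S 0 * S 1 = Complex.I • S 2) :
    ∃ g : SU2, ∀ j, adj (definingRep b g) (pauliOp b j) = S j := by
  -- The second operator is determined by the first and the third, so it suffices to intertwine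
  -- those two.
  have key : ∀ T : Fin 3 → (H →L[ℂ] H), T 0 * T 0 = 1 → T 0 * T 1 = Complex.I • T 2 →
      T 1 = Complex.I • (T 0 * T 2) := by
    intro T h0 h01
    rw [← mul_smul_comm, ← h01, ← mul_assoc, h0, one_mul]
  have h10 : S 1 * S 0 = - (Complex.I • S 2) := by
    have := congrArg star h01
    simpa [hs] using this
  have hanti : S 0 * S 2 = - (S 2 * S 0) := by
    have e : S 2 = -(Complex.I • (S 0 * S 1)) := by rw [h01, smul_smul]; simp
    have e' : S 2 = Complex.I • (S 1 * S 0) := by rw [h10, smul_neg, smul_smul]; simp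
    rw [e, mul_neg, mul_smul_comm, ← mul_assoc, h0, one_mul, ← e, e', smul_mul_assoc, mul_assoc,
      h0, mul_one]
  have h2 : S 2 * S 2 = 1 := by
    have e : S 2 = -(Complex.I • (S 0 * S 1)) := by rw [h01, smul_smul]; simp
    have e' : S 2 = Complex.I • (S 1 * S 0) := by rw [h10, smul_neg, smul_smul]; simp
    nth_rewrite 1 [e]
    rw [e', neg_mul, smul_mul_smul_comm, mul_assoc, ← mul_assoc (S 1), h1, one_mul, h0]
    simp
  -- Since `S 2` is an involution, `v + S 2 v` is fixed by it; if it always vanished, `S 2` would be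
  -- `-1`, which cannot anticommute with the invertible `S 0`.
  have hne : ∃ v, v + S 2 v ≠ 0 := by
    by_contra! h
    have e : S 2 = -1 := by
      ext v
      have := h v
      simpa using (eq_neg_of_add_eq_zero_right this)
    rw [e] at hanti
    have h3 : S 0 = 0 := by
      simp only [mul_neg, mul_one, neg_mul, one_mul, neg_neg] at hanti
      have h4 : (2 : ℂ) • S 0 = 0 := by rw [two_smul]; nth_rewrite 1 [← hanti]; simp
      exact (smul_eq_zero.mp h4).resolve_left two_ne_zero
    have := nontrivial_of_basis b
    rw [h3, zero_mul] at h0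
    exact zero_ne_one h0
  obtain ⟨v, hv⟩ := hne
  -- The unit vectors `f` and `S 0 f` have `S 2`-eigenvalues `1` and `-1`; the unitary sought takes
  -- the basis `b` to them.
  set f : H := ((‖v + S 2 v‖ : ℂ))⁻¹ • (v + S 2 v) with hf
  have hfn : ‖f‖ = 1 := by
    rw [hf, norm_smul, norm_inv, Complex.norm_real, norm_norm, inv_mul_cancel₀]
    exact norm_ne_zero_iff.mpr hv
  have hS2f : S 2 f = f := by
    have : S 2 (S 2 v) = v := by
      rw [← mul_apply_eq_comp, h2]; rfl
    rw [hf, map_smul, map_add, this, add_comm]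
  have hS2f' : S 2 (S 0 f) = - S 0 f := by
    have := congrArg (fun T : H →L[ℂ] H => T f) hanti
    simp only [mul_apply_eq_comp, neg_apply, hS2f] at this
    rw [eq_neg_iff_add_eq_zero, add_comm, ← eq_neg_iff_add_eq_zero]
    exact this
  have hS0 : S 0 (S 0 f) = f := by
    rw [← mul_apply_eq_comp, h0]; rfl
  have hadj : ∀ (j : Fin 3) (x y : H), inner ℂ (S j x) y = inner ℂ x (S j y) := by
    intro j x y
    rw [← ContinuousLinearMap.adjoint_inner_right, ← ContinuousLinearMap.star_eq_adjoint, hs]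
  have hon : Orthonormal ℂ ![f, S 0 f] := by
    have h01 : inner ℂ f (S 0 f) = (0 : ℂ) := by
      have h := hadj 2 f (S 0 f)
      rw [hS2f, hS2f', inner_neg_right] at h
      exact self_eq_neg.mp h
    have hn : ‖S 0 f‖ = 1 := by
      have : ‖S 0 f‖ ^ 2 = ‖f‖ ^ 2 := by
        rw [← inner_self_eq_norm_sq (𝕜 := ℂ), ← inner_self_eq_norm_sq (𝕜 := ℂ), hadj, hS0]
      rw [hfn] at this
      exact (pow_left_inj₀ (norm_nonneg _) zero_le_one two_ne_zero).mp this
    constructor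
    · intro i
      fin_cases i
      · exact hfn
      · exact hn
    · intro i j hij
      fin_cases i <;> fin_cases j
      · exact absurd rfl hij
      · exact h01
      · exact inner_eq_zero_symm.mp h01
      · exact absurd rfl hij
  have : FiniteDimensional ℂ H := b.toBasis.finiteDimensional_of_finite
  have hfr : Module.finrank ℂ H = Fintype.card (Fin 2) :=
    Module.finrank_eq_card_basis b.toBasis
  obtain ⟨f', hf'⟩ := Orthonormal.exists_orthonormalBasis_extension_of_card_eq hfr
    (v := ![f, S 0 f]) (s := Set.univ) (hon.comp _ Subtype.val_injective)
  have hf0 : f' 0 = f := hf' 0 trivial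
  have hf1 : f' 1 = S 0 f := hf' 1 trivial
  set U : unitary (H →L[ℂ] H) := Unitary.linearIsometryEquiv.symm (b.equiv f' (Equiv.refl _))
    with hU
  have hUb : ∀ i, (U : H →L[ℂ] H) (b i) = f' i := by
    intro i
    simp [hU]
  have hint : ∀ j, (U : H →L[ℂ] H) * pauliOp b j = S j * (U : H →L[ℂ] H) := by
    have c0 : (U : H →L[ℂ] H) * pauliOp b 0 = S 0 * (U : H →L[ℂ] H) := by
      apply ContinuousLinearMap.coe_injective
      apply b.toBasis.ext
      intro i
      fin_cases i <;>
        simp [hUb, pauliOp, matOp_apply_basis, pauli, hf0, hf1, hS0]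
    have c2 : (U : H →L[ℂ] H) * pauliOp b 2 = S 2 * (U : H →L[ℂ] H) := by
      apply ContinuousLinearMap.coe_injective
      apply b.toBasis.ext
      intro i
      fin_cases i <;>
        simp [hUb, pauliOp, matOp_apply_basis, pauli, hf0, hf1, hS2f, hS2f']
    intro j
    fin_cases j
    · exact c0
    · change (U : H →L[ℂ] H) * pauliOp b 1 = S 1 * (U : H →L[ℂ] H)
      rw [key S h0 h01, key _ (pauliOp_mul_self b 0) (pauliOp_zero_mul_one b), mul_smul_comm,
        smul_mul_assoc, ← mul_assoc, c0, mul_assoc, c2, mul_assoc]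
    · exact c2
  obtain ⟨g, hg⟩ := exists_adj_definingRep b U
  refine ⟨g, fun j => ?_⟩
  rw [hg, adj, Unitary.conjStarAlgAut_apply, hint, mul_assoc, Unitary.mul_star_self_of_mem U.2, mul_one]

end UnitaryConjugation

/-! ### Positive, trace-preserving, unital maps as mixtures. -/

section PositiveMaps

/-- Singular value decomposition of an endomorphism of the three-dimensional Euclidean space. -/
theorem exists_orthonormalBasis_map_eq_smul (T : E3 →ₗ[ℝ] E3) :
    ∃ (u v : OrthonormalBasis (Fin 3) ℝ E3) (d : Fin 3 → ℝ), ∀ j, T (v j) = d j • u j := by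
  have hfr : Module.finrank ℝ E3 = 3 := by simp
  have hsymm : (LinearMap.adjoint T * T).IsSymmetric := T.isSymmetric_adjoint_mul_self
  set v := hsymm.eigenvectorBasis hfr with hv
  have horth : ∀ i j, i ≠ j → inner ℝ (T (v i)) (T (v j)) = 0 := by
    intro i j hij
    have h := hsymm.apply_eigenvectorBasis hfr j
    rw [← LinearMap.adjoint_inner_right, ← Module.End.mul_apply]
    rw [← hv] at h
    rw [h, inner_smul_right, v.inner_eq_zero hij, mul_zero]
  -- Only the nonzero images can be normalized; the remaining vectors of `u` are free because their
  -- singular values are zero.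
  set s : Set (Fin 3) := {j | T (v j) ≠ 0} with hs
  have hon : Orthonormal ℝ (s.domRestrict fun j => ‖T (v j)‖⁻¹ • T (v j)) := by
    constructor
    · rintro ⟨i, hi⟩
      have : ‖T (v i)‖ ≠ 0 := norm_ne_zero_iff.mpr hi
      simp [Set.domRestrict, norm_smul, this]
    · rintro ⟨i, hi⟩ ⟨j, hj⟩ hij
      have : i ≠ j := fun h => hij (Subtype.ext h)
      simp [Set.domRestrict, inner_smul_left, inner_smul_right, horth i j this]
  obtain ⟨u, hu⟩ := hon.exists_orthonormalBasis_extension_of_card_eq (by simp)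
  refine ⟨u, v, fun j => ‖T (v j)‖, fun j => ?_⟩
  by_cases h : T (v j) = 0
  · simp [h]
  · rw [hu j h, smul_smul, mul_inv_cancel₀ (norm_ne_zero_iff.mpr h), one_smul]

variable {H : Type*} [NormedAddCommGroup H] [InnerProductSpace ℂ H] [CompleteSpace H]
  (b : OrthonormalBasis (Fin 2) ℂ H)

/-- The sign `s` is the orientation of `u`, from `u 0 × u 1 = s • u 2`. In odd dimension,
multiplying a basis by its orientation makes it positively oriented, hence a rotation of the Pauli
triple. -/
theorem exists_adj_pauliOp_eq_bloch (u : OrthonormalBasis (Fin 3) ℝ E3) :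
    ∃ (g : SU2) (s : ℝ), s * s = 1 ∧ ∀ j, adj (definingRep b g) (pauliOp b j) = s • bloch b (u j) := by
  set c : E3 := !₂[u 0 1 * u 1 2 - u 0 2 * u 1 1, u 0 2 * u 1 0 - u 0 0 * u 1 2,
    u 0 0 * u 1 1 - u 0 1 * u 1 0] with hc
  have hmul : bloch b (u 0) * bloch b (u 1) = Complex.I • bloch b c := by
    rw [bloch_mul, u.inner_eq_zero (by decide), zero_smul, zero_add]
  have h0 : inner ℝ (u 0) c = 0 := by
    simp [hc, PiLp.inner_apply, Fin.sum_univ_three]; ring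
  have h1 : inner ℝ (u 1) c = 0 := by
    simp [hc, PiLp.inner_apply, Fin.sum_univ_three]; ring
  have hsq : ∀ j, bloch b (u j) * bloch b (u j) = 1 := by
    intro j
    rw [bloch_mul_self, u.norm_eq_one, one_pow, one_smul]
  have hcn : ‖c‖ = 1 := by
    have e : star (Complex.I • bloch b c) * (Complex.I • bloch b c) = 1 := by
      rw [← hmul, star_mul, star_bloch, star_bloch, mul_assoc, ← mul_assoc (bloch b (u 0)), hsq,
        one_mul, hsq]
    have := nontrivial_of_basis b
    have e2 := CStarRing.norm_star_mul_self (x := Complex.I • bloch b c)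
    rw [e, norm_smul, norm_bloch, norm_one, Complex.norm_I, one_mul] at e2
    nlinarith [norm_nonneg c]
  have hcu : c = inner ℝ (u 2) c • u 2 := by
    conv_lhs => rw [← u.sum_repr' c]
    simp [Fin.sum_univ_three, h0, h1]
  set s : ℝ := inner ℝ (u 2) c with hs
  have hss : s * s = 1 := by
    have : ‖c‖ = |s| := by rw [hcu, norm_smul, u.norm_eq_one, mul_one, Real.norm_eq_abs]
    rw [← abs_mul_abs_self, ← this, hcn, one_mul]
  obtain ⟨g, hg⟩ := exists_adj_pauliOp b (S := fun j => s • bloch b (u j))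
    (fun j => by simp [star_bloch]) (by simp [smul_smul, hsq, hss]) (by simp [smul_smul, hsq, hss])
    (by
      simp only [smul_mul_smul_comm, hss, one_smul]
      rw [hmul, hcu, map_smul])
  exact ⟨g, s, hss, hg⟩

/-- A positive, trace-preserving, unital map is, up to rotations on both sides, diagonal. -/
theorem exists_diagonal {Φ : (H →L[ℂ] H) →ₗ[ℂ] (H →L[ℂ] H)} (hpos : IsPositiveMap Φ)
    (htr : IsTracePreserving Φ) (hone : IsUnitalMap Φ) :
    ∃ (g h : SU2) (d : Fin 3 → ℝ), (∀ j, |d j| ≤ 1) ∧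
      ∀ j, Φ (adj (definingRep b h) (pauliOp b j)) = d j • adj (definingRep b g) (pauliOp b j) := by
  have hpos' : ∀ A, 0 ≤ A → 0 ≤ Φ A := fun A hA =>
    (ContinuousLinearMap.nonneg_iff_isPositive _).mpr
      (hpos A ((ContinuousLinearMap.nonneg_iff_isPositive _).mp hA))
  have hΦr : ∀ (c : ℝ) (A : H →L[ℂ] H), Φ (c • A) = c • Φ A := fun c A => by
    rw [← Complex.coe_smul, map_smul, Complex.coe_smul]
  have hex : ∀ w : E3, ∃ w' : E3, Φ (bloch b w) = bloch b w' := by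
    intro w
    -- Adding `‖w‖ • 1` gives a positive operator, whose image is selfadjoint; unitality then
    -- removes the shift.
    have h1 := hpos' _ ((smul_one_add_bloch_nonneg_iff b ‖w‖ w).mpr le_rfl)
    rw [map_add, hΦr, hone] at h1
    have hsa : star (Φ (bloch b w)) = Φ (bloch b w) := by
      have := h1.isSelfAdjoint.star_eq
      simpa using this
    obtain ⟨w', hw'⟩ := exists_bloch_eq b hsa
    refine ⟨w', ?_⟩
    conv_lhs => rw [hw', htr, opTrace_bloch]
    simp
  choose T hT using hex
  obtain ⟨u, v, d, hd⟩ := exists_orthonormalBasis_map_eq_smul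
    { toFun := T
      map_add' := fun x y => bloch_injective b (by rw [map_add, ← hT, ← hT, ← hT, map_add, map_add])
      map_smul' := fun c x => bloch_injective b (by
        rw [RingHom.id_apply, map_smul, ← hT, ← hT, map_smul, hΦr]) }
  have hd' : ∀ j, T (v j) = d j • u j := hd
  obtain ⟨g, s, hss, hg⟩ := exists_adj_pauliOp_eq_bloch b u
  obtain ⟨h, s', hss', hh⟩ := exists_adj_pauliOp_eq_bloch b v
  have habs : ∀ s : ℝ, s * s = 1 → |s| = 1 := fun s h => by
    have : |s| * |s| = 1 := by rw [abs_mul_abs_self, h]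
    nlinarith [abs_nonneg s]
  refine ⟨g, h, fun j => s * s' * d j, fun j => ?_, fun j => ?_⟩
  · rw [abs_mul, abs_mul, habs s hss, habs s' hss', one_mul, one_mul]
    have h1 := hpos' _ ((smul_one_add_bloch_nonneg_iff b 1 (v j)).mpr (v.norm_eq_one j).le)
    rw [map_add, hΦr, hone, hT, smul_one_add_bloch_nonneg_iff, hd', norm_smul, u.norm_eq_one,
      mul_one, Real.norm_eq_abs] at h1
    exact h1
  · rw [hh, hg, hΦr, hT, hd', map_smul, smul_smul, smul_smul]
    congr 1
    calc s' * d j = s * s * (s' * d j) := by rw [hss, one_mul]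
      _ = _ := by ring

/-- The universal NOT map `A ↦ tr(A) - A`. -/
def univNot : (H →L[ℂ] H) →ₗ[ℂ] (H →L[ℂ] H) :=
  (opTraceₗ H).smulRight (1 : H →L[ℂ] H) - LinearMap.id

theorem univNot_apply {H : Type*} [NormedAddCommGroup H] [InnerProductSpace ℂ H]
    (A : H →L[ℂ] H) : univNot A = opTrace A • 1 - A := rfl

theorem univNot_one (b : OrthonormalBasis (Fin 2) ℂ H) : univNot (1 : H →L[ℂ] H) = 1 := by
  rw [univNot_apply, opTrace_one b, two_smul, add_sub_cancel_right]

theorem univNot_pauliOp (j : Fin 3) : univNot (pauliOp b j) = - pauliOp b j := by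
  rw [univNot_apply, opTrace_pauliOp, zero_smul, zero_sub]

theorem opTrace_adj (U : unitary (H →L[ℂ] H)) (A : H →L[ℂ] H) : opTrace (adj U A) = opTrace A := by
  rw [adj, Unitary.conjStarAlgAut_apply, opTrace_mul_comm, ← mul_assoc,
    Unitary.star_mul_self_of_mem U.2, one_mul]

theorem univNot_adj (U : unitary (H →L[ℂ] H)) (A : H →L[ℂ] H) :
    univNot (adj U A) = adj U (univNot A) := by
  rw [univNot_apply, univNot_apply, opTrace_adj, map_sub, map_smul, map_one]

/-- The signs of the action of the Klein four-group on the Pauli operators. -/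
def kleinSign : Fin 4 → Fin 3 → ℝ := ![![1, 1, 1], ![1, -1, -1], ![-1, 1, -1], ![-1, -1, 1]]

theorem kleinSign_mul_self (a : Fin 4) (j : Fin 3) : kleinSign a j * kleinSign a j = 1 := by
  fin_cases a <;> fin_cases j <;> simp [kleinSign]

/-- Each row of `kleinSign` has product `1`, so it is the identity or a half-turn about a coordinate
axis and preserves the Pauli relations. -/
theorem exists_klein (a : Fin 4) :
    ∃ q : SU2, ∀ j, adj (definingRep b q) (pauliOp b j) = kleinSign a j • pauliOp b j := by
  refine exists_adj_pauliOp b (S := fun j => kleinSign a j • pauliOp b j)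
    (fun j => by simp [star_pauliOp]) ?_ ?_ ?_
  · simp [smul_smul, pauliOp_mul_self, kleinSign_mul_self]
  · simp [smul_smul, pauliOp_mul_self, kleinSign_mul_self]
  · simp only [smul_mul_smul_comm, pauliOp_zero_mul_one]
    rw [smul_comm]
    congr 2
    fin_cases a <;> simp [kleinSign]

/-- The map `∑ p_a Ad(g_a) + ∑ m_a Ad(g_a) ∘ univNot`. -/
def mixture (g : Fin 4 → SU2) (p m : Fin 4 → ℝ≥0) : (H →L[ℂ] H) →ₗ[ℂ] (H →L[ℂ] H) where
  toFun A := ∑ a, p a • adj (definingRep b (g a)) A +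
    ∑ a, m a • adj (definingRep b (g a)) (univNot A)
  map_add' A B := by
    simp only [map_add, smul_add, Finset.sum_add_distrib]
    abel
  map_smul' c A := by
    simp only [map_smul, smul_add, Finset.smul_sum, RingHom.id_apply, smul_comm c]

theorem mixture_apply (g : Fin 4 → SU2) (p m : Fin 4 → ℝ≥0) (A : H →L[ℂ] H) :
    mixture b g p m A = ∑ a, p a • adj (definingRep b (g a)) A +
      ∑ a, m a • adj (definingRep b (g a)) (univNot A) := rfl

/-- Conjugation by a unitary operator, as a linear map. -/
def adjₗ (U : unitary (H →L[ℂ] H)) : (H →L[ℂ] H) →ₗ[ℂ] (H →L[ℂ] H) where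
  toFun := adj U
  map_add' := map_add (adj U)
  map_smul' := map_smul (adj U)

theorem adjₗ_apply (U : unitary (H →L[ℂ] H)) (A : H →L[ℂ] H) : adjₗ U A = adj U A := rfl

theorem adj_definingRep_mul (x y : SU2) (A : H →L[ℂ] H) :
    adj (definingRep b (x * y)) A = adj (definingRep b x) (adj (definingRep b y) A) := by
  rw [map_mul, adj, map_mul]
  rfl

theorem adj_definingRep_inv (x : SU2) (A : H →L[ℂ] H) :
    adj (definingRep b x) (adj (definingRep b x⁻¹) A) = A := by
  rw [← adj_definingRep_mul, mul_inv_cancel, map_one, adj, map_one]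
  rfl

theorem adj_definingRep_inv' (x : SU2) (A : H →L[ℂ] H) :
    adj (definingRep b x⁻¹) (adj (definingRep b x) A) = A := by
  rw [← adj_definingRep_mul, inv_mul_cancel, map_one, adj, map_one]
  rfl

theorem adj_real_smul (U : unitary (H →L[ℂ] H)) (c : ℝ) (A : H →L[ℂ] H) :
    adj U (c • A) = c • adj U A := by
  rw [← Complex.coe_smul, map_smul, Complex.coe_smul]

/-- Once `d` is a convex combination of the Klein signs and their negatives, undoing the two
rotations turns sign vector `a` into conjugation by `g * q a * h⁻¹`. -/
theorem exists_mixture_of_weights {Φ : (H →L[ℂ] H) →ₗ[ℂ] (H →L[ℂ] H)} (hone : IsUnitalMap Φ)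
    {g h : SU2} {d : Fin 3 → ℝ}
    (hΦ : ∀ j, Φ (adj (definingRep b h) (pauliOp b j)) = d j • adj (definingRep b g) (pauliOp b j))
    {p m : Fin 4 → ℝ≥0} (hpm : ∑ a, (p a : ℝ) + ∑ a, (m a : ℝ) = 1)
    (hd : ∀ j, ∑ a, (p a : ℝ) * kleinSign a j - ∑ a, (m a : ℝ) * kleinSign a j = d j) :
    ∃ g : Fin 4 → SU2, Φ = mixture b g p m := by
  choose q hq using exists_klein b
  refine ⟨fun a => g * q a * h⁻¹, ?_⟩
  have hcomp : Φ ∘ₗ adjₗ (definingRep b h) =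
      mixture b (fun a => g * q a * h⁻¹) p m ∘ₗ adjₗ (definingRep b h) := by
    apply linearMap_ext_pauliOp b
    · simp only [LinearMap.comp_apply, adjₗ_apply]
      rw [map_one, hone, mixture_apply, univNot_one b]
      simp only [map_one, NNReal.smul_def, ← Finset.sum_smul, ← add_smul, hpm, one_smul]
    · intro j
      simp only [LinearMap.comp_apply, adjₗ_apply, hΦ]
      have h1 : ∀ a, adj (definingRep b (g * q a * h⁻¹)) (adj (definingRep b h) (pauliOp b j)) =
          kleinSign a j • adj (definingRep b g) (pauliOp b j) := by
        intro a
        rw [adj_definingRep_mul, adj_definingRep_inv', adj_definingRep_mul, hq, adj_real_smul]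
      have h2 : ∀ a, adj (definingRep b (g * q a * h⁻¹))
          (univNot (adj (definingRep b h) (pauliOp b j))) =
          -(kleinSign a j • adj (definingRep b g) (pauliOp b j)) := by
        intro a
        rw [univNot_adj, univNot_pauliOp, map_neg, map_neg, h1]
      rw [mixture_apply]
      simp only [h1, h2, NNReal.smul_def, smul_neg, smul_smul, Finset.sum_neg_distrib,
        ← Finset.sum_smul]
      rw [← hd j, sub_smul, sub_eq_add_neg]
  ext1 A
  have h1 := congrArg (fun F => F (adj (definingRep b h⁻¹) A)) hcomp
  simpa only [LinearMap.comp_apply, adjₗ_apply, adj_definingRep_inv] using h1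

/-- The weights are the law of three independent random signs with means `d j`: the vertex `ε` of
the cube gets mass `∏ (1 + ε j * d j) / 8`. The vertices with product `1` give `p`, their antipodes
give `m`. -/
theorem exists_mixture {Φ : (H →L[ℂ] H) →ₗ[ℂ] (H →L[ℂ] H)} (hpos : IsPositiveMap Φ)
    (htr : IsTracePreserving Φ) (hone : IsUnitalMap Φ) :
    ∃ (g : Fin 4 → SU2) (p m : Fin 4 → ℝ≥0), ∑ a, p a + ∑ a, m a = 1 ∧
      Φ = mixture b g p m := by
  obtain ⟨g, h, d, hd, hΦ⟩ := exists_diagonal b hpos htr hone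
  have hεd : ∀ a j, |kleinSign a j * d j| ≤ 1 := by
    intro a j
    have h1 : |kleinSign a j| = 1 := by
      have := kleinSign_mul_self a j
      rw [← abs_mul_abs_self] at this
      nlinarith [abs_nonneg (kleinSign a j)]
    rw [abs_mul, h1, one_mul]
    exact hd j
  have hp : ∀ a, 0 ≤ (∏ j, (1 + kleinSign a j * d j)) / 8 := fun a =>
    div_nonneg (Finset.prod_nonneg fun j _ => by linarith [(abs_le.mp (hεd a j)).1]) (by norm_num)
  have hm : ∀ a, 0 ≤ (∏ j, (1 - kleinSign a j * d j)) / 8 := fun a =>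
    div_nonneg (Finset.prod_nonneg fun j _ => by linarith [(abs_le.mp (hεd a j)).2]) (by norm_num)
  set p : Fin 4 → ℝ≥0 := fun a => ⟨_, hp a⟩
  set m : Fin 4 → ℝ≥0 := fun a => ⟨_, hm a⟩
  have hpc : ∀ a, (p a : ℝ) = (∏ j, (1 + kleinSign a j * d j)) / 8 := fun _ => rfl
  have hmc : ∀ a, (m a : ℝ) = (∏ j, (1 - kleinSign a j * d j)) / 8 := fun _ => rfl
  have hpm : ∑ a, (p a : ℝ) + ∑ a, (m a : ℝ) = 1 := by
    simp only [hpc, hmc]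
    simp [Fin.sum_univ_four, Fin.prod_univ_three, kleinSign]
    ring
  obtain ⟨g', hg'⟩ := exists_mixture_of_weights b hone hΦ hpm (fun j => by
    simp only [hpc, hmc]
    fin_cases j <;> simp [Fin.sum_univ_four, Fin.prod_univ_three, kleinSign] <;> ring)
  exact ⟨g', p, m, by exact_mod_cast hpm, hg'⟩

end PositiveMaps

/-! ### Completely positive maps and the tetrahedron of Pauli multipliers. -/

section CompletelyPositiveMaps

variable {H : Type*} [NormedAddCommGroup H] [InnerProductSpace ℂ H] [CompleteSpace H]
  (b : OrthonormalBasis (Fin 2) ℂ H)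

/-- The positivity of `∑ ⟨x_i, Φ(B_i* B_j) x_j⟩`, a consequence of complete positivity. -/
def IsTwoPositive (Φ : (H →L[ℂ] H) →ₗ[ℂ] (H →L[ℂ] H)) : Prop :=
  ∀ (B : Fin 2 → (H →L[ℂ] H)) (x : Fin 2 → H),
    0 ≤ (∑ i, ∑ j, inner ℂ (x i) (Φ (star (B i) * B j) (x j))).re

theorem re_sum_inner_nonneg_of_nonneg {M : CStarMatrix (Fin 2) (Fin 2) (H →L[ℂ] H)} (hM : 0 ≤ M)
    (x : Fin 2 → H) : 0 ≤ (∑ i, ∑ j, inner ℂ (x i) (M i j (x j))).re := by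
  rw [StarOrderedRing.nonneg_iff] at hM
  induction hM using AddSubmonoid.closure_induction with
  | mem M h =>
    obtain ⟨D, rfl⟩ := h
    have h1 : ∑ i, ∑ j, inner ℂ (x i) ((star D * D) i j (x j)) =
        ∑ k, inner ℂ (∑ i, D k i (x i)) (∑ i, D k i (x i)) := by
      have h2 : ∀ i j, (star D * D) i j = ∑ k, star (D k i) * D k j := fun i j => by
        simp only [CStarMatrix.mul_apply, CStarMatrix.star_apply]
      have h3 : ∀ k i j, inner ℂ (x i) ((star (D k i) * D k j) (x j)) =
          inner ℂ (D k i (x i)) (D k j (x j)) := fun k i j => by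
        rw [mul_apply_eq_comp, ContinuousLinearMap.star_eq_adjoint,
          ContinuousLinearMap.adjoint_inner_right]
      simp only [h2, sum_apply, inner_sum, sum_inner, h3]
      simp only [Fin.sum_univ_two]
      ring
    rw [h1, Complex.re_sum]
    exact Finset.sum_nonneg fun k _ => inner_self_nonneg (𝕜 := ℂ)
  | zero => simp
  | add M N _ _ hM hN =>
    simp only [CStarMatrix.add_apply, add_apply, inner_add_right,
      Finset.sum_add_distrib, Complex.add_re]
    exact add_nonneg hM hN

theorem IsCompletelyPositiveMap.isTwoPositive {Φ : (H →L[ℂ] H) →ₗ[ℂ] (H →L[ℂ] H)}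
    (hΦ : IsCompletelyPositiveMap Φ) : IsTwoPositive Φ := by
  obtain ⟨Ψ, rfl⟩ := hΦ
  intro B x
  -- With first row `B` and second row zero, `star N * N` has the entries `star (B i) * B j`.
  set N : CStarMatrix (Fin 2) (Fin 2) (H →L[ℂ] H) :=
    CStarMatrix.ofMatrix (Matrix.of ![B, 0]) with hN
  have h1 := re_sum_inner_nonneg_of_nonneg
    (Ψ.map_cstarMatrix_nonneg' 2 (star N * N) (star_mul_self_nonneg N)) x
  have h2 : ∀ i j, (star N * N) i j = star (B i) * B j := by
    intro i j
    have e0 : ∀ i, N 0 i = B i := fun _ => rfl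
    have e1 : ∀ i, N 1 i = 0 := fun _ => rfl
    simp only [CStarMatrix.mul_apply, CStarMatrix.star_apply, Fin.sum_univ_two, e0, e1, star_zero,
      zero_mul, add_zero]
  simpa only [CStarMatrix.map_apply, h2] using h1

theorem inner_matOp_apply (M : Matrix (Fin 2) (Fin 2) ℂ) (i j : Fin 2) :
    inner ℂ (b i) (matOp b M (b j)) = M i j := by
  rw [matOp_apply_basis, inner_sum]
  simp [inner_smul_right, b.inner_eq_ite]

/-- This is the Choi form, at the unnormalized maximally entangled vector, of the map multiplying
`pauli l` by `e l`. Each Pauli matrix contributes `e l` because `tr (σ_l ^ 2) / 2 = 1`. -/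
theorem sum_single_expansion (e : Fin 3 → ℂ) :
    ∑ i : Fin 2, ∑ j : Fin 2,
      (((Matrix.single i j (1 : ℂ) : Matrix (Fin 2) (Fin 2) ℂ).trace / 2) •
          (1 : Matrix (Fin 2) (Fin 2) ℂ) +
        ∑ l, ((pauli l * Matrix.single i j 1).trace / 2 * e l) • pauli l) i j = 1 + ∑ l, e l := by
  simp [Fin.sum_univ_two, Fin.sum_univ_three, pauli, Matrix.trace_fin_two, Matrix.single,
    Matrix.mul_apply]
  ring_nf
  simp

/-- These are the four facet inequalities of the tetrahedron. After removing the rotations and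
composing with a Klein conjugation, each is the Choi form of a Pauli-diagonal map at a maximally
entangled vector. -/
theorem one_add_kleinSign_nonneg {Φ : (H →L[ℂ] H) →ₗ[ℂ] (H →L[ℂ] H)} (hΦ2 : IsTwoPositive Φ)
    (hone : IsUnitalMap Φ) {g h : SU2} {d : Fin 3 → ℝ}
    (hΦ : ∀ j, Φ (adj (definingRep b h) (pauliOp b j)) = d j • adj (definingRep b g) (pauliOp b j))
    (a : Fin 4) : 0 ≤ 1 + ∑ j, kleinSign a j * d j := by
  obtain ⟨q, hq⟩ := exists_klein b a
  set V := definingRep b h with hV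
  set U := definingRep b (g * q) with hU
  -- Chosen so that `star (B i) * B j` is the matrix unit `E_ij` conjugated by `V`, and so that the
  -- vectors absorb the conjugation by `U⁻¹`.
  have h1 := hΦ2 (fun i => matOp b (Matrix.single 0 i 1) * star (V : H →L[ℂ] H))
    (fun i => (U : H →L[ℂ] H) (b i))
  have h2 : ∀ i j, star (matOp b (Matrix.single 0 i 1) * star (V : H →L[ℂ] H)) *
      (matOp b (Matrix.single 0 j 1) * star (V : H →L[ℂ] H)) =
      adj V (matOp b (Matrix.single i j 1)) := by
    intro i j
    rw [star_mul, star_star, ← map_star, Matrix.star_eq_conjTranspose,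
      Matrix.conjTranspose_single, star_one, adj, Unitary.conjStarAlgAut_apply, mul_assoc,
      ← mul_assoc (matOp b _), ← map_mul, Matrix.single_mul_single_same, mul_one, mul_assoc]
  have h3 : ∀ i j (A : H →L[ℂ] H), inner ℂ ((U : H →L[ℂ] H) (b i)) (A ((U : H →L[ℂ] H) (b j))) =
      inner ℂ (b i) (adj (definingRep b (g * q)⁻¹) A (b j)) := by
    intro i j A
    rw [map_inv, ← hU, ← Unitary.star_eq_inv, adj, Unitary.conjStarAlgAut_apply,
      Unitary.coe_star, star_star, mul_apply_eq_comp, mul_apply_eq_comp,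
      ContinuousLinearMap.star_eq_adjoint, ContinuousLinearMap.adjoint_inner_right]
  set F : (H →L[ℂ] H) →ₗ[ℂ] (H →L[ℂ] H) := adjₗ (definingRep b (g * q)⁻¹) ∘ₗ Φ ∘ₗ adjₗ V with hF
  have hFA : ∀ A, F A = adj (definingRep b (g * q)⁻¹) (Φ (adj V A)) := fun A => rfl
  have hF1 : F 1 = 1 := by rw [hFA, map_one, hone, map_one]
  have hFP : ∀ l, F (pauliOp b l) = ((kleinSign a l * d l : ℝ) : ℂ) • pauliOp b l := by
    intro l
    have e : kleinSign a l • adj (definingRep b q⁻¹) (pauliOp b l) = pauliOp b l := by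
      rw [← adj_real_smul, ← hq, adj_definingRep_inv']
    have e2 : adj (definingRep b q⁻¹) (pauliOp b l) = kleinSign a l • pauliOp b l := by
      nth_rewrite 2 [← e]
      rw [smul_smul, kleinSign_mul_self, one_smul]
    rw [hFA, hΦ, adj_real_smul, mul_inv_rev, adj_definingRep_mul, adj_definingRep_inv', e2,
      smul_smul, Complex.coe_smul, mul_comm]
  have hFM : ∀ M, F (matOp b M) = matOp b ((M.trace / 2) • 1 +
      ∑ l, ((pauli l * M).trace / 2 * (kleinSign a l * d l : ℝ)) • pauli l) := by
    intro M
    conv_lhs => rw [pauli_expansion M]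
    simp only [map_add, map_sum, map_one, map_smul, hF1]
    congr 1
    refine Finset.sum_congr rfl fun l _ => ?_
    rw [← pauliOp, hFP, smul_smul]
  simp only [h2, h3, ← hFA, hFM, inner_matOp_apply] at h1
  rw [sum_single_expansion] at h1
  have h4 : (1 : ℂ) + ∑ l, ((kleinSign a l * d l : ℝ) : ℂ) =
      ((1 + ∑ j, kleinSign a j * d j : ℝ) : ℂ) := by
    push_cast
    rfl
  rwa [h4, Complex.ofReal_re] at h1

/-- The numbers `(1 + ∑ j, kleinSign a j * d j) / 4` are the barycentric coordinates of `d` in the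
tetrahedron of the Klein signs. -/
theorem exists_mixture_of_isTwoPositive {Φ : (H →L[ℂ] H) →ₗ[ℂ] (H →L[ℂ] H)}
    (hpos : IsPositiveMap Φ) (hΦ2 : IsTwoPositive Φ) (htr : IsTracePreserving Φ)
    (hone : IsUnitalMap Φ) :
    ∃ (g : Fin 4 → SU2) (p : Fin 4 → ℝ≥0), ∑ a, p a = 1 ∧ Φ = mixture b g p 0 := by
  obtain ⟨g, h, d, -, hΦ⟩ := exists_diagonal b hpos htr hone
  have hp : ∀ a, 0 ≤ (1 + ∑ j, kleinSign a j * d j) / 4 := fun a =>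
    div_nonneg (one_add_kleinSign_nonneg b hΦ2 hone hΦ a) (by norm_num)
  set p : Fin 4 → ℝ≥0 := fun a => ⟨_, hp a⟩
  have hpc : ∀ a, (p a : ℝ) = (1 + ∑ j, kleinSign a j * d j) / 4 := fun _ => rfl
  have hp1 : ∑ a, (p a : ℝ) = 1 := by
    simp only [hpc]
    simp [Fin.sum_univ_four, Fin.sum_univ_three, kleinSign]
    ring
  obtain ⟨g', hg'⟩ := exists_mixture_of_weights b (p := p) (m := 0) hone hΦ (by simpa using hp1)
    (fun j => by
      simp only [hpc]
      fin_cases j <;> simp [Fin.sum_univ_four, Fin.sum_univ_three, kleinSign] <;> ring)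
  exact ⟨g', p, by exact_mod_cast hp1, hg'⟩

theorem mixture_isCompletelyPositiveMap (g : Fin 4 → SU2) (p : Fin 4 → ℝ≥0) :
    IsCompletelyPositiveMap (mixture b g p 0) := by
  refine ⟨⟨mixture b g p 0, fun k M hM => ?_⟩, rfl⟩
  have h1 : M.map (mixture b g p 0) = ∑ a, (p a : ℝ) • M.map (adj (definingRep b (g a))) := by
    refine CStarMatrix.ext fun i j => ?_
    have h2 : ∀ (s : Finset (Fin 4)) (N : Fin 4 → CStarMatrix (Fin k) (Fin k) (H →L[ℂ] H)),
        (∑ a ∈ s, N a) i j = ∑ a ∈ s, N a i j := fun s N => Matrix.sum_apply i j s N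
    rw [h2, CStarMatrix.map_apply, mixture_apply]
    simp [NNReal.smul_def]
  refine h1 ▸ Finset.sum_nonneg fun a _ => smul_nonneg (p a).2 ?_
  exact CompletelyPositiveMapClass.map_cstarMatrix_nonneg' (adj (definingRep b (g a))) k M hM

theorem isPositive_of_isCompletelyPositiveMap {Φ : (H →L[ℂ] H) →ₗ[ℂ] (H →L[ℂ] H)}
    (hΦ : IsCompletelyPositiveMap Φ) : IsPositiveMap Φ := by
  obtain ⟨Ψ, rfl⟩ := hΦ
  intro A hA
  rw [← ContinuousLinearMap.nonneg_iff_isPositive] at hA ⊢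
  exact map_nonneg Ψ hA

end CompletelyPositiveMaps

/-! ### Twirling integrals and atomic measures. -/

section Twirls

section Twirl

variable {H : Type*} [NormedAddCommGroup H] [InnerProductSpace ℂ H] [CompleteSpace H]
  {X : Type*} [MeasurableSpace X]

theorem norm_adj (U : unitary (H →L[ℂ] H)) (A : H →L[ℂ] H) : ‖adj U A‖ = ‖A‖ :=
  NonUnitalStarAlgHom.norm_map (adj U) (adj U).injective A

theorem measurable_adj {π : X → unitary (H →L[ℂ] H)} (hπ : Measurable π) (A : H →L[ℂ] H) :
    Measurable fun x => adj (π x) A := by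
  have hc : Continuous fun U : H →L[ℂ] H => U * A * star U := by fun_prop
  exact hc.measurable.comp (measurable_subtype_coe.comp hπ)

/-- Positive, trace-preserving and unital maps. -/
def IsPTU {H : Type*} [NormedAddCommGroup H] [InnerProductSpace ℂ H]
    (Φ : (H →L[ℂ] H) →ₗ[ℂ] (H →L[ℂ] H)) : Prop :=
  IsPositiveMap Φ ∧ IsTracePreserving Φ ∧ IsUnitalMap Φ

theorem isPositiveMap_iff {H : Type*} [NormedAddCommGroup H] [InnerProductSpace ℂ H]
    {Φ : (H →L[ℂ] H) →ₗ[ℂ] (H →L[ℂ] H)} :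
    IsPositiveMap Φ ↔ ∀ A, 0 ≤ A → 0 ≤ Φ A := by
  simp only [IsPositiveMap, ContinuousLinearMap.nonneg_iff_isPositive]

theorem isPTU_adjₗ_comp {N : (H →L[ℂ] H) →ₗ[ℂ] (H →L[ℂ] H)} (hN : IsPTU N)
    (U : unitary (H →L[ℂ] H)) : IsPTU (adjₗ U ∘ₗ N) := by
  refine ⟨isPositiveMap_iff.mpr fun A hA => ?_, fun A => ?_, ?_⟩
  · exact map_nonneg (adj U) (isPositiveMap_iff.mp hN.1 A hA)
  · rw [LinearMap.comp_apply, adjₗ_apply, opTrace_adj, hN.2.1]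
  · rw [IsUnitalMap, LinearMap.comp_apply, hN.2.2, adjₗ_apply, map_one]

theorem isPTU_univNot (b : OrthonormalBasis (Fin 2) ℂ H) :
    IsPTU (univNot : (H →L[ℂ] H) →ₗ[ℂ] (H →L[ℂ] H)) := by
  refine ⟨isPositiveMap_iff.mpr fun A hA => ?_, fun A => ?_, univNot_one b⟩
  · obtain ⟨c, w, hA', hc⟩ := exists_smul_one_add_bloch b hA.isSelfAdjoint.star_eq
    have hN : univNot A = c • 1 + bloch b (-w) := by
      rw [univNot_apply, hc, map_neg]
      nth_rewrite 1 [hA']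
      rw [← Complex.coe_smul, two_mul, add_smul]
      abel
    rw [hA', smul_one_add_bloch_nonneg_iff] at hA
    rw [hN, smul_one_add_bloch_nonneg_iff, norm_neg]
    exact hA
  · rw [univNot_apply, opTrace_sub, opTrace_smul, opTrace_one b]
    ring

variable [FiniteDimensional ℂ H]

theorem aestronglyMeasurable_adj {π : X → unitary (H →L[ℂ] H)} (hπ : Measurable π)
    (μ : Measure X) (A : H →L[ℂ] H) : AEStronglyMeasurable (fun x => adj (π x) A) μ := by
  have : ProperSpace (H →L[ℂ] H) := FiniteDimensional.proper ℂ (H →L[ℂ] H)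
  have : SecondCountableTopology (H →L[ℂ] H) := secondCountable_of_proper
  exact (measurable_adj hπ A).aestronglyMeasurable

theorem integrable_adj {π : X → unitary (H →L[ℂ] H)} (hπ : Measurable π) (μ : Measure X)
    [IsFiniteMeasure μ] (A : H →L[ℂ] H) : Integrable (fun x => adj (π x) A) μ :=
  Integrable.of_bound (aestronglyMeasurable_adj hπ μ A) ‖A‖ (ae_of_all _ fun _ => (norm_adj _ A).le)

/-- The twirling map `A ↦ ∫ π A π* dμ`. -/
def twirl {π : X → unitary (H →L[ℂ] H)} (hπ : Measurable π) (μ : Measure X) [IsFiniteMeasure μ] :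
    (H →L[ℂ] H) →ₗ[ℂ] (H →L[ℂ] H) where
  toFun A := ∫ x, adj (π x) A ∂μ
  map_add' A B := by
    simp only [map_add]
    exact integral_add (integrable_adj hπ μ A) (integrable_adj hπ μ B)
  map_smul' c A := by
    simp only [map_smul]
    exact integral_smul c _

variable {π : X → unitary (H →L[ℂ] H)} (hπ : Measurable π) (μ ν : Measure X)
  [IsFiniteMeasure μ] [IsFiniteMeasure ν]

theorem twirl_apply (A : H →L[ℂ] H) : twirl hπ μ A = ∫ x, adj (π x) A ∂μ := rfl

theorem twirl_one : twirl hπ μ 1 = μ.real Set.univ • 1 := by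
  simp [twirl_apply]

theorem twirl_nonneg {A : H →L[ℂ] H} (hA : 0 ≤ A) : 0 ≤ twirl hπ μ A :=
  integral_nonneg fun x => map_nonneg (adj (π x)) hA

theorem continuousLinearMap_twirl {V : Type*} [NormedAddCommGroup V] [NormedSpace ℂ V]
    [CompleteSpace V] (F : (H →L[ℂ] H) →L[ℂ] V) (A : H →L[ℂ] H) :
    F (twirl hπ μ A) = ∫ x, F (adj (π x) A) ∂μ :=
  (F.integral_comp_comm (integrable_adj hπ μ A)).symm

theorem opTrace_twirl (A : H →L[ℂ] H) : opTrace (twirl hπ μ A) = μ.real Set.univ • opTrace A := by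
  have h := continuousLinearMap_twirl hπ μ (LinearMap.toContinuousLinearMap (opTraceₗ H)) A
  simp only [LinearMap.coe_toContinuousLinearMap', opTraceₗ_apply, opTrace_adj] at h
  rw [h, integral_const]

theorem isTwoPositive_twirl : IsTwoPositive (twirl hπ μ) := by
  intro B x
  have h1 : ∀ i j (C : H →L[ℂ] H), inner ℂ (x i) (twirl hπ μ C (x j)) =
      ∫ y, inner ℂ (x i) (adj (π y) C (x j)) ∂μ := fun i j C =>
    continuousLinearMap_twirl hπ μ
      ((innerSL ℂ (x i)).comp (ContinuousLinearMap.apply ℂ H (x j))) C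
  have h2 : ∀ i j (C : H →L[ℂ] H), Integrable (fun y => inner ℂ (x i) (adj (π y) C (x j))) μ :=
    fun i j C => ((innerSL ℂ (x i)).comp (ContinuousLinearMap.apply ℂ H (x j))).integrable_comp
      (integrable_adj hπ μ C)
  simp only [h1]
  have h3 : ∑ i, ∑ j, ∫ y, inner ℂ (x i) (adj (π y) (star (B i) * B j) (x j)) ∂μ =
      ∫ y, ∑ i, ∑ j, inner ℂ (x i) (adj (π y) (star (B i) * B j) (x j)) ∂μ := by
    rw [integral_finsetSum _ fun i _ => integrable_finsetSum _ fun j _ => h2 i j _]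
    refine Finset.sum_congr rfl fun i _ => ?_
    rw [integral_finsetSum _ fun j _ => h2 i j _]
  rw [h3]
  have h4 : ∀ y, 0 ≤ (∑ i, ∑ j, inner ℂ (x i) (adj (π y) (star (B i) * B j) (x j))).re := by
    intro y
    have h5 : ∀ i j, inner ℂ (x i) (adj (π y) (star (B i) * B j) (x j)) =
        inner ℂ (B i (star (π y : H →L[ℂ] H) (x i))) (B j (star (π y : H →L[ℂ] H) (x j))) := by
      intro i j
      rw [adj, Unitary.conjStarAlgAut_apply, mul_apply_eq_comp, mul_apply_eq_comp,
        mul_apply_eq_comp, ContinuousLinearMap.star_eq_adjoint,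
        ContinuousLinearMap.star_eq_adjoint, ← ContinuousLinearMap.adjoint_inner_left,
        ContinuousLinearMap.adjoint_inner_right]
    simp only [h5, ← inner_sum, ← sum_inner]
    exact inner_self_nonneg (𝕜 := ℂ)
  have h6 := integral_re (𝕜 := ℂ) (integrable_finsetSum Finset.univ fun i _ =>
    integrable_finsetSum Finset.univ fun j _ => h2 i j (star (B i) * B j))
  simp only [RCLike.re_eq_complex_re] at h6
  rw [← h6]
  exact integral_nonneg h4

/-- The common shape of both integral forms: `N` is `A ↦ J A* J` in the pair form and the flip of
`s_k` in the signed form. -/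
theorem isPTU_twirl_add {N Φ : (H →L[ℂ] H) →ₗ[ℂ] (H →L[ℂ] H)} (hN : IsPTU N)
    (hμν : (μ + ν) Set.univ = 1) (hΦ : ∀ A, Φ A = twirl hπ μ A + twirl hπ ν (N A)) : IsPTU Φ := by
  have hm : μ.real Set.univ + ν.real Set.univ = 1 := by
    rw [Measure.add_apply] at hμν
    rw [measureReal_def, measureReal_def, ← ENNReal.toReal_add (measure_ne_top _ _)
      (measure_ne_top _ _), hμν, ENNReal.toReal_one]
  refine ⟨isPositiveMap_iff.mpr fun A hA => ?_, fun A => ?_, ?_⟩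
  · rw [hΦ]
    exact add_nonneg (twirl_nonneg hπ μ hA) (twirl_nonneg hπ ν (isPositiveMap_iff.mp hN.1 A hA))
  · rw [hΦ, opTrace_add, opTrace_twirl, opTrace_twirl, hN.2.1, ← add_smul, hm, one_smul]
  · rw [IsUnitalMap, hΦ, hN.2.2, twirl_one, twirl_one, ← add_smul, hm, one_smul]

end Twirl

section Atoms

variable {X : Type*} [MeasurableSpace X]

/-- The measure with masses `p a` at the points `x a`. -/
def atomMeasure (p : Fin 4 → ℝ≥0) (x : Fin 4 → X) : Measure X := ∑ a, p a • Measure.dirac (x a)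

instance (p : Fin 4 → ℝ≥0) (x : Fin 4 → X) : IsFiniteMeasure (atomMeasure p x) := by
  unfold atomMeasure
  infer_instance

theorem atomMeasure_apply {s : Set X} (hs : MeasurableSet s) (p : Fin 4 → ℝ≥0) (x : Fin 4 → X) :
    atomMeasure p x s = ∑ a, (p a : ℝ≥0∞) * s.indicator 1 (x a) := by
  simp only [atomMeasure, Measure.coe_finsetSum, Finset.sum_apply, Measure.smul_apply,
    Measure.dirac_apply' _ hs]
  rfl

theorem atomMeasure_univ (p : Fin 4 → ℝ≥0) (x : Fin 4 → X) :
    atomMeasure p x Set.univ = ∑ a, (p a : ℝ≥0∞) := by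
  simp [atomMeasure_apply]

theorem integral_atomMeasure [MeasurableSingletonClass X] {V : Type*} [NormedAddCommGroup V]
    [NormedSpace ℝ V] [CompleteSpace V] (p : Fin 4 → ℝ≥0) (x : Fin 4 → X) (f : X → V) :
    ∫ y, f y ∂(atomMeasure p x) = ∑ a, p a • f (x a) := by
  rw [atomMeasure, integral_finsetSum_measure]
  · simp [integral_smul_nnreal_measure]
  · intro a _
    exact Integrable.smul_measure_nnreal (integrable_dirac (by simp))

theorem mutuallySingular_atomMeasure [MeasurableSingletonClass X] (p m : Fin 4 → ℝ≥0)
    {x y : Fin 4 → X} (h : ∀ a c, x a ≠ y c) : atomMeasure p x ⟂ₘ atomMeasure m y := by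
  refine ⟨Set.range y, (Set.finite_range y).measurableSet, ?_, ?_⟩
  · rw [atomMeasure_apply (Set.finite_range y).measurableSet]
    refine Finset.sum_eq_zero fun a _ => ?_
    rw [Set.indicator_of_notMem (by rintro ⟨c, hc⟩; exact h a c hc.symm), mul_zero]
  · rw [atomMeasure_apply (Set.finite_range y).measurableSet.compl]
    refine Finset.sum_eq_zero fun a _ => ?_
    rw [Set.indicator_of_notMem (by simp), mul_zero]

end Atoms

end Twirls

/-! ### The pair form and the signed form as twirls. -/

section RepresentationForms

variable {H : Type*} [NormedAddCommGroup H] [InnerProductSpace ℂ H] [CompleteSpace H]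
  (b : OrthonormalBasis (Fin 2) ℂ H)

section Transposition

theorem IsComplexConjugation.apply_apply {H : Type*} [NormedAddCommGroup H] [InnerProductSpace ℂ H]
    {J : H ≃ₛₗᵢ[starRingEnd ℂ] H} (hJ : IsComplexConjugation J) (x : H) : J (J x) = x := by
  rw [← sub_eq_zero, ← norm_eq_zero, ← sq_eq_zero_iff, @norm_sub_sq ℂ, hJ (J x) x]
  simp only [LinearIsometryEquiv.norm_map, inner_self_eq_norm_sq]
  ring

theorem IsComplexConjugation.inner_comm {H : Type*} [NormedAddCommGroup H] [InnerProductSpace ℂ H]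
    {J : H ≃ₛₗᵢ[starRingEnd ℂ] H} (hJ : IsComplexConjugation J) (x y : H) :
    inner ℂ x (J y) = inner ℂ y (J x) := by
  rw [← inner_conj_symm, hJ y x, inner_conj_symm]

variable {J : H ≃ₛₗᵢ[starRingEnd ℂ] H}

theorem transposition_apply (J : H ≃ₛₗᵢ[starRingEnd ℂ] H) (A : H →L[ℂ] H) (x : H) :
    transposition J A x = J (star A (J x)) := rfl

/-- The map `A ↦ J A* J`, as a linear map. -/
def transpositionₗ (J : H ≃ₛₗᵢ[starRingEnd ℂ] H) : (H →L[ℂ] H) →ₗ[ℂ] (H →L[ℂ] H) where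
  toFun := transposition J
  map_add' A B := by
    ext x
    simp [transposition_apply]
  map_smul' c A := by
    ext x
    simp [transposition_apply, LinearIsometryEquiv.map_smulₛₗ]

theorem transpositionₗ_apply (A : H →L[ℂ] H) : transpositionₗ J A = transposition J A := rfl

theorem transposition_one (hJ : IsComplexConjugation J) :
    transposition J (1 : H →L[ℂ] H) = 1 := by
  ext x
  simp [transposition_apply, hJ.apply_apply]

theorem transposition_mul (hJ : IsComplexConjugation J) (A B : H →L[ℂ] H) :
    transposition J (A * B) = transposition J B * transposition J A := by
  ext x
  simp [transposition_apply, hJ.apply_apply]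

theorem star_transposition (hJ : IsComplexConjugation J) (A : H →L[ℂ] H) :
    star (transposition J A) = transposition J (star A) := by
  rw [ContinuousLinearMap.star_eq_adjoint, eq_comm, ContinuousLinearMap.eq_adjoint_iff]
  intro x y
  rw [transposition_apply, transposition_apply, star_star, hJ, hJ.inner_comm,
    ContinuousLinearMap.star_eq_adjoint, ContinuousLinearMap.adjoint_inner_left]

/-- Transposition reverses products, and the extra minus signs restore the Pauli relations for the
operators `-J σ_j J`. These are therefore unitarily conjugate to the `σ_j`. -/
theorem exists_adj_transposition (hJ : IsComplexConjugation J) :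
    ∃ g : SU2, ∀ A, univNot A = adj (definingRep b g) (transposition J A) := by
  have hneg : ∀ c : ℂ, ∀ A, transposition J (c • A) = c • transposition J A :=
    map_smul (transpositionₗ J)
  have hmul : ∀ A B : H →L[ℂ] H, -transposition J A * -transposition J B = transposition J (B * A) :=
    fun A B => by rw [neg_mul_neg, transposition_mul hJ]
  obtain ⟨g, hg⟩ := exists_adj_pauliOp b (S := fun j => -transposition J (pauliOp b j))
    (fun j => by rw [star_neg, star_transposition hJ, star_pauliOp])
    (by rw [hmul, pauliOp_mul_self, transposition_one hJ])
    (by rw [hmul, pauliOp_mul_self, transposition_one hJ])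
    (by
      have h := congrArg star (pauliOp_zero_mul_one b)
      rw [star_mul, star_smul, star_pauliOp, star_pauliOp, star_pauliOp] at h
      rw [hmul, h, hneg, smul_neg, Complex.star_def, Complex.conj_I, neg_smul])
  refine ⟨g⁻¹, fun A => ?_⟩
  have : univNot = adjₗ (definingRep b g⁻¹) ∘ₗ transpositionₗ J := by
    apply linearMap_ext_pauliOp b
    · rw [univNot_one b, LinearMap.comp_apply, transpositionₗ_apply, transposition_one hJ,
        adjₗ_apply, map_one]
    · intro j
      rw [univNot_pauliOp, LinearMap.comp_apply, transpositionₗ_apply, adjₗ_apply,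
        ← neg_neg (transposition J _), ← hg, map_neg, adj_definingRep_inv']
  exact congrArg (fun F => F A) this

theorem isPTU_transpositionₗ (b : OrthonormalBasis (Fin 2) ℂ H) (hJ : IsComplexConjugation J) : IsPTU (transpositionₗ J) := by
  obtain ⟨g, hg⟩ := exists_adj_transposition b hJ
  have h : transpositionₗ J = adjₗ (definingRep b g⁻¹) ∘ₗ univNot := by
    ext1 A
    rw [LinearMap.comp_apply, hg, adjₗ_apply, adj_definingRep_inv', transpositionₗ_apply]
  rw [h]
  exact isPTU_adjₗ_comp (isPTU_univNot b) _

end Transposition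

section SpinFlip

/-- The map changing the sign of the component along `s_k`. -/
def spinFlip (k : Fin 3) : (H →L[ℂ] H) →ₗ[ℂ] (H →L[ℂ] H) where
  toFun A := A - opTrace (pauliOp b k * A) • pauliOp b k
  map_add' A B := by
    rw [mul_add, opTrace_add, add_smul]
    abel
  map_smul' c A := by
    rw [mul_smul_comm, opTrace_smul, RingHom.id_apply, smul_sub, smul_smul]

theorem spinFlip_apply (k : Fin 3) (A : H →L[ℂ] H) :
    spinFlip b k A = A - opTrace (pauliOp b k * A) • pauliOp b k := rfl

/-- The inversion `w ↦ -w` is the reflection along axis `k` followed by the half-turn about that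
axis, which is row `k.succ` of the Klein signs. -/
theorem exists_adj_spinFlip (k : Fin 3) :
    ∃ g : SU2, ∀ A, univNot A = adj (definingRep b g) (spinFlip b k A) := by
  obtain ⟨g, hg⟩ := exists_klein b k.succ
  refine ⟨g, fun A => ?_⟩
  have : univNot = adjₗ (definingRep b g) ∘ₗ spinFlip b k := by
    apply linearMap_ext_pauliOp b
    · rw [univNot_one b, LinearMap.comp_apply, spinFlip_apply, mul_one, opTrace_pauliOp, zero_smul,
        sub_zero, adjₗ_apply, map_one]
    · intro j
      rw [univNot_pauliOp, LinearMap.comp_apply, spinFlip_apply, opTrace_pauliOp_mul, adjₗ_apply,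
        map_sub, map_smul, hg, hg]
      fin_cases k <;> fin_cases j <;> simp [kleinSign, two_smul]
  exact congrArg (fun F => F A) this

theorem isPTU_spinFlip (k : Fin 3) : IsPTU (spinFlip b k) := by
  obtain ⟨g, hg⟩ := exists_adj_spinFlip b k
  have h : spinFlip b k = adjₗ (definingRep b g⁻¹) ∘ₗ univNot := by
    ext1 A
    rw [LinearMap.comp_apply, hg, adjₗ_apply, adj_definingRep_inv']
  rw [h]
  exact isPTU_adjₗ_comp (isPTU_univNot b) _

theorem two_mul_hsInner_spin (l : Fin 3) (A : H →L[ℂ] H) :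
    2 * hsInner (spin b l) A = opTrace (pauliOp b l * A) := by
  rw [hsInner, spin_eq, star_smul, star_pauliOp, smul_mul_assoc, opTrace_smul]
  simp

theorem spin_expansion (A : H →L[ℂ] H) :
    A = opTrace A • spinZero H + ∑ l, (2 * hsInner (spin b l) A) • spin b l := by
  conv_lhs => rw [pauliOp_expansion b A]
  simp only [two_mul_hsInner_spin]
  simp only [spin_eq, spinZero, smul_smul, div_eq_mul_inv, one_mul]

theorem spinFlip_eq (k : Fin 3) (A : H →L[ℂ] H) :
    spinFlip b k A = opTrace A • spinZero H - (2 * hsInner (spin b k) A) • spin b k +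
      ∑ l ∈ Finset.univ.erase k, (2 * hsInner (spin b l) A) • spin b l := by
  have h := spin_expansion b A
  rw [← Finset.add_sum_erase _ _ (Finset.mem_univ k)] at h
  rw [spinFlip_apply]
  nth_rewrite 1 [h]
  have h2 : opTrace (pauliOp b k * A) • pauliOp b k =
      (2 : ℂ) • (2 * hsInner (spin b k) A) • spin b k := by
    rw [two_mul_hsInner_spin, spin_eq, smul_smul, smul_smul]
    congr 1
    ring
  rw [h2, two_smul]
  abel

end SpinFlip

section Forms

variable [FiniteDimensional ℂ H] {X : Type*} [MeasurableSpace X]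
  {π : X → unitary (H →L[ℂ] H)} (hπ : Measurable π)

theorem isFiniteMeasure_of_add_univ {μ ν : Measure X} (h : (μ + ν) Set.univ = 1) :
    IsFiniteMeasure μ ∧ IsFiniteMeasure ν := by
  rw [Measure.add_apply] at h
  exact ⟨⟨lt_of_le_of_lt (self_le_add_right _ _) (h ▸ ENNReal.one_lt_top)⟩,
    ⟨lt_of_le_of_lt (self_le_add_left _ _) (h ▸ ENNReal.one_lt_top)⟩⟩

theorem IsPairForm.isPTU (b : OrthonormalBasis (Fin 2) ℂ H) (hπ : Measurable π) {J : H ≃ₛₗᵢ[starRingEnd ℂ] H}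
    (hJ : IsComplexConjugation J)
    {μ ν : ℝ≥0 → Measure X} {Λ : ℝ≥0 → (H →L[ℂ] H) →ₗ[ℂ] (H →L[ℂ] H)}
    (h : IsPairForm J π μ ν Λ) (t : ℝ≥0) : IsPTU (Λ t) := by
  obtain ⟨_, _⟩ := isFiniteMeasure_of_add_univ (h.1 t)
  exact isPTU_twirl_add hπ (μ t) (ν t) (isPTU_transpositionₗ b hJ) (h.1 t) (h.2 t)

/-- In the Jordan decomposition the negative part enters with a minus sign along `s_k` and with a
plus sign along the other `s_l`; that is the effect of `spinFlip b k` before twirling. Total mass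
one accounts for the `s₀` term. -/
theorem signedForm_eq (hπ : Measurable π) (k : Fin 3) (σ : SignedMeasure X)
    (hσ : σ.totalVariation Set.univ = 1) (A : H →L[ℂ] H) :
    opTrace A • spinZero H
      + (2 * hsInner (spin b k) A) •
          (∫ᵛ x, ((π x : H →L[ℂ] H) * spin b k * star (π x : H →L[ℂ] H)) ∂<•σ)
      + ∑ l ∈ Finset.univ.erase k, (2 * hsInner (spin b l) A) •
          (∫ x, (π x : H →L[ℂ] H) * spin b l * star (π x : H →L[ℂ] H) ∂σ.totalVariation) =
    twirl hπ σ.toJordanDecomposition.posPart A +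
      twirl hπ σ.toJordanDecomposition.negPart (spinFlip b k A) := by
  set j := σ.toJordanDecomposition with hj
  have hm : j.posPart.real Set.univ + j.negPart.real Set.univ = 1 := by
    rw [measureReal_def, measureReal_def, ← ENNReal.toReal_add (measure_ne_top _ _)
      (measure_ne_top _ _), ← Measure.add_apply]
    exact (congrArg ENNReal.toReal hσ).trans ENNReal.toReal_one
  have h0 : spinZero H = twirl hπ j.posPart (spinZero H) + twirl hπ j.negPart (spinZero H) := by
    rw [spinZero, map_smul, map_smul, twirl_one, twirl_one, ← smul_add, ← add_smul, hm, one_smul]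
  have h1 : (∫ᵛ x, ((π x : H →L[ℂ] H) * spin b k * star (π x : H →L[ℂ] H)) ∂<•σ) =
      twirl hπ j.posPart (spin b k) - twirl hπ j.negPart (spin b k) := by
    have hσj : σ = j.posPart.toSignedMeasure - j.negPart.toSignedMeasure :=
      (SignedMeasure.toSignedMeasure_toJordanDecomposition σ).symm
    have hi : ∀ (μ : Measure X) [IsFiniteMeasure μ], μ.toSignedMeasure.Integrable
        (fun x => (π x : H →L[ℂ] H) * spin b k * star (π x : H →L[ℂ] H)) := by
      intro μ _
      rw [VectorMeasure.Integrable, Measure.variation_toSignedMeasure]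
      exact integrable_adj hπ μ (spin b k)
    conv_lhs => rw [hσj]
    rw [VectorMeasure.integral_sub_vectorMeasure (hi _) (hi _), VectorMeasure.integral_toSignedMeasure,
      VectorMeasure.integral_toSignedMeasure]
    rfl
  have h2 : ∀ l, (∫ x, (π x : H →L[ℂ] H) * spin b l * star (π x : H →L[ℂ] H) ∂σ.totalVariation) =
      twirl hπ j.posPart (spin b l) + twirl hπ j.negPart (spin b l) := fun l =>
    integral_add_measure (integrable_adj hπ _ _) (integrable_adj hπ _ _)
  rw [h1]
  simp only [h2]
  nth_rewrite 1 [h0]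
  rw [spinFlip_eq]
  have h3 := congrArg (twirl hπ j.posPart) (spin_expansion b A)
  rw [← Finset.add_sum_erase _ _ (Finset.mem_univ k)] at h3
  rw [h3]
  simp only [map_add, map_sub, map_sum, map_smul, smul_add, smul_sub, Finset.sum_add_distrib]
  abel

theorem isSignedForm_iff (k : Fin 3) {σ : ℝ≥0 → SignedMeasure X}
    {Λ : ℝ≥0 → (H →L[ℂ] H) →ₗ[ℂ] (H →L[ℂ] H)} :
    IsSignedForm b k π σ Λ ↔ (∀ t, (σ t).totalVariation Set.univ = 1) ∧
      ∀ t A, Λ t A = twirl hπ (σ t).toJordanDecomposition.posPart A +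
        twirl hπ (σ t).toJordanDecomposition.negPart (spinFlip b k A) := by
  refine and_congr_right fun h => forall_congr' fun t => forall_congr' fun A => ?_
  rw [signedForm_eq b hπ k (σ t) (h t) A]

theorem IsSignedForm.isPTU (hπ : Measurable π) {k : Fin 3} {σ : ℝ≥0 → SignedMeasure X}
    {Λ : ℝ≥0 → (H →L[ℂ] H) →ₗ[ℂ] (H →L[ℂ] H)} (h : IsSignedForm b k π σ Λ) (t : ℝ≥0) :
    IsPTU (Λ t) := by
  rw [isSignedForm_iff b hπ] at h
  exact isPTU_twirl_add hπ _ _ (isPTU_spinFlip b k) (h.1 t) (h.2 t)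

end Forms

end RepresentationForms

/-! ### Topology of SU(2), existence of the forms, complete positivity. -/

section SpecialUnitaryGroup

variable {H : Type*} [NormedAddCommGroup H] [InnerProductSpace ℂ H] [CompleteSpace H]
  (b : OrthonormalBasis (Fin 2) ℂ H)

theorem continuous_matOp : Continuous (matOp b) :=
  LinearMap.continuous_of_finiteDimensional (matOp b).toAlgEquiv.toLinearMap

theorem continuous_definingRep : Continuous (definingRep b) :=
  ((continuous_matOp b).comp continuous_subtype_val).subtype_mk _

theorem measurable_definingRep : Measurable (definingRep b) :=
  (continuous_definingRep b).measurable

instance : CompactSpace SU2 := by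
  have h1 : IsCompact (Set.pi Set.univ fun _ : Fin 2 => Set.pi Set.univ fun _ : Fin 2 =>
      Metric.closedBall (0 : ℂ) 1) :=
    isCompact_univ_pi fun _ => isCompact_univ_pi fun _ => isCompact_closedBall _ _
  have h2 : IsClosed {M : Matrix (Fin 2) (Fin 2) ℂ | star M * M = 1 ∧ M.det = 1} :=
    (isClosed_eq (by fun_prop) continuous_const).inter
      (isClosed_eq (Continuous.matrix_det continuous_id) continuous_const)
  have h3 : ((Matrix.specialUnitaryGroup (Fin 2) ℂ : Set (Matrix (Fin 2) (Fin 2) ℂ))) =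
      {M | star M * M = 1 ∧ M.det = 1} := by
    ext M
    rw [SetLike.mem_coe, Matrix.mem_specialUnitaryGroup_iff, Matrix.mem_unitaryGroup_iff']
    rfl
  refine isCompact_iff_compactSpace.mp (h1.of_isClosed_subset (h3 ▸ h2) fun M hM => ?_)
  intro i _ l _
  rw [mem_closedBall_zero_iff]
  exact entry_norm_bound_of_unitary (Matrix.specialUnitaryGroup_le_unitaryGroup hM) i l

instance : SecondCountableTopology SU2 := by
  have : SecondCountableTopology (Matrix (Fin 2) (Fin 2) ℂ) :=
    inferInstanceAs (SecondCountableTopology (Fin 2 → Fin 2 → ℂ))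
  exact TopologicalSpace.Subtype.secondCountableTopology _

instance : IsTopologicalGroup SU2 where
  continuous_mul := continuous_mul
  continuous_inv :=
    ((continuous_star (R := Matrix (Fin 2) (Fin 2) ℂ)).comp continuous_subtype_val).subtype_mk _

/-- The element `-1` of `SU(2)`. -/
def negOne : SU2 := ⟨-1, Matrix.mem_specialUnitaryGroup_iff.mpr
  ⟨by simp [Matrix.mem_unitaryGroup_iff], by simp [Matrix.det_fin_two]⟩⟩

theorem negOne_mul_negOne : negOne * negOne = 1 := by
  ext1
  simp [negOne]

theorem negOne_mul_ne (g : SU2) : negOne * g ≠ g := by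
  intro h
  have h2 : negOne = 1 := mul_eq_right.mp h
  have h3 := congrArg (fun x : SU2 => (x : Matrix (Fin 2) (Fin 2) ℂ) 0 0) h2
  simp [negOne] at h3
  norm_num [Complex.ext_iff] at h3

theorem adj_negOne_mul (g : SU2) : adj (definingRep b (negOne * g)) = adj (definingRep b g) := by
  have h : (definingRep b negOne : H →L[ℂ] H) = -1 := by
    change matOp b (-1) = -1
    rw [map_neg, map_one]
  ext1 A
  rw [adj_definingRep_mul, adj, Unitary.conjStarAlgAut_apply, h]
  simp

/-- A choice of one element from each pair `{g, -g}`. -/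
theorem exists_section : ∃ r : SU2 → SU2, (∀ g, r g = g ∨ r g = negOne * g) ∧
    ∀ g g', r g ≠ negOne * r g' := by
  have h1 : ∀ g, negOne * (negOne * g) = g := fun g => by
    rw [← mul_assoc, negOne_mul_negOne, one_mul]
  -- The unordered pair is the same for `g` and `-g`, so the choice depends on the pair only.
  set r : SU2 → SU2 := fun g => (Quot.out s(g, negOne * g)).1 with hr
  have h2 : ∀ g, r g = g ∨ r g = negOne * g := fun g => Sym2.mem_iff.mp (Sym2.out_fst_mem _)
  have h3 : ∀ g, r (negOne * g) = r g := fun g => by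
    simp only [hr, h1]
    rw [Sym2.eq_swap]
  refine ⟨r, h2, fun g g' h => ?_⟩
  have h4 : r g = r g' := by
    rcases h2 g with e | e <;> rcases h2 g' with e' | e' <;> rw [e, e'] at h
    · rw [h, h3]
    · rw [h, h1]
    · rw [← mul_left_cancel h]
    · rw [h1] at h
      rw [← h3 g, h]
  rw [h4] at h
  exact negOne_mul_ne _ h.symm

section Existence

variable [FiniteDimensional ℂ H] {X : Type*} [MeasurableSpace X] [MeasurableSingletonClass X]
  {π : X → unitary (H →L[ℂ] H)} {ι : SU2 → X}

theorem exists_isPairForm (hι : ∀ g, π (ι g) = definingRep b g)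
    {J : H ≃ₛₗᵢ[starRingEnd ℂ] H} (hJ : IsComplexConjugation J)
    {Λ : ℝ≥0 → (H →L[ℂ] H) →ₗ[ℂ] (H →L[ℂ] H)} {g : ℝ≥0 → Fin 4 → SU2} {p m : ℝ≥0 → Fin 4 → ℝ≥0}
    (hpm : ∀ t, ∑ a, p t a + ∑ a, m t a = 1) (hΛ : ∀ t, Λ t = mixture b (g t) (p t) (m t)) :
    ∃ x y : ℝ≥0 → Fin 4 → X, IsPairForm J π (fun t => atomMeasure (p t) (x t))
      (fun t => atomMeasure (m t) (y t)) Λ := by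
  obtain ⟨w, hw⟩ := exists_adj_transposition b hJ
  refine ⟨fun t a => ι (g t a), fun t a => ι (g t a * w), fun t => ?_, fun t A => ?_⟩
  · rw [Measure.add_apply, atomMeasure_univ, atomMeasure_univ]
    exact_mod_cast hpm t
  · change _ = ∫ x, adj (π x) A ∂_ + ∫ x, adj (π x) (transposition J A) ∂_
    rw [integral_atomMeasure, integral_atomMeasure, hΛ, mixture_apply]
    simp only [hι, adj_definingRep_mul, ← hw]

/-- The positive atoms are moved into the section `r` and the negative ones into its translate by
`-1`. Conjugations are unchanged, while the two measures become mutually singular. They thus form a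
Jordan decomposition, and the total variation is the sum of the weights. -/
theorem exists_isSignedForm (hπ : Measurable π) (hιi : Function.Injective ι)
    (hι : ∀ g, π (ι g) = definingRep b g) (k : Fin 3)
    {Λ : ℝ≥0 → (H →L[ℂ] H) →ₗ[ℂ] (H →L[ℂ] H)} {g : ℝ≥0 → Fin 4 → SU2} {p m : ℝ≥0 → Fin 4 → ℝ≥0}
    (hpm : ∀ t, ∑ a, p t a + ∑ a, m t a = 1) (hΛ : ∀ t, Λ t = mixture b (g t) (p t) (m t)) :
    ∃ (σ : ℝ≥0 → SignedMeasure X) (x y : ℝ≥0 → Fin 4 → X),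
      (∀ t, σ t = (atomMeasure (p t) (x t)).toSignedMeasure -
        (atomMeasure (m t) (y t)).toSignedMeasure) ∧ IsSignedForm b k π σ Λ := by
  obtain ⟨w, hw⟩ := exists_adj_spinFlip b k
  obtain ⟨r, hr, hr'⟩ := exists_section
  have hra : ∀ g, adj (definingRep b (r g)) = adj (definingRep b g) := by
    intro g
    rcases hr g with h | h
    · rw [h]
    · rw [h, adj_negOne_mul]
  set x : ℝ≥0 → Fin 4 → X := fun t a => ι (r (g t a)) with hx
  set y : ℝ≥0 → Fin 4 → X := fun t a => ι (negOne * r (g t a * w)) with hy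
  set j : ℝ≥0 → JordanDecomposition X := fun t => ⟨atomMeasure (p t) (x t), atomMeasure (m t) (y t),
    mutuallySingular_atomMeasure _ _ fun a c h => hr' _ _ (hιi h)⟩ with hj
  have hjt : ∀ t, (j t).toSignedMeasure.toJordanDecomposition = j t := fun t =>
    JordanDecomposition.toJordanDecomposition_toSignedMeasure _
  refine ⟨fun t => (j t).toSignedMeasure, x, y, fun t => rfl, ?_⟩
  rw [isSignedForm_iff b hπ]
  refine ⟨fun t => ?_, fun t A => ?_⟩
  · rw [SignedMeasure.totalVariation, hjt, Measure.add_apply, atomMeasure_univ, atomMeasure_univ]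
    exact_mod_cast hpm t
  · simp only [hjt]
    rw [twirl_apply, twirl_apply, integral_atomMeasure, integral_atomMeasure, hΛ, mixture_apply]
    simp only [hx, hy, hι, adj_negOne_mul, hra, adj_definingRep_mul, ← hw]

end Existence

section CompletePositivity

variable [FiniteDimensional ℂ H] {X : Type*} [MeasurableSpace X] {π : X → unitary (H →L[ℂ] H)}

/-- Positivity of the Choi form already produces a mixture of unitary conjugations. Hence an
integral of conjugations needs checking only at this level. -/
theorem isCompletelyPositiveMap_of_isTwoPositive (b : OrthonormalBasis (Fin 2) ℂ H)
    {Φ : (H →L[ℂ] H) →ₗ[ℂ] (H →L[ℂ] H)} (hΦ : IsPTU Φ)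
    (h2 : IsTwoPositive Φ) : IsCompletelyPositiveMap Φ := by
  obtain ⟨g, p, -, rfl⟩ := exists_mixture_of_isTwoPositive b hΦ.1 h2 hΦ.2.1 hΦ.2.2
  exact mixture_isCompletelyPositiveMap b g p

theorem IsPairForm.isCompletelyPositiveMap (b : OrthonormalBasis (Fin 2) ℂ H)
    (hπ : Measurable π) {J : H ≃ₛₗᵢ[starRingEnd ℂ] H} (hJ : IsComplexConjugation J)
    {μ ν : ℝ≥0 → Measure X} {Λ : ℝ≥0 → (H →L[ℂ] H) →ₗ[ℂ] (H →L[ℂ] H)}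
    (h : IsPairForm J π μ ν Λ) (hμ : ∀ t, IsProbabilityMeasure (μ t)) (t : ℝ≥0) :
    IsCompletelyPositiveMap (Λ t) := by
  refine isCompletelyPositiveMap_of_isTwoPositive b (h.isPTU b hπ hJ t) ?_
  have := hμ t
  have hν : ν t = 0 := by
    have h1 := h.1 t
    rw [Measure.add_apply, measure_univ] at h1
    rw [← Measure.measure_univ_eq_zero]
    exact (ENNReal.add_right_inj ENNReal.one_ne_top).mp (h1.trans (add_zero 1).symm)
  have h2 : Λ t = twirl hπ (μ t) := by
    ext1 A
    rw [h.2 t A, hν, integral_zero_measure, add_zero]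
    rfl
  rw [h2]
  exact isTwoPositive_twirl hπ (μ t)

theorem IsSignedForm.isCompletelyPositiveMap (b : OrthonormalBasis (Fin 2) ℂ H)
    (hπ : Measurable π) {k : Fin 3} {σ : ℝ≥0 → SignedMeasure X}
    {Λ : ℝ≥0 → (H →L[ℂ] H) →ₗ[ℂ] (H →L[ℂ] H)} (h : IsSignedForm b k π σ Λ)
    (hσ : IsProbabilityFamily σ) (t : ℝ≥0) : IsCompletelyPositiveMap (Λ t) := by
  refine isCompletelyPositiveMap_of_isTwoPositive b (h.isPTU b hπ t) ?_
  have h0 := (VectorMeasure.le_restrict_univ_iff_le _ _).mpr (hσ t).1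
  set μ := (σ t).toMeasureOfZeroLE Set.univ MeasurableSet.univ h0 with hμ
  have hj : (σ t).toJordanDecomposition = ⟨μ, 0, Measure.MutuallySingular.zero_right⟩ := by
    refine SignedMeasure.toJordanDecomposition_eq ?_
    rw [JordanDecomposition.toSignedMeasure, Measure.toSignedMeasure_zero, sub_zero]
    exact (SignedMeasure.toMeasureOfZeroLE_toSignedMeasure (σ t) h0).symm
  have h2 : Λ t = twirl hπ (σ t).toJordanDecomposition.posPart := by
    ext1 A
    rw [((isSignedForm_iff b hπ k).mp h).2 t A]
    have h3 : twirl hπ (σ t).toJordanDecomposition.negPart (spinFlip b k A) = 0 := by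
      rw [twirl_apply, hj, integral_zero_measure]
    rw [h3, add_zero]
  rw [h2]
  exact isTwoPositive_twirl hπ _

end CompletePositivity

end SpecialUnitaryGroup

/-! ### Limits of convolution powers on a compact group. -/

section ConvolutionSemigroups

section Convolution

variable {G : Type*} [Group G] [TopologicalSpace G] [IsTopologicalGroup G] [CompactSpace G]
  [T2Space G] [SecondCountableTopology G] [MeasurableSpace G] [BorelSpace G]

instance convolutionMonoid : Monoid (ProbabilityMeasure G) where
  mul μ ν := ⟨(μ : Measure G).mconv ν, inferInstance⟩
  one := ⟨Measure.dirac 1, inferInstance⟩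
  mul_assoc μ ν ρ := Subtype.ext (Measure.mconv_assoc (μ : Measure G) ν ρ)
  one_mul μ := Subtype.ext (Measure.dirac_one_mconv (μ : Measure G))
  mul_one μ := Subtype.ext (Measure.mconv_dirac_one (μ : Measure G))

theorem toMeasure_mul (μ ν : ProbabilityMeasure G) :
    ((μ * ν : ProbabilityMeasure G) : Measure G) = (μ : Measure G).mconv ν := rfl

theorem toMeasure_one : ((1 : ProbabilityMeasure G) : Measure G) = Measure.dirac 1 := rfl

instance : ContinuousMul (ProbabilityMeasure G) where
  continuous_mul := by
    have : TopologicalSpace.MetrizableSpace G := TopologicalSpace.metrizableSpace_of_t3_secondCountable G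
    exact (ProbabilityMeasure.continuous_map (continuous_mul (M := G))).comp
      ProbabilityMeasure.continuous_prod

/-- Probability measures whose mean of a continuous function vanishing only at `1` tends to zero
converge to the Dirac mass at `1`. -/
theorem tendsto_one_of_integral_tendsto {d : G → ℝ} (hd : Continuous d) (hd0 : ∀ g, 0 ≤ d g)
    (hd1 : ∀ g, d g = 0 → g = 1) {ι : Type*} {F : Filter ι} {ν : ι → ProbabilityMeasure G}
    (h : Tendsto (fun i => ∫ g, d g ∂(ν i : Measure G)) F (𝓝 0)) : Tendsto ν F (𝓝 1) := by
  rw [ProbabilityMeasure.tendsto_iff_forall_integral_tendsto]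
  intro f
  rw [toMeasure_one, integral_dirac, Metric.tendsto_nhds]
  intro ε hε
  -- Where `f` differs from `f 1` by at least `ε / 2`, compactness bounds `d` below by a positive
  -- number, so a large multiple of `d` dominates `2 * ‖f‖` there.
  obtain ⟨K, hK, hfK⟩ : ∃ K, 0 ≤ K ∧ ∀ g, |f g - f 1| ≤ ε / 2 + K * d g := by
    have hc : IsCompact {g | ε / 2 ≤ |f g - f 1|} :=
      (isClosed_le continuous_const (by fun_prop)).isCompact
    rcases Set.eq_empty_or_nonempty {g | ε / 2 ≤ |f g - f 1|} with he | hne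
    · refine ⟨0, le_rfl, fun g => ?_⟩
      have : g ∉ {g | ε / 2 ≤ |f g - f 1|} := by simp [he]
      simp only [Set.mem_ofPred_eq, not_le] at this
      linarith
    · obtain ⟨g₀, hg₀, hmin⟩ := hc.exists_isMinOn hne hd.continuousOn
      have hpos : 0 < d g₀ := by
        refine (hd0 g₀).lt_of_ne fun h0 => ?_
        rw [Set.mem_ofPred_eq, hd1 g₀ h0.symm, sub_self, abs_zero] at hg₀
        linarith
      refine ⟨2 * ‖f‖ / d g₀, by positivity, fun g => ?_⟩
      rcases lt_or_ge |f g - f 1| (ε / 2) with hl | hl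
      · have : 0 ≤ 2 * ‖f‖ / d g₀ * d g := mul_nonneg (by positivity) (hd0 g)
        linarith
      · have h1 : |f g - f 1| ≤ 2 * ‖f‖ := by
          have := f.dist_le_two_norm g 1
          rwa [Real.dist_eq] at this
        have h2 : d g₀ ≤ d g := hmin hl
        have h3 : 2 * ‖f‖ ≤ 2 * ‖f‖ / d g₀ * d g := by
          rw [div_mul_eq_mul_div, le_div_iff₀ hpos]
          exact mul_le_mul_of_nonneg_left h2 (by positivity)
        linarith
  have h1 : ∀ᶠ i in F, K * ∫ g, d g ∂(ν i : Measure G) < ε / 2 := by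
    have h2 := h.const_mul K
    rw [mul_zero] at h2
    exact h2.eventually_lt_const (by linarith)
  filter_upwards [h1] with i hi
  have hdi : Integrable d (ν i : Measure G) :=
    hd.integrable_of_hasCompactSupport (HasCompactSupport.of_compactSpace d)
  have hfi : Integrable f (ν i : Measure G) := f.integrable _
  rw [Real.dist_eq]
  calc |∫ g, f g ∂(ν i : Measure G) - f 1| = |∫ g, (f g - f 1) ∂(ν i : Measure G)| := by
        rw [integral_sub hfi (integrable_const _)]
        simp
    _ ≤ ∫ g, |f g - f 1| ∂(ν i : Measure G) := abs_integral_le_integral_abs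
    _ ≤ ∫ g, (ε / 2 + K * d g) ∂(ν i : Measure G) :=
        integral_mono (hfi.sub (integrable_const _)).abs
          ((integrable_const _).add (hdi.const_mul K)) hfK
    _ = ε / 2 + K * ∫ g, d g ∂(ν i : Measure G) := by
        rw [integral_add (integrable_const _) (hdi.const_mul K), integral_const_mul]
        simp
    _ < ε := by linarith

/-- Limits along an ultrafilter of convolution powers with controlled spread form a convolution
semigroup. -/
theorem exists_isConvolutionSemigroup {d : G → ℝ} (hd : Continuous d) (hd0 : ∀ g, 0 ≤ d g)
    (hd1 : ∀ g, d g = 0 → g = 1) {m : ℕ → ProbabilityMeasure G} {τ : ℕ → ℝ≥0} (hτ : ∀ n, 0 < τ n)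
    (hτ0 : Tendsto τ atTop (𝓝 0)) {C : ℝ}
    (hC : ∀ (n k : ℕ), ∫ g, d g ∂((m n ^ k : ProbabilityMeasure G) : Measure G) ≤ C * (k * τ n)) :
    ∃ μ : ℝ≥0 → ProbabilityMeasure G, IsConvolutionSemigroup (fun t => (μ t : Measure G)) ∧
      ∀ t, Tendsto (fun n => m n ^ ⌊t / τ n⌋₊) (hyperfilter ℕ) (𝓝 (μ t)) := by
  have hat : ((hyperfilter ℕ : Ultrafilter ℕ) : Filter ℕ) ≤ atTop := Nat.hyperfilter_le_atTop
  -- Probability measures on a compact group form a compact space. One ultrafilter serves every `t`,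
  -- so the limits at different times are compatible.
  have hlim : ∀ t : ℝ≥0, ∃ μ : ProbabilityMeasure G,
      Tendsto (fun n => m n ^ ⌊t / τ n⌋₊) (hyperfilter ℕ) (𝓝 μ) := by
    intro t
    obtain ⟨μ, -, hμ⟩ := isCompact_univ.ultrafilter_le_nhds
      ((hyperfilter ℕ).map fun n => m n ^ ⌊t / τ n⌋₊) (by simp)
    exact ⟨μ, hμ⟩
  choose μ hμ using hlim
  have hT2 : T2Space (ProbabilityMeasure G) := by
    have : TopologicalSpace.MetrizableSpace G := TopologicalSpace.metrizableSpace_of_t3_secondCountable G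
    infer_instance
  have hdnn : ∀ ν : ProbabilityMeasure G, 0 ≤ ∫ g, d g ∂(ν : Measure G) := fun ν =>
    integral_nonneg hd0
  have hD : ∀ t, ∫ g, d g ∂(μ t : Measure G) ≤ C * t := by
    intro t
    have h1 := (ProbabilityMeasure.tendsto_iff_forall_integral_tendsto.mp (hμ t))
      (BoundedContinuousFunction.mkOfCompact ⟨d, hd⟩)
    have hC0 : 0 ≤ C := by
      have h2 := (hdnn _).trans (hC 0 1)
      rw [Nat.cast_one, one_mul] at h2
      exact nonneg_of_mul_nonneg_left h2 (hτ 0)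
    refine le_of_tendsto h1 (Eventually.of_forall fun n => (hC n ⌊t / τ n⌋₊).trans ?_)
    refine mul_le_mul_of_nonneg_left ?_ hC0
    have h3 : (⌊t / τ n⌋₊ : ℝ≥0) ≤ t / τ n := Nat.floor_le (zero_le)
    rw [le_div_iff₀ (hτ n)] at h3
    exact_mod_cast h3
  have h0 : μ 0 = 1 := by
    refine tendsto_nhds_unique (hμ 0) ?_
    simp
  refine ⟨μ, ⟨fun t => inferInstance, by rw [h0, toMeasure_one], fun s t => ?_, fun f => ?_⟩, hμ⟩
  -- Floors are additive up to a defect of `0` or `1`; the surplus factor `m n ^ e n` has mean of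
  -- `d` at most `|C| * τ n`, hence tends to the unit mass at `1`.
  · set e : ℕ → ℕ := fun n => ⌊(s + t) / τ n⌋₊ - (⌊s / τ n⌋₊ + ⌊t / τ n⌋₊) with he
    have h1 : ∀ n, ⌊s / τ n⌋₊ + ⌊t / τ n⌋₊ ≤ ⌊(s + t) / τ n⌋₊ := by
      intro n
      rw [add_div]
      exact Nat.le_floor (by
        push_cast
        exact add_le_add (Nat.floor_le (zero_le)) (Nat.floor_le (zero_le)))
    have h2 : ∀ n, e n ≤ 1 := by
      intro n
      have h3 : ⌊(s + t) / τ n⌋₊ < ⌊s / τ n⌋₊ + ⌊t / τ n⌋₊ + 2 := by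
        rw [Nat.floor_lt (zero_le), add_div]
        have := Nat.lt_floor_add_one (s / τ n)
        have := Nat.lt_floor_add_one (t / τ n)
        push_cast
        calc s / τ n + t / τ n < (⌊s / τ n⌋₊ + 1) + (⌊t / τ n⌋₊ + 1) := by gcongr
          _ = _ := by ring
      simp only [he]
      omega
    have h4 : Tendsto (fun n => m n ^ e n) (hyperfilter ℕ) (𝓝 1) := by
      refine tendsto_one_of_integral_tendsto hd hd0 hd1 ?_
      have h5 : Tendsto (fun n => |C| * (τ n : ℝ)) (hyperfilter ℕ : Ultrafilter ℕ) (𝓝 0) := by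
        have := ((NNReal.tendsto_coe.mpr hτ0).const_mul |C|).mono_left hat
        simpa using this
      refine squeeze_zero (fun n => hdnn _) (fun n => (hC n _).trans ?_) h5
      calc C * (e n * τ n) ≤ |C| * (1 * τ n) := by
            gcongr
            · exact le_abs_self C
            · exact_mod_cast h2 n
        _ = |C| * τ n := by rw [one_mul]
    have h6 := ((hμ s).mul (hμ t)).mul h4
    rw [mul_one] at h6
    rw [← toMeasure_mul]
    congr 1
    refine tendsto_nhds_unique (hμ (s + t)) (h6.congr fun n => ?_)
    rw [← pow_add, ← pow_add, he]
    simp only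
    congr 1
    have := h1 n
    omega
  · have h1 : Tendsto μ (𝓝[>] 0) (𝓝 1) := by
      refine tendsto_one_of_integral_tendsto hd hd0 hd1 ?_
      have h5 : Tendsto (fun t : ℝ≥0 => C * (t : ℝ)) (𝓝[>] 0) (𝓝 0) := by
        have h6 : Continuous fun t : ℝ≥0 => C * (t : ℝ) := by fun_prop
        have := (h6.tendsto 0).mono_left (nhdsWithin_le_nhds (s := Set.Ioi 0))
        simpa using this
      exact squeeze_zero (fun n => hdnn _) hD h5
    have h2 := ProbabilityMeasure.tendsto_iff_forall_integral_tendsto.mp h1 f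
    rwa [toMeasure_one, integral_dirac] at h2

end Convolution

end ConvolutionSemigroups

/-! ### Linear rates from successive square roots. -/

section Rates

section Rate

theorem norm_one_sub_pow_le {R : Type*} [NormedRing R] [NormOneClass R] {M : R} (hM : ‖M‖ ≤ 1)
    (k : ℕ) : ‖1 - M ^ k‖ ≤ k * ‖1 - M‖ := by
  induction k with
  | zero => simp
  | succ k ih =>
    have h1 : 1 - M ^ (k + 1) = (1 - M ^ k) + M ^ k * (1 - M) := by
      rw [pow_succ]
      noncomm_ring
    have h2 : ‖M ^ k‖ ≤ 1 := (norm_pow_le M k).trans (pow_le_one₀ (norm_nonneg _) hM)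
    calc ‖1 - M ^ (k + 1)‖ ≤ ‖1 - M ^ k‖ + ‖M ^ k‖ * ‖1 - M‖ := by
          rw [h1]
          exact (norm_add_le _ _).trans (by gcongr; exact norm_mul_le _ _)
      _ ≤ k * ‖1 - M‖ + 1 * ‖1 - M‖ := by gcongr
      _ = _ := by push_cast; ring

/-- The defects `x n = T n - 1` of successive square roots `T (n + 1) ^ 2 = T n` near `1` decrease
geometrically. -/
theorem exists_norm_le_of_add_sq {R : Type*} [NormedRing R] [NormedAlgebra ℝ R] {x : ℕ → R}
    (hx : ∀ n, x n = x (n + 1) + x (n + 1) + x (n + 1) * x (n + 1)) (h1 : ∀ n, ‖x n‖ < 1) :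
    ∃ C, ∀ n, ‖x n‖ ≤ C / 2 ^ n := by
  refine ⟨‖x 0‖ / (1 - ‖x 0‖), fun n => ?_⟩
  -- The quantity `r / (1 - r)` at least halves at each step, without loss of constants: from `‖x n‖
  -- ≥ r * (2 - r) = 1 - (1 - r) ^ 2` its value at `n` is at least `r * (2 - r) / (1 - r) ^ 2 ≥ 2 *
  -- r / (1 - r)`.
  have hy : ∀ n, ‖x n‖ / (1 - ‖x n‖) ≤ ‖x 0‖ / (1 - ‖x 0‖) / 2 ^ n := by
    intro n
    induction n with
    | zero => simp
    | succ n ih =>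
      set r := ‖x (n + 1)‖ with hr
      have hr0 : 0 ≤ r := norm_nonneg _
      have hr1 : r < 1 := h1 (n + 1)
      have h2 : r * (2 - r) ≤ ‖x n‖ := by
        have h3 : x (n + 1) + x (n + 1) = x n - x (n + 1) * x (n + 1) := by
          rw [hx n]
          abel
        have h4 : 2 * r ≤ ‖x n‖ + r * r := by
          have h5 : ‖x (n + 1) + x (n + 1)‖ = 2 * r := by
            rw [hr, ← two_smul ℝ, norm_smul, Real.norm_two]
          rw [← h5, h3]
          exact (norm_sub_le _ _).trans (by gcongr; exact norm_mul_le _ _)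
        linarith
      have h6 : 2 * (r / (1 - r)) ≤ ‖x n‖ / (1 - ‖x n‖) := by
        have h7 : 0 < 1 - r := by linarith
        have h8 : 0 < 1 - ‖x n‖ := by linarith [h1 n]
        rw [mul_div_assoc', div_le_div_iff₀ h7 h8]
        nlinarith [mul_le_mul_of_nonneg_right h2 (by linarith : 0 ≤ 1 + r),
          mul_nonneg (mul_nonneg hr0 hr0) h7.le]
      rw [pow_succ, ← div_div, le_div_iff₀ two_pos]
      linarith
  refine le_trans ?_ (hy n)
  rw [le_div_iff₀ (by linarith [h1 n])]
  nlinarith [norm_nonneg (x n)]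

end Rate

end Rates

/-! ### Choosing group elements near the identity. -/

section MixturesNearIdentity

variable {H : Type*} [NormedAddCommGroup H] [InnerProductSpace ℂ H] [CompleteSpace H]
  (b : OrthonormalBasis (Fin 2) ℂ H)

theorem abs_re_opTrace_le (b : OrthonormalBasis (Fin 2) ℂ H) (A : H →L[ℂ] H) :
    |(opTrace A).re| ≤ 2 * ‖A‖ := by
  have h1 : opTrace A = ∑ i, inner ℂ (b i) (A (b i)) := by
    obtain ⟨M, rfl⟩ := exists_matOp b A
    simp only [inner_matOp_apply, opTrace_matOp]
    rfl
  have h2 : ∀ i, ‖inner ℂ (b i) (A (b i))‖ ≤ ‖A‖ := fun i => by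
    refine (norm_inner_le_norm _ _).trans ?_
    have := A.le_opNorm (b i)
    rw [b.norm_eq_one, mul_one] at this
    rwa [b.norm_eq_one, one_mul]
  refine (Complex.abs_re_le_norm _).trans ?_
  rw [h1]
  refine (norm_sum_le_of_le _ fun i _ => h2 i).trans ?_
  simp

theorem norm_pauliOp (j : Fin 3) : ‖pauliOp b j‖ = 1 := by
  have := nontrivial_of_basis b
  have h := CStarRing.norm_star_mul_self (x := pauliOp b j)
  rw [star_pauliOp, pauliOp_mul_self, norm_one] at h
  nlinarith [norm_nonneg (pauliOp b j)]

/-- Averaging over `1` and the Pauli operators is the completely depolarizing channel. It serves to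
recover a unitary, weighted by its trace, from its action on the Pauli operators. -/
theorem add_sum_pauliOp_mul (A : H →L[ℂ] H) :
    A + ∑ j, pauliOp b j * A * pauliOp b j = (2 * opTrace A) • 1 := by
  obtain ⟨M, rfl⟩ := exists_matOp b A
  have h : M + ∑ j, pauli j * M * pauli j = (2 * M.trace) • 1 := by
    ext i j
    fin_cases i <;> fin_cases j <;>
      simp [pauli, Fin.sum_univ_three, Matrix.trace_fin_two, Matrix.mul_apply, Fin.sum_univ_two,
        Matrix.vecMul, Matrix.vecHead, Matrix.vecTail] <;>
      ring_nf <;> simp <;> ring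
  simp only [pauliOp, ← map_mul, ← map_sum, ← map_add, h, matOp_smul, opTrace_matOp, map_one]

/-- The real part of the upper left entry, that is, one half of the trace. -/
def halfTrace (g : SU2) : ℝ := ((g : Matrix (Fin 2) (Fin 2) ℂ) 0 0).re

theorem coe_SU2_one_one (g : SU2) : (g : Matrix (Fin 2) (Fin 2) ℂ) 1 1 =
    star ((g : Matrix (Fin 2) (Fin 2) ℂ) 0 0) := by
  set M := (g : Matrix (Fin 2) (Fin 2) ℂ) with hM
  obtain ⟨h1, h2⟩ := Matrix.mem_specialUnitaryGroup_iff.mp g.2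
  have h3 : star M = M.adjugate := by
    calc star M = star M * (M * M.adjugate) := by rw [Matrix.mul_adjugate, h2, one_smul, mul_one]
      _ = M.adjugate := by rw [← mul_assoc, Matrix.mem_unitaryGroup_iff'.mp h1, one_mul]
  have h4 := congrFun (congrFun h3 0) 0
  rw [Matrix.adjugate_fin_two] at h4
  simpa using h4.symm

theorem opTrace_definingRep (g : SU2) :
    opTrace (definingRep b g : H →L[ℂ] H) = ((2 * halfTrace g : ℝ) : ℂ) := by
  change opTrace (matOp b g) = _
  rw [opTrace_matOp, Matrix.trace_fin_two, coe_SU2_one_one]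
  apply Complex.ext <;> simp [halfTrace, two_mul]

theorem norm_sq_column (g : SU2) : ‖(g : Matrix (Fin 2) (Fin 2) ℂ) 0 0‖ ^ 2 +
    ‖(g : Matrix (Fin 2) (Fin 2) ℂ) 1 0‖ ^ 2 = 1 := by
  have h1 := Matrix.mem_unitaryGroup_iff'.mp (Matrix.mem_specialUnitaryGroup_iff.mp g.2).1
  have h2 := congrArg Complex.re (congrFun (congrFun h1 0) 0)
  rw [Complex.sq_norm, Complex.sq_norm, Complex.normSq_apply, Complex.normSq_apply]
  simpa [Matrix.mul_apply, Fin.sum_univ_two] using h2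

theorem norm_sq_row (g : SU2) : ‖(g : Matrix (Fin 2) (Fin 2) ℂ) 0 0‖ ^ 2 +
    ‖(g : Matrix (Fin 2) (Fin 2) ℂ) 0 1‖ ^ 2 = 1 := by
  have h1 := Matrix.mem_unitaryGroup_iff.mp (Matrix.mem_specialUnitaryGroup_iff.mp g.2).1
  have h2 := congrArg Complex.re (congrFun (congrFun h1 0) 0)
  rw [Complex.sq_norm, Complex.sq_norm, Complex.normSq_apply, Complex.normSq_apply]
  simpa [Matrix.mul_apply, Fin.sum_univ_two] using h2

theorem halfTrace_le_one (g : SU2) : halfTrace g ≤ 1 := by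
  refine (Complex.re_le_norm _).trans ?_
  nlinarith [norm_sq_column g, norm_nonneg ((g : Matrix (Fin 2) (Fin 2) ℂ) 0 0)]

/-- The unit length of the first row and column leaves no room for other entries. Thus `1 -
halfTrace` is a gauge of distance from `1`. -/
theorem eq_one_of_halfTrace_eq_one {g : SU2} (h : halfTrace g = 1) : g = 1 := by
  have h1 := norm_sq_column g
  have h2 := norm_sq_row g
  have h3 : 1 ≤ ‖(g : Matrix (Fin 2) (Fin 2) ℂ) 0 0‖ := h ▸ Complex.re_le_norm _
  have h4 : ‖(g : Matrix (Fin 2) (Fin 2) ℂ) 1 0‖ = 0 := by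
    have : ‖(g : Matrix (Fin 2) (Fin 2) ℂ) 1 0‖ ^ 2 ≤ 0 := by nlinarith
    exact pow_eq_zero_iff two_ne_zero |>.mp (le_antisymm this (sq_nonneg _))
  have h5 : ‖(g : Matrix (Fin 2) (Fin 2) ℂ) 0 1‖ = 0 := by
    have : ‖(g : Matrix (Fin 2) (Fin 2) ℂ) 0 1‖ ^ 2 ≤ 0 := by nlinarith
    exact pow_eq_zero_iff two_ne_zero |>.mp (le_antisymm this (sq_nonneg _))
  have h6 : (g : Matrix (Fin 2) (Fin 2) ℂ) 0 0 = 1 := by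
    rw [h4, Complex.sq_norm, Complex.normSq_apply] at h1
    unfold halfTrace at h
    rw [h] at h1
    apply Complex.ext
    · simpa using h
    · rw [Complex.one_im]
      nlinarith
  have h7 : (g : Matrix (Fin 2) (Fin 2) ℂ) 1 1 = 1 := by rw [coe_SU2_one_one, h6, star_one]
  ext i j
  fin_cases i <;> fin_cases j
  · simpa using h6
  · simpa using h5
  · simpa using h4
  · simpa using h7

theorem halfTrace_negOne_mul (g : SU2) : halfTrace (negOne * g) = - halfTrace g := by
  simp [halfTrace, negOne]

theorem continuous_halfTrace : Continuous halfTrace :=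
  Complex.continuous_re.comp ((continuous_apply_apply 0 0).comp continuous_subtype_val)

/-- The group elements of a mixture can be chosen near `1` if the mixture is near the identity. -/
theorem exists_mixture_near_one {g : Fin 4 → SU2} {p : Fin 4 → ℝ≥0} (hp : ∑ a, p a = 1)
    {ε : ℝ} (hε : ∀ j, ‖mixture b g p 0 (pauliOp b j) - pauliOp b j‖ ≤ ε) :
    ∃ g' : Fin 4 → SU2, mixture b g' p 0 = mixture b g p 0 ∧
      ‖1 - ∑ a, (p a : ℝ) • (definingRep b (g' a) : H →L[ℂ] H)‖ ≤ 2 * ε := by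
  -- Conjugation does not see the sign, so the representative closer to `1` can be taken.
  set g' : Fin 4 → SU2 := fun a => if 0 ≤ halfTrace (g a) then g a else negOne * g a with hg'
  have ha : ∀ a, 0 ≤ halfTrace (g' a) := by
    intro a
    simp only [hg']
    split_ifs with h
    · exact h
    · rw [halfTrace_negOne_mul]
      linarith
  have hadj : ∀ a, adj (definingRep b (g' a)) = adj (definingRep b (g a)) := by
    intro a
    simp only [hg']
    split_ifs
    · rfl
    · exact adj_negOne_mul b _
  have hmix : mixture b g' p 0 = mixture b g p 0 := by
    ext1 A
    simp only [mixture_apply, hadj]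
  have hp' : ∑ a, (p a : ℝ) = 1 := by exact_mod_cast hp
  refine ⟨g', hmix, ?_⟩
  set U : Fin 4 → (H →L[ℂ] H) := fun a => (definingRep b (g' a) : H →L[ℂ] H) with hU
  -- Each summand is even in `g' a`, so `Y` is determined by the mixture: `4 Y = 1 + ∑ Φ(σ_j) σ_j`
  -- with `Φ` the mixture, whence `‖1 - Y‖ ≤ ε`.
  set Y : H →L[ℂ] H := ∑ a, ((p a : ℝ) * halfTrace (g' a)) • U a with hY
  have h1 : ∀ a, 1 + ∑ j, adj (definingRep b (g' a)) (pauliOp b j) * pauliOp b j =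
      (4 * halfTrace (g' a)) • U a := by
    intro a
    have h2 := congrArg (fun A => U a * A) (add_sum_pauliOp_mul b (star (U a)))
    have h3 : U a * star (U a) = 1 := Unitary.mul_star_self_of_mem (definingRep b (g' a)).2
    simp only [mul_add, Finset.mul_sum, h3, mul_smul_comm, mul_one] at h2
    rw [opTrace_star b, opTrace_definingRep] at h2
    have h4 : ∀ j, adj (definingRep b (g' a)) (pauliOp b j) * pauliOp b j =
        U a * (pauliOp b j * star (U a) * pauliOp b j) := fun j => by
      rw [adj, Unitary.conjStarAlgAut_apply]
      simp only [mul_assoc]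
      rfl
    simp only [h4]
    rw [h2, ← Complex.coe_smul]
    congr 1
    simp
    ring
  have h5 : (4 : ℝ) • (1 - Y) = ∑ j, (pauliOp b j - mixture b g p 0 (pauliOp b j)) * pauliOp b j := by
    have h6 : (4 : ℝ) • Y = 1 + ∑ j, mixture b g p 0 (pauliOp b j) * pauliOp b j := by
      have h7 : (4 : ℝ) • Y = ∑ a, (p a : ℝ) •
          (1 + ∑ j, adj (definingRep b (g' a)) (pauliOp b j) * pauliOp b j) := by
        simp only [h1, hY, Finset.smul_sum, smul_smul]
        refine Finset.sum_congr rfl fun a _ => ?_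
        congr 1
        ring
      rw [h7]
      simp only [smul_add, Finset.sum_add_distrib, ← Finset.sum_smul, hp', one_smul]
      congr 1
      rw [← hmix]
      simp only [mixture_apply, Pi.zero_apply, zero_smul, Finset.sum_const_zero, add_zero,
        Finset.sum_mul, smul_mul_assoc, Finset.smul_sum]
      rw [Finset.sum_comm]
      rfl
    simp only [sub_mul, Finset.sum_sub_distrib, pauliOp_mul_self]
    rw [smul_sub, h6]
    simp only [Finset.sum_const, Finset.card_univ, Fintype.card_fin]
    module
  have hY1 : ‖1 - Y‖ ≤ ε := by
    have h8 : ‖(4 : ℝ) • (1 - Y)‖ ≤ 3 * ε := by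
      rw [h5]
      refine (norm_sum_le_of_le (f := fun j => (pauliOp b j - mixture b g p 0 (pauliOp b j)) * pauliOp b j) (n := fun _ => ε) _ fun j _ => ?_).trans (by simp)
      refine (norm_mul_le _ _).trans ?_
      rw [norm_pauliOp, mul_one, norm_sub_rev]
      exact hε j
    rw [norm_smul, Real.norm_eq_abs, abs_of_pos (by norm_num)] at h8
    linarith [norm_nonneg (1 - Y)]
  -- Half the trace of `1 - Y`.
  have h9 : ∑ a, (p a : ℝ) * (1 - halfTrace (g' a) ^ 2) ≤ ε := by
    have h10 : (opTrace (1 - Y)).re = 2 * ∑ a, (p a : ℝ) * (1 - halfTrace (g' a) ^ 2) := by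
      have h11 : opTrace Y = ((2 * ∑ a, (p a : ℝ) * halfTrace (g' a) ^ 2 : ℝ) : ℂ) := by
        rw [← opTraceₗ_apply, hY, map_sum]
        simp only [opTraceₗ_apply, opTrace_real_smul, hU, opTrace_definingRep]
        push_cast
        rw [Finset.mul_sum]
        refine Finset.sum_congr rfl fun a _ => ?_
        ring
      rw [opTrace_sub, opTrace_one b, h11, Complex.sub_re, Complex.ofReal_re]
      simp only [mul_sub, Finset.sum_sub_distrib, mul_one, hp']
      simp
    have h12 := (le_abs_self _).trans (abs_re_opTrace_le b (1 - Y))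
    rw [h10] at h12
    linarith
  -- Half traces lie in `[0, 1]` by the choice of signs, so `1 - h ≤ 1 - h ^ 2` and the preceding
  -- bound applies.
  have h13 : ‖Y - ∑ a, (p a : ℝ) • U a‖ ≤ ε := by
    refine le_trans ?_ h9
    rw [hY, ← Finset.sum_sub_distrib]
    refine norm_sum_le_of_le _ fun a _ => ?_
    rw [← sub_smul, norm_smul]
    have h14 : ‖U a‖ ≤ 1 := by
      have := nontrivial_of_basis b
      exact (CStarRing.norm_of_mem_unitary (definingRep b (g' a)).2).le
    have h15 : (p a : ℝ) * halfTrace (g' a) - p a = -(p a * (1 - halfTrace (g' a))) := by ring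
    have h16 := halfTrace_le_one (g' a)
    rw [h15, norm_neg, Real.norm_eq_abs, abs_of_nonneg (mul_nonneg (p a).coe_nonneg (sub_nonneg.mpr h16))]
    calc (p a : ℝ) * (1 - halfTrace (g' a)) * ‖U a‖ ≤ p a * (1 - halfTrace (g' a)) * 1 := by
          gcongr
      _ ≤ _ := by
          rw [mul_one]
          refine mul_le_mul_of_nonneg_left ?_ (p a).2
          nlinarith [ha a]
  calc ‖1 - ∑ a, (p a : ℝ) • U a‖ = ‖(1 - Y) + (Y - ∑ a, (p a : ℝ) • U a)‖ := by
        congr 1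
        abel
    _ ≤ ‖1 - Y‖ + ‖Y - ∑ a, (p a : ℝ) • U a‖ := norm_add_le _ _
    _ ≤ 2 * ε := by linarith

end MixturesNearIdentity

/-! ### Means over convolution powers; semigroups of maps. -/

section SemigroupsAndMeans

variable {H : Type*} [NormedAddCommGroup H] [InnerProductSpace ℂ H] [CompleteSpace H]
  (b : OrthonormalBasis (Fin 2) ℂ H)

section Mean

variable {G : Type*} [Group G] [TopologicalSpace G] [IsTopologicalGroup G] [CompactSpace G]
  [T2Space G] [SecondCountableTopology G] [MeasurableSpace G] [BorelSpace G]

theorem integrable_of_continuous_compact {V : Type*} [NormedAddCommGroup V] {f : G → V}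
    (hf : Continuous f) (ν : Measure G) [IsFiniteMeasure ν] : Integrable f ν :=
  hf.integrable_of_hasCompactSupport (HasCompactSupport.of_compactSpace f)

theorem integral_mul_measure {V : Type*} [NormedAddCommGroup V] [NormedSpace ℝ V] {f : G → V}
    (hf : Continuous f) (μ ν : ProbabilityMeasure G) :
    ∫ g, f g ∂((μ * ν : ProbabilityMeasure G) : Measure G) =
      ∫ x, ∫ y, f (x * y) ∂(ν : Measure G) ∂(μ : Measure G) :=
  integral_mconv (μ := (μ : Measure G)) (ν := (ν : Measure G))
    (integrable_of_continuous_compact hf _)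

variable [FiniteDimensional ℂ H] {π : G →* unitary (H →L[ℂ] H)} (hπ : Continuous π)

theorem integral_rep_pow {π : G →* unitary (H →L[ℂ] H)} (hπ : Continuous π) (μ : ProbabilityMeasure G) (k : ℕ) :
    ∫ g, (π g : H →L[ℂ] H) ∂((μ ^ k : ProbabilityMeasure G) : Measure G) =
      (∫ g, (π g : H →L[ℂ] H) ∂(μ : Measure G)) ^ k := by
  have hc : Continuous fun g => (π g : H →L[ℂ] H) := continuous_subtype_val.comp hπ
  induction k with
  | zero => simp [toMeasure_one]
  | succ k ih =>
    rw [pow_succ, integral_mul_measure hc, pow_succ, ← ih]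
    simp only [map_mul, Submonoid.coe_mul]
    have hi := integrable_of_continuous_compact hc (μ : Measure G)
    have hik := integrable_of_continuous_compact hc ((μ ^ k : ProbabilityMeasure G) : Measure G)
    simp only [integral_const_mul_of_integrable hi]
    exact integral_mul_const_of_integrable hik

theorem twirl_pow (μ : ProbabilityMeasure G) (k : ℕ) :
    twirl hπ.measurable ((μ ^ k : ProbabilityMeasure G) : Measure G) =
      (twirl hπ.measurable (μ : Measure G)) ^ k := by
  have hc : ∀ A : H →L[ℂ] H, Continuous fun g => adj (π g) A := by
    intro A
    have h : Continuous fun U : H →L[ℂ] H => U * A * star U := by fun_prop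
    exact h.comp (continuous_subtype_val.comp hπ)
  induction k with
  | zero =>
    ext1 A
    rw [twirl_apply, pow_zero, pow_zero, toMeasure_one, integral_dirac, map_one, adj, map_one]
    rfl
  | succ k ih =>
    ext1 A
    rw [pow_succ, pow_succ, twirl_apply, integral_mul_measure (hc A), ← ih]
    change _ = ∫ x, adj (π x) (twirl hπ.measurable (μ : Measure G) A) ∂_
    refine integral_congr_ae (ae_of_all _ fun x => ?_)
    have h2 := continuousLinearMap_twirl hπ.measurable (μ : Measure G)
      (LinearMap.toContinuousLinearMap (adjₗ (π x))) A
    simp only [LinearMap.coe_toContinuousLinearMap', adjₗ_apply] at h2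
    refine Eq.trans (integral_congr_ae (ae_of_all _ fun y => ?_)) h2.symm
    simp only [map_mul, adj]
    rfl

end Mean

section Semigroups

variable [FiniteDimensional ℂ H] {Λ : ℝ≥0 → (H →L[ℂ] H) →ₗ[ℂ] (H →L[ℂ] H)}

theorem IsSemigroup.tendsto_nhds_zero {H : Type*} [NormedAddCommGroup H] [InnerProductSpace ℂ H]
    {Λ : ℝ≥0 → (H →L[ℂ] H) →ₗ[ℂ] (H →L[ℂ] H)} (hΛ : IsSemigroup Λ) (A : H →L[ℂ] H) :
    Tendsto (fun t => Λ t A) (𝓝 0) (𝓝 A) := by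
  have h1 : Tendsto (fun t => Λ t A) (𝓝[≠] 0) (𝓝 A) := by
    have : ({0}ᶜ : Set ℝ≥0) = Set.Ioi 0 := by
      ext t
      simp [pos_iff_ne_zero]
    rw [this]
    exact hΛ.tendsto_zero A
  rw [← nhdsNE_sup_pure, tendsto_sup]
  refine ⟨h1, tendsto_pure_left.mpr fun s hs => ?_⟩
  rw [hΛ.map_zero]
  exact mem_of_mem_nhds hs

theorem IsSemigroup.map_nsmul {H : Type*} [NormedAddCommGroup H] [InnerProductSpace ℂ H]
    {Λ : ℝ≥0 → (H →L[ℂ] H) →ₗ[ℂ] (H →L[ℂ] H)} (hΛ : IsSemigroup Λ) (τ : ℝ≥0) (k : ℕ) :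
    Λ (k * τ) = Λ τ ^ k := by
  induction k with
  | zero => rw [Nat.cast_zero, zero_mul, hΛ.map_zero, pow_zero]; rfl
  | succ k ih =>
    rw [Nat.cast_add, Nat.cast_one, add_mul, one_mul, hΛ.map_add, ih, pow_succ]
    rfl

theorem norm_mixture_le (g : Fin 4 → SU2) {p : Fin 4 → ℝ≥0} (hp : ∑ a, p a = 1) (A : H →L[ℂ] H) :
    ‖mixture b g p 0 A‖ ≤ ‖A‖ := by
  have hp' : ∑ a, (p a : ℝ) = 1 := by exact_mod_cast hp
  rw [mixture_apply]
  simp only [Pi.zero_apply, zero_smul, Finset.sum_const_zero, add_zero]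
  refine (norm_sum_le_of_le (n := fun a => p a * ‖A‖) _ fun a _ => ?_).trans_eq ?_
  · rw [NNReal.smul_def, norm_smul, norm_adj]
    simp
  · rw [← Finset.sum_mul, hp', one_mul]

/-- Along suitable dyadic times the maps of a semigroup are close to the identity at a linear
rate. -/
theorem IsSemigroup.exists_rate (hΛ : IsSemigroup Λ) : ∃ (τ : ℕ → ℝ≥0) (C : ℝ),
    (∀ n, 0 < τ n) ∧ Tendsto τ atTop (𝓝 0) ∧ 0 ≤ C ∧
      ∀ n A, ‖Λ (τ n) A - A‖ ≤ C * τ n * ‖A‖ := by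
  set T : ℝ≥0 → (H →L[ℂ] H) →L[ℂ] (H →L[ℂ] H) := fun t => LinearMap.toContinuousLinearMap (Λ t)
  -- In finite dimension, convergence on the vectors of a basis bounds the operator norm.
  have hT : ∀ᶠ t in 𝓝 0, ‖T t - 1‖ < 1 := by
    obtain ⟨v⟩ : Nonempty (Module.Basis (Fin (Module.finrank ℂ (H →L[ℂ] H))) ℂ (H →L[ℂ] H)) :=
      ⟨Module.finBasis ℂ (H →L[ℂ] H)⟩
    obtain ⟨C, hC, hv⟩ := v.exists_opNorm_le (F := H →L[ℂ] H)
    have h1 : ∀ᶠ t in 𝓝 (0 : ℝ≥0), ∀ i, ‖Λ t (v i) - v i‖ < 1 / (2 * C) := by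
      refine eventually_all.mpr fun i => ?_
      have h2 := hΛ.tendsto_nhds_zero (v i)
      rw [tendsto_iff_norm_sub_tendsto_zero] at h2
      exact h2.eventually_lt_const (by positivity)
    filter_upwards [h1] with t ht
    have h3 : ∀ i, ‖(T t - 1) (v i)‖ ≤ 1 / (2 * C) := fun i => (ht i).le
    refine (hv (by positivity) h3).trans_lt ?_
    rw [one_div, mul_inv, mul_left_comm, mul_inv_cancel₀ hC.ne']
    norm_num
  obtain ⟨δ, hδ, hδT⟩ : ∃ δ : ℝ≥0, 0 < δ ∧ ∀ t ≤ δ, ‖T t - 1‖ < 1 := by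
    obtain ⟨ε, hε, h⟩ := Metric.eventually_nhds_iff.mp hT
    refine ⟨⟨ε / 2, by positivity⟩, by exact_mod_cast half_pos hε, fun t ht => h ?_⟩
    rw [NNReal.dist_eq, NNReal.coe_zero, sub_zero, abs_of_nonneg t.coe_nonneg]
    have : (t : ℝ) ≤ ε / 2 := ht
    linarith
  have hx : ∀ t, T (t + t) - 1 = (T t - 1) + (T t - 1) + (T t - 1) * (T t - 1) := by
    intro t
    have : T (t + t) = T t * T t := by
      ext1 A
      change Λ (t + t) A = Λ t (Λ t A)
      rw [hΛ.map_add]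
      rfl
    rw [this, sub_mul, mul_sub, one_mul, mul_one]
    abel
  have h2n : ∀ n : ℕ, δ / 2 ^ n ≤ δ := fun n => div_le_self (zero_le) (one_le_pow₀ one_le_two)
  -- The maps at the times `δ / 2 ^ n` are successive square roots, which yields a linear rate
  -- without a generator.
  obtain ⟨C, hC⟩ := exists_norm_le_of_add_sq (x := fun n => T (δ / 2 ^ n) - 1)
    (fun n => by
      rw [← hx, pow_succ, ← div_div, add_halves])
    fun n => hδT _ (h2n n)
  have hC0 : 0 ≤ C := by simpa using (norm_nonneg _).trans (hC 0)
  refine ⟨fun n => δ / 2 ^ n, C / δ, fun n => by positivity, ?_, by positivity, fun n A => ?_⟩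
  · have h3 : Tendsto (fun n => δ * (1 / 2 : ℝ≥0) ^ n) atTop (𝓝 (δ * 0)) :=
      (NNReal.tendsto_pow_atTop_nhds_zero_of_lt_one (by
        rw [div_lt_one two_pos]; exact one_lt_two)).const_mul δ
    rw [mul_zero] at h3
    refine h3.congr fun n => ?_
    rw [one_div, inv_pow, div_eq_mul_inv]
  · refine ((T (δ / 2 ^ n) - 1).le_opNorm A).trans ?_
    refine mul_le_mul_of_nonneg_right ((hC n).trans_eq ?_) (norm_nonneg A)
    push_cast
    have : (δ : ℝ) ≠ 0 := by exact_mod_cast hδ.ne'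
    field_simp

end Semigroups

end SemigroupsAndMeans

/-! ### Completely positive semigroups are twirling semigroups. -/

section TwirlingSemigroups

variable {H : Type*} [NormedAddCommGroup H] [InnerProductSpace ℂ H] [CompleteSpace H]
  (b : OrthonormalBasis (Fin 2) ℂ H)

section Twirling

variable [FiniteDimensional ℂ H] {Λ : ℝ≥0 → (H →L[ℂ] H) →ₗ[ℂ] (H →L[ℂ] H)}

/-- Floors of `t / τ`, times `τ`, approximate `t`. -/
theorem IsSemigroup.tendsto_floor (hΛ : IsSemigroup Λ) (hle : ∀ t A, ‖Λ t A‖ ≤ ‖A‖)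
    {τ : ℕ → ℝ≥0} (hτ : ∀ n, 0 < τ n) (hτ0 : Tendsto τ atTop (𝓝 0)) (t : ℝ≥0) (A : H →L[ℂ] H) :
    Tendsto (fun n => Λ (⌊t / τ n⌋₊ * τ n) A) atTop (𝓝 (Λ t A)) := by
  have h1 : ∀ n, ∃ e, t = ⌊t / τ n⌋₊ * τ n + e ∧ e ≤ τ n := by
    intro n
    have h2 : (⌊t / τ n⌋₊ : ℝ≥0) * τ n ≤ t :=
      (le_div_iff₀ (hτ n)).mp (Nat.floor_le zero_le)
    have h3 : t ≤ (⌊t / τ n⌋₊ + 1 : ℝ≥0) * τ n :=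
      (div_le_iff₀ (hτ n)).mp (Nat.lt_floor_add_one _).le
    refine ⟨t - ⌊t / τ n⌋₊ * τ n, (add_tsub_cancel_of_le h2).symm, ?_⟩
    rw [tsub_le_iff_left]
    rwa [add_mul, one_mul] at h3
  choose e he heτ using h1
  have h4 : Tendsto e atTop (𝓝 0) := tendsto_of_tendsto_of_tendsto_of_le_of_le tendsto_const_nhds
    hτ0 (fun _ => zero_le) heτ
  have h5 := tendsto_iff_norm_sub_tendsto_zero.mp ((hΛ.tendsto_nhds_zero A).comp h4)
  rw [tendsto_iff_norm_sub_tendsto_zero]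
  refine squeeze_zero (fun _ => norm_nonneg _) (fun n => ?_) h5
  have h6 : Λ t A = Λ (⌊t / τ n⌋₊ * τ n) (Λ (e n) A) := by
    conv_lhs => rw [he n, hΛ.map_add]
    rfl
  rw [h6, ← map_sub]
  refine (hle _ _).trans ?_
  rw [norm_sub_rev]
  exact le_rfl

variable {G : Type*} [Group G] [TopologicalSpace G] [IsTopologicalGroup G] [CompactSpace G]
  [T2Space G] [SecondCountableTopology G] [MeasurableSpace G] [BorelSpace G]

/-- Completely positive semigroups are twirling semigroups, for any group isomorphic to
`SU(2)`. -/
theorem exists_isConvolutionSemigroup_twirl (q : G ≃* SU2) (hq : Continuous q)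
    (hΛ : IsSemigroup Λ)
    (hcp : ∀ t, ∃ (g : Fin 4 → SU2) (p : Fin 4 → ℝ≥0), ∑ a, p a = 1 ∧ Λ t = mixture b g p 0) :
    ∃ μ : ℝ≥0 → Measure G, IsConvolutionSemigroup μ ∧ ∀ t A, Λ t A =
      ∫ g, adj (definingRep b (q g)) A ∂(μ t) := by
  obtain ⟨τ, C, hτ, hτ0, hC0, hC⟩ := hΛ.exists_rate
  set π : G →* unitary (H →L[ℂ] H) := (definingRep b).comp q.toMonoidHom with hπ'
  have hπ : Continuous π := (continuous_definingRep b).comp hq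
  have hle : ∀ t A, ‖Λ t A‖ ≤ ‖A‖ := by
    intro t A
    obtain ⟨g, p, hp, h⟩ := hcp t
    rw [h]
    exact norm_mixture_le b g hp A
  -- Besides reproducing `Λ (τ n)`, the measure must have its mean representation near `1`: its
  -- convolution powers could otherwise drift to `-1` unnoticed by the twirls.
  have hm : ∀ n, ∃ m : ProbabilityMeasure G, twirl hπ.measurable (m : Measure G) = Λ (τ n) ∧
      ‖1 - ∫ g, (π g : H →L[ℂ] H) ∂(m : Measure G)‖ ≤ 2 * (C * τ n) ∧
      ‖∫ g, (π g : H →L[ℂ] H) ∂(m : Measure G)‖ ≤ 1 := by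
    intro n
    obtain ⟨g, p, hp, h⟩ := hcp (τ n)
    obtain ⟨g', hg', hM⟩ := exists_mixture_near_one b hp (ε := C * τ n) fun j => by
      have := hC n (pauliOp b j)
      rwa [norm_pauliOp, mul_one, h] at this
    have hpr : IsProbabilityMeasure (atomMeasure p fun a => q.symm (g' a)) := ⟨by
      rw [atomMeasure_univ]
      exact_mod_cast hp⟩
    obtain ⟨m, hm⟩ : ∃ m : ProbabilityMeasure G,
        (m : Measure G) = atomMeasure p fun a => q.symm (g' a) := ⟨⟨_, hpr⟩, rfl⟩
    refine ⟨m, ?_, ?_, ?_⟩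
    · ext1 A
      rw [h, ← hg', mixture_apply, twirl_apply, hm, integral_atomMeasure]
      simp [hπ']
    · rw [hm, integral_atomMeasure]
      simpa [hπ', NNReal.smul_def] using hM
    · have := nontrivial_of_basis b
      refine (norm_integral_le_of_norm_le_const (C := 1) (ae_of_all _ fun x => ?_)).trans (by simp)
      exact (CStarRing.norm_of_mem_unitary (π x).2).le
  choose m hmΛ hm1 hm2 using hm
  -- This function is affine in `π g`, so its mean over a convolution power is computed from the
  -- power of the mean operator, where the telescoping bound for contractions applies.
  have hd : Continuous fun g => 1 - halfTrace (q g) :=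
    continuous_const.sub (continuous_halfTrace.comp hq)
  obtain ⟨μ, hμ, hlim⟩ := exists_isConvolutionSemigroup (G := G) (C := 2 * C) hd
    (fun g => sub_nonneg.mpr (halfTrace_le_one _))
    (fun g hg => by
      have := eq_one_of_halfTrace_eq_one (sub_eq_zero.mp hg).symm
      exact (map_eq_one_iff q q.injective).mp this) (m := m) hτ hτ0 fun n k => by
      have hi := integrable_of_continuous_compact (continuous_subtype_val.comp hπ)
        ((m n ^ k : ProbabilityMeasure G) : Measure G)
      have h1 : ∫ g, (1 - halfTrace (q g)) ∂((m n ^ k : ProbabilityMeasure G) : Measure G) =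
          (opTrace (1 - (∫ g, (π g : H →L[ℂ] H) ∂(m n : Measure G)) ^ k)).re / 2 := by
        set F : (H →L[ℂ] H) →L[ℝ] ℝ := Complex.reCLM.comp
          ((LinearMap.toContinuousLinearMap (opTraceₗ H)).restrictScalars ℝ) with hF
        have hF' : ∀ A, F A = (opTrace A).re := fun _ => rfl
        have h2 := F.integral_comp_comm hi
        simp only [Function.comp_apply] at h2
        rw [integral_rep_pow hπ, hF'] at h2
        have h3 : ∀ g, F (π g : H →L[ℂ] H) = 2 * halfTrace (q g) := fun g => by
          rw [hF']
          change (opTrace (definingRep b (q g) : H →L[ℂ] H)).re = _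
          rw [opTrace_definingRep, Complex.ofReal_re]
        simp only [h3, integral_const_mul] at h2
        have hi2 : Integrable (fun g => halfTrace (q g))
            ((m n ^ k : ProbabilityMeasure G) : Measure G) :=
          integrable_of_continuous_compact (continuous_halfTrace.comp hq) _
        rw [integral_sub (integrable_const _) hi2, opTrace_sub,
          opTrace_one b, Complex.sub_re, ← h2]
        simp
        ring
      rw [h1]
      have := nontrivial_of_basis b
      have h4 := (le_abs_self _).trans (abs_re_opTrace_le b
        (1 - (∫ g, (π g : H →L[ℂ] H) ∂(m n : Measure G)) ^ k))
      have h5 := norm_one_sub_pow_le (hm2 n) k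
      have h6 := mul_le_mul_of_nonneg_left (hm1 n) (Nat.cast_nonneg (α := ℝ) k)
      linarith
  refine ⟨fun t => μ t, hμ, fun t A => ?_⟩
  have hcA : Continuous fun g => adj (π g) A := by
    have h : Continuous fun U : H →L[ℂ] H => U * A * star U := by fun_prop
    exact h.comp (continuous_subtype_val.comp hπ)
  change _ = twirl hπ.measurable (μ t : Measure G) A
  -- Weak convergence of measures concerns scalar functions, hence the test by functionals.
  rw [SeparatingDual.eq_iff_forall_dual_eq (R := ℂ)]
  intro F
  have h1 : Tendsto (fun n => F (Λ (⌊t / τ n⌋₊ * τ n) A)) (hyperfilter ℕ : Ultrafilter ℕ)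
      (𝓝 (F (Λ t A))) :=
    (F.continuous.tendsto _).comp
      ((hΛ.tendsto_floor hle hτ hτ0 t A).mono_left Nat.hyperfilter_le_atTop)
  refine tendsto_nhds_unique h1 ?_
  have h2 := (ProbabilityMeasure.tendsto_iff_forall_integral_rclike_tendsto ℂ).mp (hlim t)
    (BoundedContinuousFunction.mkOfCompact ⟨fun g => F (adj (π g) A), F.continuous.comp hcA⟩)
  simp only [BoundedContinuousFunction.mkOfCompact_apply, ContinuousMap.coe_mk] at h2
  have h3 := continuousLinearMap_twirl hπ.measurable (μ t : Measure G) F A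
  rw [← h3] at h2
  refine h2.congr fun n => ?_
  have h4 := continuousLinearMap_twirl hπ.measurable
    ((m n ^ ⌊t / τ n⌋₊ : ProbabilityMeasure G) : Measure G) F A
  rw [← h4, twirl_pow hπ, hmΛ, hΛ.map_nsmul]

end Twirling

end TwirlingSemigroups

/-! ### Entropies as functions of the Bloch length. -/

section EntropyMonotonicity

variable {H : Type*} [NormedAddCommGroup H] [InnerProductSpace ℂ H] [CompleteSpace H]
  (b : OrthonormalBasis (Fin 2) ℂ H)

section Contraction

/-- For a positive operator `A`, `‖A‖ ≤ r` means `0 ≤ r - A`, which is again decided by the Bloch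
cone. -/
theorem norm_smul_one_add_bloch {c : ℝ} (w : E3) (h : ‖w‖ ≤ c) :
    ‖c • (1 : H →L[ℂ] H) + bloch b w‖ = c + ‖w‖ := by
  have hA := (smul_one_add_bloch_nonneg_iff b c w).mpr h
  have h1 : ∀ r, 0 ≤ r → (‖c • (1 : H →L[ℂ] H) + bloch b w‖ ≤ r ↔ c + ‖w‖ ≤ r) := by
    intro r hr
    rw [CStarAlgebra.norm_le_iff_le_algebraMap _ hr hA, ← sub_nonneg,
      Algebra.algebraMap_eq_smul_one]
    have h2 : r • (1 : H →L[ℂ] H) - (c • 1 + bloch b w) = (r - c) • 1 + bloch b (-w) := by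
      rw [map_neg]
      module
    rw [h2, smul_one_add_bloch_nonneg_iff, norm_neg, le_sub_iff_add_le, add_comm]
  have h3 : 0 ≤ c + ‖w‖ := add_nonneg ((norm_nonneg w).trans h) (norm_nonneg w)
  exact le_antisymm ((h1 _ h3).mpr le_rfl) ((h1 _ (norm_nonneg _)).mp le_rfl)

/-- Positive, trace-preserving and unital maps contract the Bloch ball. -/
theorem IsPTU.exists_bloch {Φ : (H →L[ℂ] H) →ₗ[ℂ] (H →L[ℂ] H)} (hΦ : IsPTU Φ)
    (b : OrthonormalBasis (Fin 2) ℂ H) (c : ℝ) (w : E3) :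
    ∃ w', Φ (c • 1 + bloch b w) = c • 1 + bloch b w' ∧ ‖w'‖ ≤ ‖w‖ := by
  have hone : Φ 1 = 1 := hΦ.2.2
  have hs : ∀ (c : ℝ), Φ (c • 1 + bloch b w) = c • 1 + Φ (bloch b w) := fun c => by
    rw [map_add, ← Complex.coe_smul, map_smul, hone]
  -- The shift `‖w‖` puts the operator on the boundary of the cone; trace preservation keeps this
  -- shift, so positivity of the image reads `‖w'‖ ≤ ‖w‖`.
  have h1 := isPositiveMap_iff.mp hΦ.1 _ ((smul_one_add_bloch_nonneg_iff b ‖w‖ w).mpr le_rfl)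
  obtain ⟨c', w', hw', hc'⟩ := exists_smul_one_add_bloch b h1.isSelfAdjoint.star_eq
  have h2 : c' = ‖w‖ := by
    rw [hΦ.2.1, opTrace_add, opTrace_real_smul, opTrace_one b, opTrace_bloch] at hc'
    have := congrArg Complex.re hc'
    simp at this
    linarith
  rw [h2] at hw'
  refine ⟨w', ?_, ?_⟩
  · rw [hs, add_right_inj]
    rw [hs] at hw'
    exact add_left_cancel hw'
  · rwa [hw', smul_one_add_bloch_nonneg_iff] at h1

theorem IsDensity.exists_bloch {ρ : H →L[ℂ] H} (hρ : IsDensity ρ)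
    (b : OrthonormalBasis (Fin 2) ℂ H) :
    ∃ w, ρ = (1 / 2 : ℝ) • 1 + bloch b w ∧ ‖w‖ ≤ 1 / 2 := by
  have h0 := (ContinuousLinearMap.nonneg_iff_isPositive ρ).mpr hρ.1
  obtain ⟨c, w, hw, hc⟩ := exists_smul_one_add_bloch b h0.isSelfAdjoint.star_eq
  have h2 : c = 1 / 2 := by
    rw [hρ.2] at hc
    have := congrArg Complex.re hc
    simp at this
    linarith
  subst h2
  exact ⟨w, hw, (smul_one_add_bloch_nonneg_iff b _ w).mp (hw ▸ h0)⟩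

theorem isDensity_half (b : OrthonormalBasis (Fin 2) ℂ H) :
    IsDensity ((1 / 2 : ℝ) • (1 : H →L[ℂ] H)) := by
  refine ⟨(ContinuousLinearMap.nonneg_iff_isPositive _).mp (smul_nonneg (by norm_num) zero_le_one),
    ?_⟩
  rw [opTrace_real_smul, opTrace_one b]
  norm_num

end Contraction

section Convexity

theorem strictAntiOn_of_strictConcaveOn {φ : ℝ → ℝ} (h : StrictConcaveOn ℝ (Set.Ici 0) φ) :
    StrictAntiOn (fun r => φ (1 / 2 + r) + φ (1 / 2 - r)) (Set.Icc 0 (1 / 2)) := by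
  intro r hr s hs hrs
  have hs0 : 0 < s := hr.1.trans_lt hrs
  have hne : 1 / 2 + s ≠ 1 / 2 - s := by
    intro h
    linarith
  have hx : (1 / 2 + s) ∈ Set.Ici (0 : ℝ) := Set.mem_Ici.mpr (by linarith)
  have hy : (1 / 2 - s) ∈ Set.Ici (0 : ℝ) := Set.mem_Ici.mpr (by linarith [hs.2])
  -- With weights `(1 ± r / s) / 2`, the points `1 / 2 ± r` are convex combinations of `1 / 2 ± s`;
  -- the weights are exchanged between the two, so the inequalities add up to the claim.
  have ha : 0 < (1 + r / s) / 2 := by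
    have := div_nonneg hr.1 hs0.le
    linarith
  have hb : 0 < (1 - r / s) / 2 := by
    have := (div_lt_one hs0).mpr hrs
    linarith
  have h1 := h.2 hx hy hne ha hb (by ring)
  have h2 := h.2 hx hy hne hb ha (by ring)
  have e : s * (r / s) = r := mul_div_cancel₀ r hs0.ne'
  have e1 : ((1 + r / s) / 2) • (1 / 2 + s) + ((1 - r / s) / 2) • (1 / 2 - s) = 1 / 2 + r := by
    simp only [smul_eq_mul]
    linear_combination e
  have e2 : ((1 - r / s) / 2) • (1 / 2 + s) + ((1 + r / s) / 2) • (1 / 2 - s) = 1 / 2 - r := by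
    simp only [smul_eq_mul]
    linear_combination -e
  rw [e1] at h1
  rw [e2] at h2
  simp only [smul_eq_mul] at h1 h2
  simp only
  linarith

theorem strictMonoOn_of_strictConvexOn {φ : ℝ → ℝ} (h : StrictConvexOn ℝ (Set.Ici 0) φ) :
    StrictMonoOn (fun r => φ (1 / 2 + r) + φ (1 / 2 - r)) (Set.Icc 0 (1 / 2)) := by
  intro r hr s hs hrs
  have := strictAntiOn_of_strictConcaveOn h.neg hr hs hrs
  simp only [Pi.neg_apply] at this
  simp only
  linarith

end Convexity

section Entropies

variable [FiniteDimensional ℂ H]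

theorem charpoly_matOp (M : Matrix (Fin 2) (Fin 2) ℂ) :
    LinearMap.charpoly (matOp b M : H →ₗ[ℂ] H) = M.charpoly := by
  have h : (matOp b M : H →ₗ[ℂ] H) =
      b.repr.symm.toLinearEquiv.conj (Matrix.toLpLin 2 2 M) := by
    ext x
    simp [matOp]
    rfl
  rw [h, LinearEquiv.charpoly_conj, Matrix.toLpLin_eq_toLin, Matrix.charpoly_toLin]

theorem eigenvalues_bloch (c : ℝ) (w : E3) :
    eigenvalues (c • (1 : H →L[ℂ] H) + bloch b w) = {c + ‖w‖, c - ‖w‖} := by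
  set N : Matrix (Fin 2) (Fin 2) ℂ := !![(c : ℂ) + w 2, w 0 - w 1 * Complex.I;
    w 0 + w 1 * Complex.I, c - w 2] with hN
  have h1 : c • (1 : H →L[ℂ] H) + bloch b w = matOp b N := by
    rw [bloch_eq_matOp, ← map_one (matOp b), ← Complex.coe_smul, ← matOp_smul, ← map_add]
    congr 1
    ext i j
    fin_cases i <;> fin_cases j <;> simp [hN] <;> ring
  have h2 : ((‖w‖ : ℂ)) ^ 2 = w 0 ^ 2 + w 1 ^ 2 + w 2 ^ 2 := by
    have := EuclideanSpace.real_norm_sq_eq w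
    rw [Fin.sum_univ_three] at this
    exact_mod_cast this
  have h3 : N.charpoly = (Polynomial.X - Polynomial.C ((c + ‖w‖ : ℝ) : ℂ)) *
      (Polynomial.X - Polynomial.C ((c - ‖w‖ : ℝ) : ℂ)) := by
    have ht : N.trace = ((c + ‖w‖ : ℝ) : ℂ) + ((c - ‖w‖ : ℝ) : ℂ) := by
      simp [hN, Matrix.trace_fin_two]
    have hdet : N.det = ((c + ‖w‖ : ℝ) : ℂ) * ((c - ‖w‖ : ℝ) : ℂ) := by
      rw [Matrix.det_fin_two]
      simp [hN]
      linear_combination h2 + (w 1 : ℂ) ^ 2 * Complex.I_sq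
    rw [Matrix.charpoly_fin_two, ht, hdet, map_add, map_mul]
    ring
  rw [eigenvalues, h1, charpoly_matOp, h3, Polynomial.roots_mul
    (mul_ne_zero (Polynomial.X_sub_C_ne_zero _) (Polynomial.X_sub_C_ne_zero _)),
    Polynomial.roots_X_sub_C, Polynomial.roots_X_sub_C, Multiset.map_add, Multiset.map_singleton,
    Multiset.map_singleton, Complex.ofReal_re, Complex.ofReal_re]
  rfl

theorem sum_eigenvalues_bloch (φ : ℝ → ℝ) (w : E3) :
    ((eigenvalues ((1 / 2 : ℝ) • (1 : H →L[ℂ] H) + bloch b w)).map φ).sum =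
      φ (1 / 2 + ‖w‖) + φ (1 / 2 - ‖w‖) := by
  rw [eigenvalues_bloch]
  simp

theorem rpow_sum_pos (q : ℝ) {r : ℝ} (hr : r ∈ Set.Icc (0 : ℝ) (1 / 2)) :
    0 < (1 / 2 + r) ^ q + (1 / 2 - r) ^ q :=
  add_pos_of_pos_of_nonneg (Real.rpow_pos_of_pos (by linarith [hr.1]) q)
    (Real.rpow_nonneg (by linarith [hr.2]) q)

/-- The entropies are strictly decreasing functions of the length of the Bloch vector. -/
theorem IsEntropy.exists_strictAntiOn {E : (H →L[ℂ] H) → ℝ} (hE : IsEntropy E) :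
    ∃ f : ℝ → ℝ, StrictAntiOn f (Set.Icc 0 (1 / 2)) ∧
      ∀ w : E3, ‖w‖ ≤ 1 / 2 → E ((1 / 2 : ℝ) • 1 + bloch b w) = f ‖w‖ := by
  have hvN : ∃ f : ℝ → ℝ, StrictAntiOn f (Set.Icc 0 (1 / 2)) ∧ ∀ w : E3, ‖w‖ ≤ 1 / 2 →
      vonNeumannEntropy ((1 / 2 : ℝ) • (1 : H →L[ℂ] H) + bloch b w) = f ‖w‖ :=
    ⟨_, strictAntiOn_of_strictConcaveOn Real.strictConcaveOn_negMulLog,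
      fun w _ => sum_eigenvalues_bloch b _ w⟩
  rcases hE with ⟨q, hq⟩ | ⟨q, hq⟩ | ⟨p, hp⟩
  · unfold tsallisEntropy
    split_ifs with h1
    · exact hvN
    · refine ⟨fun r => 1 / (1 - q) * ((1 / 2 + r) ^ q + (1 / 2 - r) ^ q - 1), ?_,
        fun w _ => by rw [sum_eigenvalues_bloch]⟩
      intro r hr s hs hrs
      rcases lt_or_gt_of_ne h1 with hlt | hgt
      · have h2 := strictAntiOn_of_strictConcaveOn (Real.strictConcaveOn_rpow hq hlt) hr hs hrs
        have h3 : 0 < 1 / (1 - q) := one_div_pos.mpr (by linarith)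
        exact mul_lt_mul_of_pos_left (sub_lt_sub_right h2 1) h3
      · have h2 := strictMonoOn_of_strictConvexOn (strictConvexOn_rpow hgt) hr hs hrs
        have h3 : 1 / (1 - q) < 0 := one_div_neg.mpr (by linarith)
        exact mul_lt_mul_of_neg_left (sub_lt_sub_right h2 1) h3
  · unfold renyiEntropy
    split_ifs with h1
    · exact hvN
    · refine ⟨fun r => 1 / (1 - q) * Real.log ((1 / 2 + r) ^ q + (1 / 2 - r) ^ q), ?_,
        fun w _ => by rw [sum_eigenvalues_bloch]⟩
      intro r hr s hs hrs
      rcases lt_or_gt_of_ne h1 with hlt | hgt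
      · have h2 := strictAntiOn_of_strictConcaveOn (Real.strictConcaveOn_rpow hq hlt) hr hs hrs
        have h3 : 0 < 1 / (1 - q) := one_div_pos.mpr (by linarith)
        exact mul_lt_mul_of_pos_left (Real.log_lt_log (rpow_sum_pos q hs) h2) h3
      · have h2 := strictMonoOn_of_strictConvexOn (strictConvexOn_rpow hgt) hr hs hrs
        have h3 : 1 / (1 - q) < 0 := one_div_neg.mpr (by linarith)
        exact mul_lt_mul_of_neg_left (Real.log_lt_log (rpow_sum_pos q hr) h2) h3
  · unfold schattenEntropy
    split_ifs with h1
    · refine ⟨fun r => 1 - (1 / 2 + r), fun r _ s _ hrs => ?_, fun w hw => by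
        rw [norm_smul_one_add_bloch b w hw]⟩
      simp only
      linarith
    · have hp' : 1 < p.toReal := by
        rw [← ENNReal.toReal_one]
        exact (ENNReal.toReal_lt_toReal ENNReal.one_ne_top h1).mpr hp
      refine ⟨fun r => 1 - ((1 / 2 + r) ^ p.toReal + (1 / 2 - r) ^ p.toReal) ^ (1 / p.toReal),
        fun r hr s hs hrs => ?_, fun w _ => by rw [sum_eigenvalues_bloch]⟩
      have h2 := strictMonoOn_of_strictConvexOn (strictConvexOn_rpow hp') hr hs hrs
      exact sub_lt_sub_left (Real.rpow_lt_rpow (rpow_sum_pos _ hr).le h2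
        (one_div_pos.mpr (by linarith))) 1

/-- The maximally mixed state is the unique maximizer of `E`, so it has to stay fixed, which is
unitality. Conversely, a unital map shortens Bloch vectors. -/
theorem doesNotDecrease_iff {E : (H →L[ℂ] H) → ℝ} (b : OrthonormalBasis (Fin 2) ℂ H)
    (hE : IsEntropy E) {Λ : ℝ≥0 → (H →L[ℂ] H) →ₗ[ℂ] (H →L[ℂ] H)} (hΛ : IsSemigroup Λ)
    (h : ∀ t, IsPositiveMap (Λ t) ∧ IsTracePreserving (Λ t)) :
    DoesNotDecrease E Λ ↔ ∀ t, IsPTU (Λ t) := by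
  obtain ⟨f, hf, hEf⟩ := hE.exists_strictAntiOn b
  have hden : ∀ t ρ, IsDensity ρ → IsDensity (Λ t ρ) := fun t ρ hρ =>
    ⟨(h t).1 ρ hρ.1, ((h t).2 ρ).trans hρ.2⟩
  constructor
  · refine fun hd t => ⟨(h t).1, (h t).2, ?_⟩
    have h1 := hd _ (isDensity_half b) 0 t
    obtain ⟨w, hw, hw1⟩ := (hden t _ (isDensity_half b)).exists_bloch b
    have h2 : E ((1 / 2 : ℝ) • 1) = f 0 := by
      have := hEf 0 (by rw [norm_zero]; norm_num)
      rwa [map_zero, add_zero, norm_zero] at this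
    rw [zero_add, hΛ.map_zero, LinearMap.id_apply, h2, hw, hEf w hw1] at h1
    have h3 : ‖w‖ = 0 := by
      by_contra hne
      have hpos := (norm_nonneg w).lt_of_ne' hne
      exact absurd (hf ⟨le_rfl, by norm_num⟩ ⟨norm_nonneg w, hw1⟩ hpos) (not_lt.mpr h1)
    rw [norm_eq_zero.mp h3, map_zero, add_zero, ← Complex.coe_smul, map_smul] at hw
    exact smul_right_injective _ (by norm_num) hw
  · intro hp ρ hρ t s
    obtain ⟨w, hw, hw1⟩ := (hden t ρ hρ).exists_bloch b
    obtain ⟨w', hw', hle⟩ := (hp s).exists_bloch b (1 / 2) w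
    have h1 : Λ (t + s) ρ = Λ s (Λ t ρ) := by
      rw [add_comm, hΛ.map_add]
      rfl
    rw [h1, hw, hw', hEf w hw1, hEf w' (hle.trans hw1)]
    exact hf.antitoneOn ⟨norm_nonneg _, hle.trans hw1⟩ ⟨norm_nonneg _, hw1⟩ hle

end Entropies

end EntropyMonotonicity

/-! ### The equivalences and the main theorem. -/

section MainEquivalences

variable {H : Type*} [NormedAddCommGroup H] [InnerProductSpace ℂ H] [CompleteSpace H]
  (b : OrthonormalBasis (Fin 2) ℂ H)

section Forms

variable [FiniteDimensional ℂ H] {Λ : ℝ≥0 → (H →L[ℂ] H) →ₗ[ℂ] (H →L[ℂ] H)} {X : Type*} [MeasurableSpace X]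
  [MeasurableSingletonClass X] {π : X → unitary (H →L[ℂ] H)} {ι : SU2 → X}

theorem isProbabilityMeasure_atomMeasure {p : Fin 4 → ℝ≥0} (hp : ∑ a, p a = 1) (x : Fin 4 → X) :
    IsProbabilityMeasure (atomMeasure p x) := ⟨by
  rw [atomMeasure_univ]
  exact_mod_cast hp⟩

theorem exists_isPairForm_of_isPTU (hι : ∀ g, π (ι g) = definingRep b g)
    {J : H ≃ₛₗᵢ[starRingEnd ℂ] H} (hJ : IsComplexConjugation J) (h : ∀ t, IsPTU (Λ t)) :
    ∃ μ ν : ℝ≥0 → Measure X, IsPairForm J π μ ν Λ := by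
  choose g p m hpm hΛ using fun t => exists_mixture b (h t).1 (h t).2.1 (h t).2.2
  obtain ⟨x, y, hxy⟩ := exists_isPairForm b hι hJ hpm hΛ
  exact ⟨_, _, hxy⟩

theorem exists_prob_isPairForm (hι : ∀ g, π (ι g) = definingRep b g)
    {J : H ≃ₛₗᵢ[starRingEnd ℂ] H} (hJ : IsComplexConjugation J)
    (h : ∀ t, ∃ (g : Fin 4 → SU2) (p : Fin 4 → ℝ≥0), ∑ a, p a = 1 ∧ Λ t = mixture b g p 0) :
    ∃ μ ν : ℝ≥0 → Measure X, (∀ t, IsProbabilityMeasure (μ t)) ∧ IsPairForm J π μ ν Λ := by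
  choose g p hp hΛ using h
  obtain ⟨x, y, hxy⟩ := exists_isPairForm b hι hJ (m := fun _ => 0)
    (fun t => by simpa using hp t) hΛ
  exact ⟨_, _, fun t => isProbabilityMeasure_atomMeasure (hp t) _, hxy⟩

theorem exists_isSignedForm_of_isPTU (hπ : Measurable π) (hιi : Function.Injective ι)
    (hι : ∀ g, π (ι g) = definingRep b g) (k : Fin 3) (h : ∀ t, IsPTU (Λ t)) :
    ∃ σ : ℝ≥0 → SignedMeasure X, IsSignedForm b k π σ Λ := by
  choose g p m hpm hΛ using fun t => exists_mixture b (h t).1 (h t).2.1 (h t).2.2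
  obtain ⟨σ, x, y, -, hσ⟩ := exists_isSignedForm b hπ hιi hι k hpm hΛ
  exact ⟨σ, hσ⟩

theorem exists_prob_isSignedForm (hπ : Measurable π) (hιi : Function.Injective ι)
    (hι : ∀ g, π (ι g) = definingRep b g) (k : Fin 3)
    (h : ∀ t, ∃ (g : Fin 4 → SU2) (p : Fin 4 → ℝ≥0), ∑ a, p a = 1 ∧ Λ t = mixture b g p 0) :
    ∃ σ : ℝ≥0 → SignedMeasure X, IsProbabilityFamily σ ∧ IsSignedForm b k π σ Λ := by
  choose g p hp hΛ using h
  obtain ⟨σ, x, y, hσ, hf⟩ := exists_isSignedForm b hπ hιi hι k (m := fun _ => 0)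
    (fun t => by simpa using hp t) hΛ
  refine ⟨σ, fun t => ?_, hf⟩
  have := isProbabilityMeasure_atomMeasure (hp t) (x t)
  have h1 : σ t = (atomMeasure (p t) (x t)).toSignedMeasure := by
    have h0 : atomMeasure (0 : Fin 4 → ℝ≥0) (y t) = 0 := by simp [atomMeasure]
    have h2 : (atomMeasure (0 : Fin 4 → ℝ≥0) (y t)).toSignedMeasure = 0 := by
      ext s hs
      rw [Measure.toSignedMeasure_apply_measurable hs, h0]
      simp
    rw [hσ]
    exact (congrArg _ h2).trans (sub_zero _)
  rw [h1]
  refine ⟨Measure.zero_le_toSignedMeasure _, ?_⟩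
  rw [Measure.toSignedMeasure_apply_measurable MeasurableSet.univ]
  simp

end Forms

section Equivalences

variable {H : Type v} [NormedAddCommGroup H] [InnerProductSpace ℂ H] [CompleteSpace H]
  [FiniteDimensional ℂ H] (b : OrthonormalBasis (Fin 2) ℂ H) (k : Fin 3)
  {J : H ≃ₛₗᵢ[starRingEnd ℂ] H}

/-- The existential forms ask for a space in an arbitrary universe, supplied by the lift of SU(2);
this is why the constructions use a map `ι` from SU(2) to `X`. -/
theorem measurable_definingRep_down :
    Measurable fun x : ULift.{u} SU2 => definingRep b x.down :=
  (measurable_definingRep b).comp measurable_down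

theorem tfae_isPTU (hJ : IsComplexConjugation J)
    (Λ : ℝ≥0 → (H →L[ℂ] H) →ₗ[ℂ] (H →L[ℂ] H)) : List.TFAE [
    ∀ t, IsPTU (Λ t), HasSignedForm.{u} b k Λ, HasPairForm.{u} J Λ,
    ∃ σ : ℝ≥0 → SignedMeasure SU2, IsSignedForm b k (definingRep b) σ Λ,
    ∃ μ ν : ℝ≥0 → Measure SU2, IsPairForm J (definingRep b) μ ν Λ] := by
  tfae_have 1 → 2 := fun h => by
    obtain ⟨σ, hσ⟩ := exists_isSignedForm_of_isPTU b (measurable_definingRep_down b)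
      ULift.up_injective (fun _ => rfl) k h
    exact ⟨ULift.{u} SU2, inferInstance, inferInstance, inferInstance, inferInstance, _, σ,
      measurable_definingRep_down b, hσ⟩
  tfae_have 2 → 1 := fun ⟨X, _, _, _, _, π, σ, hπ, hσ⟩ => hσ.isPTU b hπ
  tfae_have 1 → 3 := fun h => by
    obtain ⟨μ, ν, hμ⟩ := exists_isPairForm_of_isPTU b (X := ULift.{u} SU2) (ι := ULift.up)
      (π := fun x => definingRep b x.down) (fun _ => rfl) hJ h
    exact ⟨ULift.{u} SU2, inferInstance, inferInstance, inferInstance, inferInstance, _, μ, ν,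
      measurable_definingRep_down b, hμ⟩
  tfae_have 3 → 1 := fun ⟨X, _, _, _, _, π, μ, ν, hπ, hμ⟩ => hμ.isPTU b hπ hJ
  tfae_have 1 → 4 := fun h => exists_isSignedForm_of_isPTU b (measurable_definingRep b)
    Function.injective_id (fun _ => rfl) k h
  tfae_have 4 → 1 := fun ⟨σ, hσ⟩ => hσ.isPTU b (measurable_definingRep b)
  tfae_have 1 → 5 := fun h => exists_isPairForm_of_isPTU b (ι := id) (fun _ => rfl) hJ h
  tfae_have 5 → 1 := fun ⟨μ, ν, hμ⟩ => hμ.isPTU b (measurable_definingRep b) hJ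
  tfae_finish

theorem exists_mixture_of_isCompletelyPositiveMap {Φ : (H →L[ℂ] H) →ₗ[ℂ] (H →L[ℂ] H)}
    (h : IsCompletelyPositiveMap Φ ∧ IsTracePreserving Φ ∧ IsUnitalMap Φ) :
    ∃ (g : Fin 4 → SU2) (p : Fin 4 → ℝ≥0), ∑ a, p a = 1 ∧ Φ = mixture b g p 0 :=
  exists_mixture_of_isTwoPositive b (isPositive_of_isCompletelyPositiveMap h.1)
    h.1.isTwoPositive h.2.1 h.2.2

theorem tfae_isCompletelyPositiveMap (hJ : IsComplexConjugation J)
    (Λ : ℝ≥0 → (H →L[ℂ] H) →ₗ[ℂ] (H →L[ℂ] H)) : List.TFAE [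
    ∀ t, IsCompletelyPositiveMap (Λ t) ∧ IsTracePreserving (Λ t) ∧ IsUnitalMap (Λ t),
    HasProbSignedForm.{u} b k Λ, HasProbPairForm.{u} J Λ,
    ∃ σ : ℝ≥0 → SignedMeasure SU2, IsProbabilityFamily σ ∧ IsSignedForm b k (definingRep b) σ Λ,
    ∃ μ ν : ℝ≥0 → Measure SU2, (∀ t, IsProbabilityMeasure (μ t)) ∧
      IsPairForm J (definingRep b) μ ν Λ] := by
  tfae_have 1 → 2 := fun h => by
    obtain ⟨σ, hσ⟩ := exists_prob_isSignedForm b (measurable_definingRep_down b)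
      ULift.up_injective (fun _ => rfl) k
      fun t => exists_mixture_of_isCompletelyPositiveMap b (h t)
    exact ⟨ULift.{u} SU2, inferInstance, inferInstance, inferInstance, inferInstance, _, σ,
      measurable_definingRep_down b, hσ⟩
  tfae_have 2 → 1 := fun ⟨X, _, _, _, _, π, σ, hπ, hσ1, hσ⟩ t =>
    ⟨hσ.isCompletelyPositiveMap b hπ hσ1 t, (hσ.isPTU b hπ t).2⟩
  tfae_have 1 → 3 := fun h => by
    obtain ⟨μ, ν, hμ⟩ := exists_prob_isPairForm b (X := ULift.{u} SU2) (ι := ULift.up)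
      (π := fun x => definingRep b x.down) (fun _ => rfl) hJ
      fun t => exists_mixture_of_isCompletelyPositiveMap b (h t)
    exact ⟨ULift.{u} SU2, inferInstance, inferInstance, inferInstance, inferInstance, _, μ, ν,
      measurable_definingRep_down b, hμ⟩
  tfae_have 3 → 1 := fun ⟨X, _, _, _, _, π, μ, ν, hπ, hμ1, hμ⟩ t =>
    ⟨hμ.isCompletelyPositiveMap b hπ hJ hμ1 t, (hμ.isPTU b hπ hJ t).2⟩
  tfae_have 1 → 4 := fun h => exists_prob_isSignedForm b (measurable_definingRep b)
    Function.injective_id (fun _ => rfl) k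
    fun t => exists_mixture_of_isCompletelyPositiveMap b (h t)
  tfae_have 4 → 1 := fun ⟨σ, hσ1, hσ⟩ t =>
    ⟨hσ.isCompletelyPositiveMap b (measurable_definingRep b) hσ1 t,
      (hσ.isPTU b (measurable_definingRep b) t).2⟩
  tfae_have 1 → 5 := fun h => exists_prob_isPairForm b (ι := id) (fun _ => rfl) hJ
    fun t => exists_mixture_of_isCompletelyPositiveMap b (h t)
  tfae_have 5 → 1 := fun ⟨μ, ν, hμ1, hμ⟩ t =>
    ⟨hμ.isCompletelyPositiveMap b (measurable_definingRep b) hJ hμ1 t,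
      (hμ.isPTU b (measurable_definingRep b) hJ t).2⟩
  tfae_finish

theorem isTwirlingSemigroup_of_isCompletelyPositiveMap
    (b : OrthonormalBasis (Fin 2) ℂ H) {Λ : ℝ≥0 → (H →L[ℂ] H) →ₗ[ℂ] (H →L[ℂ] H)} (hΛ : IsSemigroup Λ)
    (h : ∀ t, IsCompletelyPositiveMap (Λ t) ∧ IsTracePreserving (Λ t) ∧ IsUnitalMap (Λ t)) :
    IsTwirlingSemigroup.{u} Λ := by
  have : SecondCountableTopology (ULift.{u} SU2) :=
    Homeomorph.ulift.isEmbedding.secondCountableTopology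
  obtain ⟨μ, hμ, hΛμ⟩ := exists_isConvolutionSemigroup_twirl b (G := ULift.{u} SU2)
    MulEquiv.ulift continuous_uliftDown hΛ
    fun t => exists_mixture_of_isCompletelyPositiveMap b (h t)
  refine ⟨ULift.{u} SU2, inferInstance, inferInstance, inferInstance, inferInstance, inferInstance,
    inferInstance, inferInstance, inferInstance, (definingRep b).comp MulEquiv.ulift.toMonoidHom, μ,
    (continuous_definingRep b).comp continuous_uliftDown, hμ, fun t A => ?_⟩
  rw [hΛμ t A]
  simp only [adj, Unitary.conjStarAlgAut_apply]
  rfl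

end Equivalences

end MainEquivalences

end

end QubitSemigroup

theorem mainTheorem8 {H : Type v} [NormedAddCommGroup H] [InnerProductSpace ℂ H]
    [CompleteSpace H] [FiniteDimensional ℂ H]
    (b : OrthonormalBasis (Fin 2) ℂ H) (k : Fin 3)
    (J : H ≃ₛₗᵢ[starRingEnd ℂ] H) (hJ : QubitSemigroup.IsComplexConjugation J)
    (Λ : ℝ≥0 → (H →L[ℂ] H) →ₗ[ℂ] (H →L[ℂ] H)) (hΛ : QubitSemigroup.IsSemigroup Λ) :
    -- positive, trace-preserving and unital semigroups
    List.TFAE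
      [ ∀ t, QubitSemigroup.IsPositiveMap (Λ t) ∧ QubitSemigroup.IsTracePreserving (Λ t) ∧
          QubitSemigroup.IsUnitalMap (Λ t),
        QubitSemigroup.HasSignedForm.{u} b k Λ,
        QubitSemigroup.HasPairForm.{u} J Λ,
        ∃ σ : ℝ≥0 → SignedMeasure QubitSemigroup.SU2,
          QubitSemigroup.IsSignedForm b k (QubitSemigroup.definingRep b) σ Λ,
        ∃ μ ν : ℝ≥0 → Measure QubitSemigroup.SU2,
          QubitSemigroup.IsPairForm J (QubitSemigroup.definingRep b) μ ν Λ ] ∧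
    -- the completely positive case
    List.TFAE
      [ ∀ t, QubitSemigroup.IsCompletelyPositiveMap (Λ t) ∧
          QubitSemigroup.IsTracePreserving (Λ t) ∧ QubitSemigroup.IsUnitalMap (Λ t),
        QubitSemigroup.HasProbSignedForm.{u} b k Λ,
        QubitSemigroup.HasProbPairForm.{u} J Λ,
        ∃ σ : ℝ≥0 → SignedMeasure QubitSemigroup.SU2, QubitSemigroup.IsProbabilityFamily σ ∧
          QubitSemigroup.IsSignedForm b k (QubitSemigroup.definingRep b) σ Λ,
        ∃ μ ν : ℝ≥0 → Measure QubitSemigroup.SU2, (∀ t, IsProbabilityMeasure (μ t)) ∧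
          QubitSemigroup.IsPairForm J (QubitSemigroup.definingRep b) μ ν Λ ] ∧
    ((∀ t, QubitSemigroup.IsCompletelyPositiveMap (Λ t) ∧
        QubitSemigroup.IsTracePreserving (Λ t) ∧ QubitSemigroup.IsUnitalMap (Λ t)) →
      QubitSemigroup.IsTwirlingSemigroup.{u} Λ) ∧
    -- entropies
    (∀ E : (H →L[ℂ] H) → ℝ, QubitSemigroup.IsEntropy E →
      (∀ t, QubitSemigroup.IsPositiveMap (Λ t) ∧ QubitSemigroup.IsTracePreserving (Λ t)) →
      List.TFAE
        [ QubitSemigroup.DoesNotDecrease E Λ,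
          QubitSemigroup.HasSignedForm.{u} b k Λ,
          QubitSemigroup.HasPairForm.{u} J Λ ]) := by
  refine ⟨QubitSemigroup.tfae_isPTU b k hJ Λ, QubitSemigroup.tfae_isCompletelyPositiveMap b k hJ Λ,
    QubitSemigroup.isTwirlingSemigroup_of_isCompletelyPositiveMap b hΛ, fun E hE h => ?_⟩
  have h1 := QubitSemigroup.doesNotDecrease_iff b hE hΛ h
  have h2 := QubitSemigroup.tfae_isPTU.{u} b k hJ Λ
  tfae_have 1 ↔ 2 := h1.trans (h2.out 0 1)
  tfae_have 1 ↔ 3 := h1.trans (h2.out 0 2)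
  tfae_finish
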